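/- **Setting.** Let $G=SL(3,\mathbf R)$, $K=SO(3)$, $M_0=\{\mathrm{diag}(\varepsilon_1,\varepsilon_2,\varepsilon_1\varepsilon_2)\mid \varepsilon_i=\pm1\}$, let $A_0$ be the group of diagonal matrices in $G$ with positive entries, $N_0$ the group of unipotent upper triangular matrices, and $\mathfrak a_0$ the space of real diagonal matrices of trace $0$, with basis $H_1=\mathrm{diag}(1,0,-1)$, $H_2=\mathrm{diag}(0,1,-1)$. Let $\nu_0\in\mathrm{Hom}_{\mathbf R}(\mathfrak a_0,\mathbf C)$, and put $e^{\mu}(a)=a_1^{\mu(H_1)}a_2^{\mu(H_2)}$ for $\mu\in\mathrm{Hom}_{\mathbf R}(\mathfrak a_0,\mathbf C)$ and $a=\mathrm{diag}(a_1,a_2,a_3)\in A_0$, and $\rho_0(\mathrm{diag}(t_1,t_2,t_3))=t_1-t_3$. Let $\sigma_0$ be a character of $M_0$, and let $\sigma_{0,1},\sigma_{0,2}\in\{0,1\}$ be given by $\sigma_0(\mathrm{diag}(\varepsilon_1,\varepsilon_2,\varepsilon_1\varepsilon_2))=\varepsilon_1^{\sigma_{0,1}}\varepsilon_2^{\sigma_{0,2}}$.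 The principal series $\pi_{(\nu_0,\sigma_0)}$ is the right regular representation on $H_{(\nu_0,\sigma_0)}$, the completion of the space of smooth $f\colon G\to\mathbf C$ with $f(namx)=e^{\nu_0+\rho_0}(a)\sigma_0(m)f(x)$ ($n\in N_0$, $a\in A_0$, $m\in M_0$, $x\in G$) for the norm $\|f\|^2=\int_K|f(k)|^2\,dk$, where $dk$ is the normalized Haar measure of $K$. For $l\ge 0$ let $V_{2l}$ be the space of homogeneous polynomials of degree $2l$ in $\mathbf C[x,y]$, with standard basis $v_k^{(2l)}=x^ky^{2l-k}$ and dual basis $v_k^{(2l)*}$ ($0\le k\le 2l$). Let $\tau_{2l}$ be the representation of $SO(3)$ on $V_{2l}$ for which $\tau_{2l}(\varphi(g))f(x,y)=f(ax+by,-\bar bx+\bar ay)$ if $g\in SU(2)$ and $g^{-1}=\begin{pmatrix}a&b\\-\bar b&\bar a\end{pmatrix}$; here $\varphi\colon SU(2)\to SO(3)$ is the double covering given by conjugation on the pure quaternions, in the basis $\begin{pmatrix}i&0\\0&-i\end{pmatrix},\begin{pmatrix}0&1\\-1&0\end{pmatrix},\begin{pmatrix}0&i\\i&0\end{pmatrix}$.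 Let $V_{2l}^*[\sigma_0]$ be the $\sigma_0$-isotypic component of the restriction to $M_0$ of the dual representation $V_{2l}^*$. Equip $V_{2l}$ with the $K$-invariant inner product for which the $v_k^{(2l)}$ are orthogonal with $\|v_k^{(2l)}\|^2=\binom{2l}{k}^{-1}$, $V_{2l}^*$ with the dual inner product, and tensor products with the tensor product inner product. Put $\Phi_l(w\otimes v)(x)=\langle w,\tau_{2l}(x)v\rangle$, let $L^2_{(M_0,\sigma_0)}(K)$ be the space of $f\in L^2(K)$ such that, for each $m\in M_0$, $f(mx)=\sigma_0(m)f(x)$ for almost every $x\in K$, and let $r_K$ be the continuous extension to $H_{(\nu_0,\sigma_0)}$ of $f\mapsto f|_K$. Let $\varepsilon(\sigma_0;l)\in\{0,1\}$ with $\varepsilon(\sigma_0;l)\equiv l-\sigma_{0,1}-\sigma_{0,2}\pmod 2$, let $Z(\sigma_0;l)$ be the set of integers $k\equiv l-\sigma_{0,2}\pmod 2$ with $0\le k\le l$ if $\varepsilon(\sigma_0;l)=0$, and with $0\le k\le l-1$ if $\varepsilon(\sigma_0;l)=1$. For $p\in Z(\sigma_0;l)$ and $0\le q\le 2l$ put $$s(l;p,q)=r_K^{-1}\,\Phi_l\bigl((v^{(2l)*}_{2l-p}+(-1)^{\varepsilon(\sigma_0;l)}v^{(2l)*}_p)\otimes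 v_q^{(2l)}\bigr),$$ and let $\langle S(l;p)\rangle$ be the span of the $s(l;p,q)$, $0\le q\le 2l$. **Proposition.** The group $K$ acts on $H_{(\nu_0,\sigma_0)}$ by a (strongly continuous) unitary representation, and $r_K$ is an isometric isomorphism of $K$-modules from $H_{(\nu_0,\sigma_0)}$ onto $L^2_{(M_0,\sigma_0)}(K)$. The representations $\tau_{2l}$ are irreducible, and there is a unitary isomorphism of representations of $K$ $$\widehat{\bigoplus_{l\ge 0}}\;V_{2l}^*[\sigma_0]\otimes_{\mathbf C}V_{2l}\;\simeq\;H_{(\nu_0,\sigma_0)}$$ ($K$ acting on the factors $V_{2l}$), whose restriction to the $l$-th summand is a positive multiple of $r_K^{-1}\circ\Phi_l$. For $p\in Z(\sigma_0;l)$ the map $v_q^{(2l)}\mapsto s(l;p,q)$ defines an injective $K$-homomorphism from $V_{2l}$ to $H_{(\nu_0,\sigma_0)}$ (so that $\langle S(l;p)\rangle\simeq V_{2l}$), and the $\tau_{2l}$-isotypic component of $\pi_{(\nu_0,\sigma_0)}$ is the direct sum $\bigoplus_{p\in Z(\sigma_0;l)}\langle S(l;p)\rangle$. **Corollary.** Let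 $H_{(\nu_0,\sigma_0),K}$ be the space of $K$-finite vectors of $H_{(\nu_0,\sigma_0)}$. For every $l\ge0$ the space $\mathrm{Hom}_K(V_{2l},H_{(\nu_0,\sigma_0),K})$ is finite-dimensional, and its dimension is $$d(\sigma_0;l)=\begin{cases}(l+2)/2&\text{if }(\sigma_{0,1},\sigma_{0,2})=(0,0)\text{ and }l\text{ is even},\\(l-1)/2&\text{if }(\sigma_{0,1},\sigma_{0,2})=(0,0)\text{ and }l\text{ is odd},\\l/2&\text{if }(\sigma_{0,1},\sigma_{0,2})\ne(0,0)\text{ and }l\text{ is even},\\(l+1)/2&\text{if }(\sigma_{0,1},\sigma_{0,2})\neq(0,0)\text{ and }l\text{ is odd}.\end{cases}$$ -/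

import Mathlib

open MeasureTheory
open scoped ContDiff TensorProduct InnerProductSpace

namespace SL3PS

/-! ### The group `SU(2)` and its representations on homogeneous polynomials -/

/-- The group `SU(2)`. -/
abbrev SU2 : Type := Matrix.specialUnitaryGroup (Fin 2) ℂ

theorem SU2.entries (x : SU2) :
    x.1 1 1 = star (x.1 0 0) ∧ x.1 1 0 = - star (x.1 0 1) ∧
      x.1 0 0 * star (x.1 0 0) + x.1 0 1 * star (x.1 0 1) = 1 := by
  obtain ⟨hu, hd⟩ := Matrix.mem_specialUnitaryGroup_iff.1 x.2
  have h1 := Matrix.mem_unitaryGroup_iff.1 hu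
  have h00 := congrFun (congrFun h1 0) 0
  have h10 := congrFun (congrFun h1 1) 0
  simp only [Matrix.mul_apply, Fin.sum_univ_two, Matrix.star_apply, Matrix.one_apply] at h00 h10
  simp at h10 h00
  rw [Matrix.det_fin_two] at hd
  refine ⟨?_, ?_, ?_⟩
  · simp only [Complex.star_def]
    linear_combination (starRingEnd ℂ) (x.1 0 0) * hd - x.1 1 1 * h00 + x.1 0 1 * h10
  · simp only [Complex.star_def]
    linear_combination - (starRingEnd ℂ) (x.1 0 1) * hd - x.1 1 0 * h00 + x.1 0 0 * h10
  · simpa using h00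

/-- The linear substitution `f(x, y) ↦ f(a x + b y, c x + d y)` attached to a matrix
`!![a, b; c, d]`. -/
noncomputable def subst (A : Matrix (Fin 2) (Fin 2) ℂ) :
    MvPolynomial (Fin 2) ℂ →ₐ[ℂ] MvPolynomial (Fin 2) ℂ :=
  MvPolynomial.aeval fun i => ∑ j, MvPolynomial.C (A i j) * MvPolynomial.X j

theorem subst_one : subst 1 = AlgHom.id ℂ _ := by
  ext i
  fin_cases i <;> simp [subst, Fin.sum_univ_two]

theorem subst_mul (A B : Matrix (Fin 2) (Fin 2) ℂ) :
    subst (B * A) = (subst A).comp (subst B) := by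
  refine MvPolynomial.algHom_ext fun i => ?_
  simp only [subst, AlgHom.comp_apply, MvPolynomial.aeval_X, Matrix.mul_apply, Fin.sum_univ_two,
    map_add, map_mul, MvPolynomial.aeval_C, MvPolynomial.algebraMap_eq]
  ring

/-- The space `V_n` of homogeneous polynomials of degree `n` in `ℂ[x, y]`, where `x = X 0` and
`y = X 1`. -/
abbrev V (n : ℕ) : Type := MvPolynomial.homogeneousSubmodule (Fin 2) ℂ n

theorem subst_mem (A : Matrix (Fin 2) (Fin 2) ℂ) (n : ℕ) {f : MvPolynomial (Fin 2) ℂ}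
    (hf : f ∈ MvPolynomial.homogeneousSubmodule (Fin 2) ℂ n) :
    subst A f ∈ MvPolynomial.homogeneousSubmodule (Fin 2) ℂ n := by
  rw [MvPolynomial.mem_homogeneousSubmodule] at hf ⊢
  have := hf.aeval (S := ℂ) (g := fun i => ∑ j, MvPolynomial.C (A i j) * MvPolynomial.X j) (n := 1)
    (fun i => MvPolynomial.IsHomogeneous.sum _ _ _ fun j _ => by
      simpa using (MvPolynomial.isHomogeneous_C _ _).mul (MvPolynomial.isHomogeneous_X _ _))
  simpa [subst] using this

/-- The representation `τ_n` of `SU(2)` on `V_n`: `(τ_n(g) f)(v) = f(g⁻¹ v)`. -/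
noncomputable def tauSU (n : ℕ) : Representation ℂ SU2 (V n) where
  toFun g := (subst (g⁻¹ : SU2).1).toLinearMap.restrict fun _ hf => subst_mem _ n hf
  map_one' := by
    ext f : 2
    simp [subst_one, LinearMap.restrict_apply]
  map_mul' g h := by
    ext f : 2
    simp [subst_mul]
    rfl

theorem tauSU_apply (n : ℕ) (g : SU2) (f : V n) :
    (tauSU n g f : MvPolynomial (Fin 2) ℂ) = subst (g⁻¹ : SU2).1 f.1 := rfl

/-- The exponent of the monomial `x^k y^(n-k)`. -/
noncomputable def expo (n k : ℕ) : Fin 2 →₀ ℕ := Finsupp.single 0 k + Finsupp.single 1 (n - k)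

/-- The standard basis vector `v_k = x^k y^(n-k)` of `V_n`, for `0 ≤ k ≤ n`. -/
noncomputable def stdVec (n : ℕ) (k : Fin (n + 1)) : V n :=
  ⟨MvPolynomial.monomial (expo n k) 1, by
    rw [MvPolynomial.mem_homogeneousSubmodule]
    refine MvPolynomial.isHomogeneous_monomial _ ?_
    have := k.2
    simp [expo, Finsupp.degree_eq_sum]
    omega⟩

/-- The dual basis vector `v_k^*` of `V_n^*`: the coefficient of `x^k y^(n-k)`. -/
noncomputable def dualVec (n k : ℕ) : Module.Dual ℂ (V n) :=
  (MvPolynomial.lcoeff ℂ (expo n k)).comp (Submodule.subtype _)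

theorem dualVec_stdVec (n : ℕ) (j k : Fin (n + 1)) :
    dualVec n j (stdVec n k) = if j = k then 1 else 0 := by
  have hj := j.2
  have hk := k.2
  have : (expo n k = expo n j) ↔ j = k := by
    constructor
    · intro h
      have := DFunLike.congr_fun h 0
      simp [expo] at this
      exact Fin.ext this.symm
    · rintro rfl; rfl
  simp [dualVec, stdVec, MvPolynomial.coeff_monomial, this]

theorem exists_expo {n : ℕ} {d : Fin 2 →₀ ℕ} (hd : d.degree = n) :
    ∃ k : Fin (n + 1), d = expo n k := by
  rw [Finsupp.degree_eq_sum, Fin.sum_univ_two] at hd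
  refine ⟨⟨d 0, by omega⟩, ?_⟩
  ext i
  fin_cases i
  · simp [expo]
  · simp [expo]; omega

theorem V_ext {n : ℕ} {f : V n} (h : ∀ k : Fin (n + 1), dualVec n k f = 0) : f = 0 := by
  ext d
  by_cases hd : d.degree = n
  · obtain ⟨k, rfl⟩ := exists_expo hd
    exact h k
  · exact f.2.coeff_eq_zero hd

theorem V_sum {n : ℕ} (f : V n) : f = ∑ k : Fin (n + 1), dualVec n k f • stdVec n k := by
  rw [← sub_eq_zero]
  refine V_ext fun j => ?_
  simp [map_sub, map_sum, dualVec_stdVec]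

theorem continuous_coeff_subst (f : MvPolynomial (Fin 2) ℂ) (d : Fin 2 →₀ ℕ) :
    Continuous fun A : Matrix (Fin 2) (Fin 2) ℂ => (subst A f).coeff d := by
  induction f using MvPolynomial.induction_on generalizing d with
  | C a => simp [subst, continuous_const]
  | add p q hp hq =>
    simp only [map_add, MvPolynomial.coeff_add]
    exact (hp d).add (hq d)
  | mul_X p i hp =>
    simp only [map_mul, MvPolynomial.coeff_mul]
    refine continuous_finsetSum _ fun e _ => (hp e.1).mul ?_
    simp only [subst, MvPolynomial.aeval_X, MvPolynomial.coeff_sum, MvPolynomial.coeff_C_mul]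
    refine continuous_finsetSum _ fun j _ => ?_
    exact (continuous_id.matrix_elem i j).mul continuous_const

theorem continuous_tauSU (n : ℕ) (w : Module.Dual ℂ (V n)) (v : V n) :
    Continuous fun x : SU2 => w (tauSU n x v) := by
  have h : ∀ x : SU2, w (tauSU n x v) = ∑ k : Fin (n + 1),
      (subst (star x.1) v.1).coeff (expo n k) * w (stdVec n k) := by
    intro x
    conv_lhs => rw [V_sum (tauSU n x v)]
    simp only [map_sum, map_smul, smul_eq_mul]
    rfl
  simp only [h]
  refine continuous_finsetSum _ fun k _ => Continuous.mul ?_ continuous_const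
  exact (continuous_coeff_subst v.1 _).comp (continuous_star.comp continuous_subtype_val)

/-! ### The groups `G = SL(3, ℝ)`, `K = SO(3)`, and the covering `SU(2) → SO(3)` -/

/-- The group `G = SL(3, ℝ)`. -/
abbrev G : Type := Matrix.SpecialLinearGroup (Fin 3) ℝ

/-- The maximal compact subgroup `K = SO(3)` of `G`. -/
def K : Subgroup G where
  carrier := {g | g.1 * g.1.transpose = 1}
  one_mem' := by simp
  mul_mem' := by
    intro a b ha hb
    simp only [Set.mem_ofPred_eq, Matrix.SpecialLinearGroup.coe_mul, Matrix.transpose_mul] at *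
    calc a.1 * b.1 * (b.1.transpose * a.1.transpose)
        = a.1 * (b.1 * b.1.transpose) * a.1.transpose := by simp only [Matrix.mul_assoc]
      _ = 1 := by rw [hb, Matrix.mul_one, ha]
  inv_mem' := by
    intro a ha
    simp only [Set.mem_ofPred_eq] at *
    have h : (a⁻¹ : G).1 = a.1.transpose := by
      have h2 : (a⁻¹ : G).1 * a.1 = 1 := by
        rw [← Matrix.SpecialLinearGroup.coe_mul]; simp
      calc (a⁻¹ : G).1 = (a⁻¹ : G).1 * (a.1 * a.1.transpose) := by rw [ha, Matrix.mul_one]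
        _ = a.1.transpose := by rw [← Matrix.mul_assoc, h2, Matrix.one_mul]
    rw [h, Matrix.transpose_transpose]
    exact mul_eq_one_comm.1 ha

/-- The matrix of the rotation `u ↦ x u x⁻¹` of the pure quaternions for the quaternion with
coordinates `p, q, r, s`. -/
def rotMatrix (p q r s : ℝ) : Matrix (Fin 3) (Fin 3) ℝ :=
  !![p^2 + q^2 - r^2 - s^2, -2 * (p * s - q * r), 2 * (p * r + q * s);
     2 * (p * s + q * r), p^2 - q^2 + r^2 - s^2, -2 * (p * q - r * s);
     -2 * (p * r - q * s), 2 * (p * q + r * s), p^2 - q^2 - r^2 + s^2]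

theorem rotMatrix_det {p q r s : ℝ} (h : p^2 + q^2 + r^2 + s^2 = 1) :
    (rotMatrix p q r s).det = 1 := by
  have : (rotMatrix p q r s).det = (p^2 + q^2 + r^2 + s^2)^3 := by
    rw [Matrix.det_fin_three]
    simp [rotMatrix]
    ring
  rw [this, h, one_pow]

theorem rotMatrix_mul_transpose {p q r s : ℝ} (h : p^2 + q^2 + r^2 + s^2 = 1) :
    rotMatrix p q r s * (rotMatrix p q r s).transpose = 1 := by
  have : rotMatrix p q r s * (rotMatrix p q r s).transpose =
      ((p^2 + q^2 + r^2 + s^2)^2) • (1 : Matrix (Fin 3) (Fin 3) ℝ) := by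
    ext i j
    fin_cases i <;> fin_cases j <;>
      simp [rotMatrix, Matrix.mul_apply, Fin.sum_univ_three] <;> ring
  rw [this, h]; simp

theorem SU2.norm_eq (x : SU2) :
    (x.1 0 0).re^2 + (x.1 0 0).im^2 + (x.1 0 1).re^2 + (x.1 0 1).im^2 = 1 := by
  have h := congrArg Complex.re (SU2.entries x).2.2
  simp at h
  linear_combination h

theorem rotMatrix_mul (p q r s a b c d : ℝ) :
    rotMatrix p q r s * rotMatrix a b c d =
      rotMatrix (p * a - q * b - r * c - s * d) (p * b + q * a + r * d - s * c)
        (p * c - q * d + r * a + s * b) (p * d + q * c - r * b + s * a) := by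
  ext i j
  fin_cases i <;> fin_cases j <;>
    simp [rotMatrix, Matrix.mul_apply, Fin.sum_univ_three] <;> ring

/-- The double covering `φ : SU(2) → SO(3)`, with
`x = !![p + i q, r + i s; -r + i s, p - i q]`. -/
noncomputable def spinCover : SU2 →* K where
  toFun x := ⟨⟨rotMatrix (x.1 0 0).re (x.1 0 0).im (x.1 0 1).re (x.1 0 1).im,
    rotMatrix_det x.norm_eq⟩, rotMatrix_mul_transpose x.norm_eq⟩
  map_one' := by
    ext i j
    fin_cases i <;> fin_cases j <;> simp [rotMatrix]
  map_mul' x y := by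
    obtain ⟨h11, h10, -⟩ := SU2.entries y
    apply Subtype.ext
    apply Subtype.ext
    change rotMatrix _ _ _ _ = rotMatrix _ _ _ _ * rotMatrix _ _ _ _
    rw [rotMatrix_mul]
    simp only [Submonoid.coe_mul, Matrix.mul_apply, Fin.sum_univ_two, h11, h10]
    congr 1 <;> simp <;> ring

theorem spinCover_coe (x : SU2) : (spinCover x).1.1 =
    rotMatrix (x.1 0 0).re (x.1 0 0).im (x.1 0 1).re (x.1 0 1).im := rfl

/-- The unitary matrix of a unit quaternion. -/
noncomputable def SU2.mk {p q r s : ℝ} (h : p^2 + q^2 + r^2 + s^2 = 1) : SU2 :=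
  ⟨!![⟨p, q⟩, ⟨r, s⟩; ⟨-r, s⟩, ⟨p, -q⟩], by
    rw [Matrix.mem_specialUnitaryGroup_iff, Matrix.mem_unitaryGroup_iff]
    constructor
    · ext i j
      fin_cases i <;> fin_cases j <;>
        simp [Matrix.mul_apply, Fin.sum_univ_two, Complex.ext_iff] <;>
        constructor <;> first | ring1 | linear_combination h
    · rw [Matrix.det_fin_two]
      simp [Complex.ext_iff]
      constructor
      · linear_combination h
      · ring⟩

theorem spinCover_surjective_aux {t Q₀ Q₁ Q₂ Q₁₂ : ℝ} (ht : t ≠ 0) (h0 : 4 * t * t = Q₀)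
    (h : Q₀ * Q₁₂ = Q₁ * Q₂) : 4 * (Q₁ / (4 * t)) * (Q₂ / (4 * t)) = Q₁₂ := by
  field_simp
  subst h0
  linear_combination -h

theorem spinCover_surjective : Function.Surjective spinCover := by
  intro k
  obtain ⟨⟨R, hdet⟩, hk⟩ := k
  have hk1 : R * R.transpose = 1 := hk
  have hk2 : R.transpose * R = 1 := mul_eq_one_comm.1 hk1
  have hadj : R.adjugate = R.transpose := by
    calc R.adjugate = R.adjugate * (R * R.transpose) := by rw [hk1, Matrix.mul_one]
      _ = R.transpose := by rw [← Matrix.mul_assoc, Matrix.adjugate_mul, hdet]; simp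
  have key : ∀ p q r s : ℝ, 4 * p * p = 1 + R 0 0 + R 1 1 + R 2 2 →
      4 * q * q = 1 + R 0 0 - R 1 1 - R 2 2 → 4 * r * r = 1 - R 0 0 + R 1 1 - R 2 2 →
      4 * s * s = 1 - R 0 0 - R 1 1 + R 2 2 →
      4 * p * q = R 2 1 - R 1 2 → 4 * p * r = R 0 2 - R 2 0 → 4 * p * s = R 1 0 - R 0 1 →
      4 * q * r = R 0 1 + R 1 0 → 4 * q * s = R 0 2 + R 2 0 → 4 * r * s = R 1 2 + R 2 1 →
      ∃ x, spinCover x = ⟨⟨R, hdet⟩, hk⟩ := by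
    intro p q r s h1 h2 h3 h4 h5 h6 h7 h8 h9 h10
    have h : p^2 + q^2 + r^2 + s^2 = 1 := by linarith
    refine ⟨SU2.mk h, ?_⟩
    apply Subtype.ext
    apply Subtype.ext
    change rotMatrix p q r s = R
    ext i j
    fin_cases i <;> fin_cases j <;> simp [rotMatrix] <;> linarith
  have e1 := fun i j => congrFun (congrFun hk1 i) j
  have e2 := fun i j => congrFun (congrFun hk2 i) j
  have e3 := fun i j => congrFun (congrFun hadj i) j
  simp only [Matrix.mul_apply, Matrix.transpose_apply, Fin.sum_univ_three,
    Matrix.one_apply, Matrix.adjugate_fin_three] at e1 e2 e3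
  have a00 := e1 0 0
  have a01 := e1 0 1
  have a02 := e1 0 2
  have a11 := e1 1 1
  have a12 := e1 1 2
  have a22 := e1 2 2
  have b00 := e2 0 0
  have b01 := e2 0 1
  have b02 := e2 0 2
  have b11 := e2 1 1
  have b12 := e2 1 2
  have b22 := e2 2 2
  have c00 := e3 0 0
  have c01 := e3 0 1
  have c02 := e3 0 2
  have c10 := e3 1 0
  have c11 := e3 1 1
  have c12 := e3 1 2
  have c20 := e3 2 0
  have c21 := e3 2 1
  have c22 := e3 2 2
  clear e1 e2 e3 hk1 hk2 hadj
  simp at a00 a01 a02 a11 a12 a22 b00 b01 b02 b11 b12 b22 c00 c01 c02 c10 c11 c12 c20 c21 c22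
  have pos : ∀ a : ℝ, 1 ≤ a → ∃ t : ℝ, t ≠ 0 ∧ 4 * t * t = a := by
    intro a ha
    refine ⟨Real.sqrt a / 2, ?_, ?_⟩
    · have := Real.sqrt_pos.2 (lt_of_lt_of_le one_pos ha)
      positivity
    · have := Real.mul_self_sqrt (le_trans zero_le_one ha)
      linarith
  have cases : 1 ≤ 1 + R 0 0 + R 1 1 + R 2 2 ∨ 1 ≤ 1 + R 0 0 - R 1 1 - R 2 2 ∨
      1 ≤ 1 - R 0 0 + R 1 1 - R 2 2 ∨ 1 ≤ 1 - R 0 0 - R 1 1 + R 2 2 := by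
    by_contra! hc
    linarith [hc.1, hc.2.1, hc.2.2.1, hc.2.2.2]
  have lin : ∀ t Q : ℝ, t ≠ 0 → 4 * t * (Q / (4 * t)) = Q := by
    intro t Q ht
    field_simp
  have lin' : ∀ t Q : ℝ, t ≠ 0 → 4 * (Q / (4 * t)) * t = Q := by
    intro t Q ht
    field_simp
  rcases cases with h | h | h | h
  · obtain ⟨t, ht, h0⟩ := pos _ h
    refine key t ((R 2 1 - R 1 2) / (4 * t)) ((R 0 2 - R 2 0) / (4 * t))
      ((R 1 0 - R 0 1) / (4 * t)) h0 ?_ ?_ ?_ (lin _ _ ht) (lin _ _ ht) (lin _ _ ht) ?_ ?_ ?_ <;>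
      refine spinCover_surjective_aux ht h0 ?_ <;> linarith
  · obtain ⟨t, ht, h0⟩ := pos _ h
    refine key ((R 2 1 - R 1 2) / (4 * t)) t ((R 0 1 + R 1 0) / (4 * t))
      ((R 0 2 + R 2 0) / (4 * t)) ?_ h0 ?_ ?_ (lin' _ _ ht) ?_ ?_ (lin _ _ ht) (lin _ _ ht) ?_ <;>
      refine spinCover_surjective_aux ht h0 ?_ <;> linarith
  · obtain ⟨t, ht, h0⟩ := pos _ h
    refine key ((R 0 2 - R 2 0) / (4 * t)) ((R 0 1 + R 1 0) / (4 * t)) t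
      ((R 1 2 + R 2 1) / (4 * t)) ?_ ?_ h0 ?_ ?_ (lin' _ _ ht) ?_ (lin' _ _ ht) ?_ (lin _ _ ht) <;>
      refine spinCover_surjective_aux ht h0 ?_ <;> linarith
  · obtain ⟨t, ht, h0⟩ := pos _ h
    refine key ((R 1 0 - R 0 1) / (4 * t)) ((R 0 2 + R 2 0) / (4 * t))
      ((R 1 2 + R 2 1) / (4 * t)) t ?_ ?_ ?_ h0 ?_ ?_ (lin' _ _ ht) ?_ (lin' _ _ ht)
      (lin' _ _ ht) <;>
      refine spinCover_surjective_aux ht h0 ?_ <;> linarith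

theorem spinCover_ker {x : SU2} (hx : spinCover x = 1) : x.1 = 1 ∨ x.1 = -1 := by
  obtain ⟨h11, h10, -⟩ := SU2.entries x
  have hn := x.norm_eq
  have h : rotMatrix (x.1 0 0).re (x.1 0 0).im (x.1 0 1).re (x.1 0 1).im = 1 :=
    congrArg (fun k : K => k.1.1) hx
  have e00 := congrFun (congrFun h 0) 0
  have e11 := congrFun (congrFun h 1) 1
  have e22 := congrFun (congrFun h 2) 2
  simp [rotMatrix] at e00 e11 e22
  have hq : (x.1 0 0).im = 0 := by
    have : (x.1 0 0).im ^ 2 = 0 := by linarith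
    simpa using this
  have hr : (x.1 0 1).re = 0 := by
    have : (x.1 0 1).re ^ 2 = 0 := by linarith
    simpa using this
  have hs : (x.1 0 1).im = 0 := by
    have : (x.1 0 1).im ^ 2 = 0 := by linarith
    simpa using this
  have hp : (x.1 0 0).re = 1 ∨ (x.1 0 0).re = -1 := by
    exact sq_eq_one_iff.1 (by linarith)
  have h01 : x.1 0 1 = 0 := Complex.ext hr hs
  rcases hp with hp | hp
  · left
    have h00 : x.1 0 0 = 1 := Complex.ext hp hq
    ext i j
    fin_cases i <;> fin_cases j <;> simp [h00, h01, h11, h10]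
  · right
    have h00 : x.1 0 0 = -1 := Complex.ext hp (by simpa using hq)
    ext i j
    fin_cases i <;> fin_cases j <;> simp [h00, h01, h11, h10]


theorem tauSU_eq_of_spinCover_eq (l : ℕ) {x y : SU2} (h : spinCover x = spinCover y) :
    tauSU (2 * l) x = tauSU (2 * l) y := by
  have hk : spinCover (x * y⁻¹) = 1 := by rw [map_mul, map_inv, h, mul_inv_cancel]
  have h1 : tauSU (2 * l) (x * y⁻¹) = 1 := by
    rcases spinCover_ker hk with h | h
    · rw [show x * y⁻¹ = 1 from Subtype.ext h, map_one]
    · have hs : subst ((x * y⁻¹)⁻¹ : SU2).1 = MvPolynomial.aeval fun i => -MvPolynomial.X i := by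
        refine MvPolynomial.algHom_ext fun i => ?_
        have : ((x * y⁻¹)⁻¹ : SU2).1 = -1 := by
          rw [← Matrix.star_eq_inv, Matrix.specialUnitaryGroup.coe_star, h]
          simp
        rw [this]
        fin_cases i <;> simp [subst, Fin.sum_univ_two]
      have hm : ∀ f : MvPolynomial (Fin 2) ℂ,
          f ∈ MvPolynomial.homogeneousSubmodule (Fin 2) ℂ (2 * l) →
          MvPolynomial.aeval (fun i => -(MvPolynomial.X i : MvPolynomial (Fin 2) ℂ)) f = f := by
        intro f hf
        rw [MvPolynomial.mem_homogeneousSubmodule] at hf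
        conv_rhs => rw [← MvPolynomial.support_sum_monomial_coeff f]
        conv_lhs => rw [← MvPolynomial.support_sum_monomial_coeff f]
        rw [map_sum]
        refine Finset.sum_congr rfl fun d hd => ?_
        have hdeg : d 0 + d 1 = 2 * l := by
          by_contra hne
          refine (MvPolynomial.mem_support_iff.1 hd) (hf.coeff_eq_zero ?_)
          rw [Finsupp.degree_eq_sum, Fin.sum_univ_two]
          exact hne
        rw [MvPolynomial.aeval_monomial, MvPolynomial.monomial_eq,
          Finsupp.prod_fintype _ _ (by simp), Finsupp.prod_fintype _ _ (by simp)]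
        simp only [Fin.prod_univ_two, MvPolynomial.algebraMap_eq]
        rw [neg_pow (MvPolynomial.X 0 : MvPolynomial (Fin 2) ℂ),
          neg_pow (MvPolynomial.X 1 : MvPolynomial (Fin 2) ℂ)]
        have : ((-1 : MvPolynomial (Fin 2) ℂ)) ^ d 0 * (-1) ^ d 1 = 1 := by
          rw [← pow_add, hdeg, pow_mul]; simp
        linear_combination (MvPolynomial.C (MvPolynomial.coeff d f) * MvPolynomial.X 0 ^ d 0 *
          MvPolynomial.X 1 ^ d 1) * this
      ext f : 2
      rw [tauSU_apply, hs]
      exact hm _ f.2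
  calc tauSU (2 * l) x = tauSU (2 * l) (x * y⁻¹ * y) := by rw [inv_mul_cancel_right]
    _ = tauSU (2 * l) y := by rw [map_mul, h1, one_mul]

/-- The representation `τ_{2l}` of `K = SO(3)` on `V_{2l}`, obtained from the representation
`τ_{2l}` of `SU(2)` by passing to the quotient: `τ_{2l}(φ(x)) = τ_{2l}(x)`, see `tau_spinCover`. -/
noncomputable def tau (l : ℕ) : Representation ℂ K (V (2 * l)) where
  toFun k := tauSU (2 * l) (Function.surjInv spinCover_surjective k)
  map_one' := by
    rw [← map_one (tauSU (2 * l))]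
    exact tauSU_eq_of_spinCover_eq l ((Function.surjInv_eq spinCover_surjective 1).trans (map_one _).symm)
  map_mul' a b := by
    rw [← map_mul]
    exact tauSU_eq_of_spinCover_eq l (by
      rw [map_mul, Function.surjInv_eq spinCover_surjective, Function.surjInv_eq spinCover_surjective,
        Function.surjInv_eq spinCover_surjective])

theorem tau_spinCover (l : ℕ) (x : SU2) : tau l (spinCover x) = tauSU (2 * l) x :=
  tauSU_eq_of_spinCover_eq l (Function.surjInv_eq _ _)

theorem isCompact_SU2 : 
    IsCompact (Matrix.specialUnitaryGroup (Fin 2) ℂ : Set (Matrix (Fin 2) (Fin 2) ℂ)) := by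
  have hc : IsCompact {A : Matrix (Fin 2) (Fin 2) ℂ | ∀ i j, A i j ∈ Metric.closedBall 0 1} := by
    have : {A : Matrix (Fin 2) (Fin 2) ℂ | ∀ i j, A i j ∈ Metric.closedBall (0 : ℂ) 1} =
        Set.pi Set.univ fun _ : Fin 2 => Set.pi Set.univ fun _ : Fin 2 =>
          Metric.closedBall (0 : ℂ) 1 := by
      ext A
      exact ⟨fun h i _ j _ => h i j, fun h i j => h i trivial j trivial⟩
    rw [this]
    exact isCompact_univ_pi fun _ => isCompact_univ_pi fun _ => isCompact_closedBall 0 1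
  refine hc.of_isClosed_subset ?_ ?_
  · have : (Matrix.specialUnitaryGroup (Fin 2) ℂ : Set (Matrix (Fin 2) (Fin 2) ℂ)) =
        {A | A * star A = 1} ∩ {A | A.det = 1} := by
      ext A
      simp [Matrix.mem_specialUnitaryGroup_iff, Matrix.mem_unitaryGroup_iff]
    rw [this]
    exact (isClosed_eq (continuous_id.mul continuous_star) continuous_const).inter
      (isClosed_eq continuous_id.matrix_det continuous_const)
  · intro A hA i j
    have := entry_norm_bound_of_unitary
      (Matrix.mem_specialUnitaryGroup_iff.1 hA).1 i j
    simpa using this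

instance : CompactSpace SU2 := isCompact_iff_compactSpace.1 isCompact_SU2

theorem continuous_spinCover : Continuous spinCover := by
  refine Continuous.subtype_mk (Continuous.subtype_mk ?_ _) _
  refine continuous_matrix fun i j => ?_
  have h : ∀ a b : Fin 2, Continuous fun x : SU2 => x.1 a b :=
    fun a b => continuous_subtype_val.matrix_elem a b
  have hre : ∀ a b : Fin 2, Continuous fun x : SU2 => (x.1 a b).re :=
    fun a b => Complex.continuous_re.comp (h a b)
  have him : ∀ a b : Fin 2, Continuous fun x : SU2 => (x.1 a b).im :=
    fun a b => Complex.continuous_im.comp (h a b)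
  have h1 := hre 0 0
  have h2 := him 0 0
  have h3 := hre 0 1
  have h4 := him 0 1
  fin_cases i <;> fin_cases j <;> simp [rotMatrix] <;> fun_prop

instance : CompactSpace K := spinCover_surjective.compactSpace continuous_spinCover

theorem isQuotientMap_spinCover : Topology.IsQuotientMap spinCover :=
  continuous_spinCover.isClosedMap.isQuotientMap continuous_spinCover spinCover_surjective

theorem continuous_tau (l : ℕ) (w : Module.Dual ℂ (V (2 * l))) (v : V (2 * l)) :
    Continuous fun k : K => w (tau l k v) := by
  rw [isQuotientMap_spinCover.continuous_iff]
  have : (fun k : K => w (tau l k v)) ∘ spinCover = fun x => w (tauSU (2 * l) x v) := by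
    ext x; simp [tau_spinCover]
  rw [this]
  exact continuous_tauSU _ w v

/-! ### Normalized Haar measure on `K` -/

instance : MeasurableSpace K := borel K
instance : BorelSpace K := ⟨rfl⟩

/-- The Haar measure `dk` on `K` of total mass one. -/
noncomputable def haarK : Measure K := Measure.haarMeasure ⊤

instance : haarK.IsHaarMeasure := by unfold haarK; infer_instance

instance : IsProbabilityMeasure haarK :=
  ⟨by simpa [haarK] using Measure.haarMeasure_self (K₀ := (⊤ : TopologicalSpace.PositiveCompacts K))⟩

instance : haarK.IsMulRightInvariant where
  map_mul_right_eq_self g := by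
    have : IsProbabilityMeasure (haarK.map (· * g)) :=
      Measure.isProbabilityMeasure_map (by fun_prop)
    have : (haarK.map (· * g)).IsHaarMeasure := inferInstance
    exact Measure.isHaarMeasure_eq_of_isProbabilityMeasure _ _

/-- The Hilbert space `L²(K)`. -/
abbrev L2K : Type := Lp ℂ 2 haarK


/-! ### The subgroups `M₀`, `A₀`, `N₀` and their characters -/

/-- The diagonal matrix `diag(ε₁, ε₂, ε₁ ε₂)`. -/
noncomputable def diagSign : ℤˣ × ℤˣ →* G where
  toFun e := ⟨Matrix.diagonal ![((e.1 : ℤ) : ℝ), ((e.2 : ℤ) : ℝ), ((e.1 * e.2 : ℤ) : ℝ)], by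
    rcases Int.units_eq_one_or e.1 with h | h <;> rcases Int.units_eq_one_or e.2 with h' | h' <;>
      simp [Matrix.det_diagonal, Fin.prod_univ_three, h, h']⟩
  map_one' := by
    ext i j
    fin_cases i <;> fin_cases j <;> simp
  map_mul' a b := by
    apply Subtype.ext
    change Matrix.diagonal _ = Matrix.diagonal _ * Matrix.diagonal _
    rw [Matrix.diagonal_mul_diagonal]
    congr 1
    ext i
    fin_cases i <;> simp [mul_mul_mul_comm]

/-- The group `M₀` of the matrices `diag(ε₁, ε₂, ε₁ ε₂)` with `ε₁, ε₂ ∈ {±1}`. -/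
noncomputable def M0 : Subgroup G := diagSign.range

theorem M0_le_K : M0 ≤ K := by
  rintro _ ⟨e, rfl⟩
  change Matrix.diagonal _ * (Matrix.diagonal _).transpose = 1
  rw [Matrix.diagonal_transpose, Matrix.diagonal_mul_diagonal, Matrix.diagonal_eq_one]
  ext i
  rcases Int.units_eq_one_or e.1 with h | h <;> rcases Int.units_eq_one_or e.2 with h' | h' <;>
    fin_cases i <;> simp [h, h']

/-- The inclusion of `M₀` in `K`. -/
noncomputable def M0toK : M0 →* K := Subgroup.inclusion M0_le_K

/-- The element `diag(ε₁, ε₂, ε₁ ε₂)` of `M₀`. -/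
noncomputable def M0.mk (e₁ e₂ : ℤˣ) : M0 := ⟨diagSign (e₁, e₂), ⟨_, rfl⟩⟩

open Classical in
/-- The coordinates `(σ₁, σ₂) ∈ {0,1}²` of a character `σ` of `M₀`:
`σ(diag(ε₁, ε₂, ε₁ ε₂)) = ε₁^σ₁ ε₂^σ₂`, see `sigma_eq`. -/
noncomputable def sigma1 (σ : M0 →* ℂˣ) : ℕ := if σ (M0.mk (-1) 1) = 1 then 0 else 1

open Classical in
/-- The second coordinate of a character of `M₀`. -/
noncomputable def sigma2 (σ : M0 →* ℂˣ) : ℕ := if σ (M0.mk 1 (-1)) = 1 then 0 else 1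

theorem M0.mk_mul (a b c d : ℤˣ) : M0.mk a b * M0.mk c d = M0.mk (a * c) (b * d) :=
  Subtype.ext (by simp [M0.mk, ← map_mul])

theorem sigma_eq (σ : M0 →* ℂˣ) (e₁ e₂ : ℤˣ) :
    (σ (M0.mk e₁ e₂) : ℂ) = ((e₁ : ℤ) : ℂ) ^ sigma1 σ * ((e₂ : ℤ) : ℂ) ^ sigma2 σ := by
  have h11 : M0.mk 1 1 = 1 := Subtype.ext (map_one diagSign)
  have hs : ∀ m : M0, m * m = 1 → σ m ≠ 1 → ((σ m : ℂˣ) : ℂ) = -1 := by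
    intro m hm hne
    have h1 : ((σ m : ℂˣ) : ℂ) * (σ m : ℂˣ) = 1 := by
      rw [← Units.val_mul, ← map_mul, hm, map_one, Units.val_one]
    rcases mul_self_eq_one_iff.1 h1 with h | h
    · exact absurd (Units.ext h) hne
    · exact h
  have h1 : ((σ (M0.mk (-1) 1) : ℂˣ) : ℂ) = (-1) ^ sigma1 σ := by
    unfold sigma1
    split_ifs with h
    · simp [h]
    · simpa using hs _ (by rw [M0.mk_mul]; simpa using h11) h
  have h2 : ((σ (M0.mk 1 (-1)) : ℂˣ) : ℂ) = (-1) ^ sigma2 σ := by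
    unfold sigma2
    split_ifs with h
    · simp [h]
    · simpa using hs _ (by rw [M0.mk_mul]; simpa using h11) h
  have h12 : M0.mk (-1) (-1) = M0.mk (-1) 1 * M0.mk 1 (-1) := by rw [M0.mk_mul]; simp
  rcases Int.units_eq_one_or e₁ with rfl | rfl <;> rcases Int.units_eq_one_or e₂ with rfl | rfl
  · simp [h11]
  · simp [h2]
  · simp [h1]
  · simp [h12, h1, h2]

/-- The subgroup `A₀` of the diagonal matrices with positive entries. -/
def A0 : Set G := {a | a.1.IsDiag ∧ ∀ i, 0 < a.1 i i}

/-- The subgroup `N₀` of the unipotent upper triangular matrices. -/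
def N0 : Set G := {n | (∀ i j, j < i → n.1 i j = 0) ∧ ∀ i, n.1 i i = 1}

/-- The Lie algebra `𝔞₀` of `A₀`: the diagonal matrices of trace zero. -/
def LieA0 : Submodule ℝ (Matrix (Fin 3) (Fin 3) ℝ) where
  carrier := {X | X.IsDiag ∧ X.trace = 0}
  zero_mem' := ⟨Matrix.isDiag_zero, by simp⟩
  add_mem' := fun ha hb => ⟨ha.1.add hb.1, by rw [Matrix.trace_add, ha.2, hb.2, add_zero]⟩
  smul_mem' := fun c _ ha => ⟨ha.1.smul c, by rw [Matrix.trace_smul, ha.2, smul_zero]⟩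

/-- `H₁ = diag(1, 0, -1)`. -/
def H1 : LieA0 := ⟨Matrix.diagonal ![1, 0, -1],
  Matrix.isDiag_diagonal _, by simp [Matrix.trace_diagonal, Fin.sum_univ_three]⟩

/-- `H₂ = diag(0, 1, -1)`. -/
def H2 : LieA0 := ⟨Matrix.diagonal ![0, 1, -1],
  Matrix.isDiag_diagonal _, by simp [Matrix.trace_diagonal, Fin.sum_univ_three]⟩

/-- The half sum `ρ₀ = e₁ - e₃` of the positive roots. -/
noncomputable def rho0 : LieA0 →ₗ[ℝ] ℂ where
  toFun X := ((X.1 0 0 - X.1 2 2 : ℝ) : ℂ)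
  map_add' X Y := by simp; ring
  map_smul' c X := by simp; ring

/-- The quasicharacter `e^μ(a) = a₁^{μ(H₁)} a₂^{μ(H₂)}` of `A₀`. -/
noncomputable def expChar (μ : LieA0 →ₗ[ℝ] ℂ) (a : G) : ℂ :=
  ((a.1 0 0 : ℝ) : ℂ) ^ μ H1 * ((a.1 1 1 : ℝ) : ℂ) ^ μ H2

/-! ### The principal series -/

/-- Smoothness of a function on the closed submanifold `G = SL(3, ℝ)` of the space of `3 × 3`
matrices: locally it is the restriction of a smooth function on an open set of matrices. -/
def IsSmooth (f : G → ℂ) : Prop :=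
  ∀ g : G, ∃ (U : Set (Fin 3 → Fin 3 → ℝ)) (F : (Fin 3 → Fin 3 → ℝ) → ℂ),
    IsOpen U ∧ (fun i j => g.1 i j) ∈ U ∧ ContDiffOn ℝ ∞ F U ∧
      ∀ h : G, (fun i j => h.1 i j) ∈ U → f h = F fun i j => h.1 i j

theorem IsSmooth.continuous {f : G → ℂ} (hf : IsSmooth f) : Continuous f := by
  have hc : Continuous fun h : G => (fun i j => h.1 i j : Fin 3 → Fin 3 → ℝ) :=
    continuous_pi fun i => continuous_pi fun j => continuous_subtype_val.matrix_elem i j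
  rw [continuous_iff_continuousAt]
  intro g
  obtain ⟨U, F, hU, hg, hF, h⟩ := hf g
  have h1 : ContinuousAt (fun h : G => F fun i j => h.1 i j) g :=
    ContinuousAt.comp (f := fun h : G => (fun i j => h.1 i j : Fin 3 → Fin 3 → ℝ)) (g := F)
      (hF.continuousOn.continuousAt (hU.mem_nhds hg)) hc.continuousAt
  refine h1.congr ?_
  filter_upwards [hc.continuousAt (hU.mem_nhds hg)] with x hx
  exact (h x hx).symm

theorem IsSmooth.translate {f : G → ℂ} (hf : IsSmooth f) (k : G) :
    IsSmooth fun x => f (x * k) := by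
  intro g
  obtain ⟨U, F, hU, hg, hF, h⟩ := hf (g * k)
  have hT : ContDiff ℝ ∞ fun (A : Fin 3 → Fin 3 → ℝ) (i j : Fin 3) => ∑ l, A i l * k.1 l j := by
    fun_prop
  refine ⟨(fun (A : Fin 3 → Fin 3 → ℝ) (i j : Fin 3) => ∑ l, A i l * k.1 l j) ⁻¹' U,
    fun A => F fun i j => ∑ l, A i l * k.1 l j, hU.preimage hT.continuous, ?_, ?_, ?_⟩
  · exact hg
  · exact hF.comp hT.contDiffOn fun _ hx => hx
  · intro x hx
    exact h (x * k) hx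

/-- The space `H^∞_{(ν,σ)}` of the smooth functions `f` on `G` with
`f(n a m x) = e^{ν+ρ₀}(a) σ(m) f(x)` for `n ∈ N₀`, `a ∈ A₀`, `m ∈ M₀`, `x ∈ G`. -/
def smoothSections (ν : LieA0 →ₗ[ℝ] ℂ) (σ : M0 →* ℂˣ) : Submodule ℂ (G → ℂ) where
  carrier := {f | IsSmooth f ∧ ∀ n ∈ N0, ∀ a ∈ A0, ∀ (m : M0) (x : G),
    f (n * a * m * x) = expChar (ν + rho0) a * σ m * f x}
  zero_mem' := ⟨fun _ => ⟨Set.univ, 0, isOpen_univ, trivial, contDiffOn_const, fun _ _ => rfl⟩,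
    by simp⟩
  add_mem' := by
    rintro f g ⟨hf, hf'⟩ ⟨hg, hg'⟩
    refine ⟨fun x => ?_, fun n hn a ha m x => ?_⟩
    · obtain ⟨U, F, hU, hx, hF, h⟩ := hf x
      obtain ⟨U', F', hU', hx', hF', h'⟩ := hg x
      exact ⟨U ∩ U', F + F', hU.inter hU', ⟨hx, hx'⟩,
        (hF.mono Set.inter_subset_left).add (hF'.mono Set.inter_subset_right),
        fun y hy => by simp [h y hy.1, h' y hy.2]⟩
    · simp only [Pi.add_apply, hf' n hn a ha m x, hg' n hn a ha m x]
      ring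
  smul_mem' := by
    rintro c f ⟨hf, hf'⟩
    refine ⟨fun x => ?_, fun n hn a ha m x => ?_⟩
    · obtain ⟨U, F, hU, hx, hF, h⟩ := hf x
      exact ⟨U, fun A => c * F A, hU, hx, contDiffOn_const.mul hF,
        fun y hy => by simp [h y hy]⟩
    · simp only [Pi.smul_apply, hf' n hn a ha m x, smul_eq_mul]
      ring

/-- The right regular representation of `G` on `H^∞_{(ν,σ)}`. -/
def piInf (ν : LieA0 →ₗ[ℝ] ℂ) (σ : M0 →* ℂˣ) : Representation ℂ G (smoothSections ν σ) where
  toFun g :=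
    { toFun := fun f => ⟨fun x => f.1 (x * g), f.2.1.translate g, fun n hn a ha m x => by
        have h := f.2.2 n hn a ha m (x * g)
        rwa [← mul_assoc] at h⟩
      map_add' := fun _ _ => rfl
      map_smul' := fun _ _ => rfl }
  map_one' := by ext f x; simp
  map_mul' g h := by ext f x; simp [mul_assoc]

/-- The type of elements of `H^∞_{(ν,σ)}`, to be equipped with the norm of `L²(K)`. -/
def HInf (ν : LieA0 →ₗ[ℝ] ℂ) (σ : M0 →* ℂˣ) : Type := smoothSections ν σ

section
variable (ν : LieA0 →ₗ[ℝ] ℂ) (σ : M0 →* ℂˣ)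

variable {ν σ} in
/-- The function on `G` underlying an element of `H^∞_{(ν,σ)}`. -/
def HInf.toFun (f : HInf ν σ) : G → ℂ := Subtype.val (p := (· ∈ smoothSections ν σ)) f

noncomputable instance : AddCommGroup (HInf ν σ) :=
  inferInstanceAs (AddCommGroup (smoothSections ν σ))

noncomputable instance : Module ℂ (HInf ν σ) :=
  inferInstanceAs (Module ℂ (smoothSections ν σ))

/-- The restriction of `f ∈ H^∞_{(ν,σ)}` to `K`, as a continuous function. -/
noncomputable def restrictK : HInf ν σ →ₗ[ℂ] C(K, ℂ) where
  toFun f := ⟨fun k => f.1 k, f.2.1.continuous.comp continuous_subtype_val⟩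
  map_add' _ _ := rfl
  map_smul' _ _ := rfl

/-- The restriction of `f ∈ H^∞_{(ν,σ)}` to `K`, as an element of `L²(K)`. -/
noncomputable def restrictL2 : HInf ν σ →ₗ[ℂ] L2K :=
  (ContinuousMap.toLp 2 haarK ℂ).toLinearMap ∘ₗ restrictK ν σ

/-- The norm `‖f‖² = ∫_K |f(k)|² dk` on `H^∞_{(ν,σ)}`. -/
noncomputable instance : SeminormedAddCommGroup (HInf ν σ) :=
  SeminormedAddCommGroup.induced (HInf ν σ) L2K (restrictL2 ν σ)

theorem HInf.norm_eq (f : HInf ν σ) : ‖f‖ = ‖restrictL2 ν σ f‖ := rfl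

/-- The inner product of `H^∞_{(ν,σ)}` that is given by integration over `K`. -/
noncomputable instance : InnerProductSpace ℂ (HInf ν σ) where
  norm_smul_le c f := by
    rw [HInf.norm_eq, HInf.norm_eq, map_smul]
    exact norm_smul_le _ _
  inner f g := inner ℂ (restrictL2 ν σ f) (restrictL2 ν σ g)
  norm_sq_eq_re_inner f := norm_sq_eq_re_inner (𝕜 := ℂ) (restrictL2 ν σ f)
  conj_inner_symm f g := inner_conj_symm (𝕜 := ℂ) (restrictL2 ν σ f) (restrictL2 ν σ g)
  add_left f g h := by simp only [map_add, inner_add_left]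
  smul_left f g c := by simp only [map_smul, inner_smul_left]

theorem HInf.norm_sq (f : HInf ν σ) : ‖f‖ ^ 2 = ∫ k : K, ‖f.toFun k‖ ^ 2 ∂haarK := by
  have h1 : ‖f‖ ^ 2 = RCLike.re (inner ℂ (restrictL2 ν σ f) (restrictL2 ν σ f)) :=
    norm_sq_eq_re_inner (𝕜 := ℂ) (restrictL2 ν σ f)
  rw [h1]
  change RCLike.re (inner ℂ (ContinuousMap.toLp 2 haarK ℂ (restrictK ν σ f))
    (ContinuousMap.toLp 2 haarK ℂ (restrictK ν σ f))) = _
  rw [ContinuousMap.inner_toLp]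
  have : ∀ k : K, (restrictK ν σ f) k * (starRingEnd ℂ) ((restrictK ν σ f) k) =
      ((‖f.toFun k‖ ^ 2 : ℝ) : ℂ) := fun k => by
    rw [Complex.mul_conj, Complex.normSq_eq_norm_sq]; rfl
  simp only [this]
  rw [integral_complex_ofReal]
  simp

/-- The representation space `H_{(ν,σ)}`: the completion of `H^∞_{(ν,σ)}`. -/
abbrev PS : Type := UniformSpace.Completion (HInf ν σ)

/-- Right translation by `k ∈ K` on `H^∞_{(ν,σ)}`. -/
noncomputable def piInfK (k : K) : HInf ν σ →ₗ[ℂ] HInf ν σ := piInf ν σ k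

theorem restrictL2_piInfK (k : K) (f : HInf ν σ) : restrictL2 ν σ (piInfK ν σ k f) =
    Lp.compMeasurePreserving (· * k) (measurePreserving_mul_right haarK k)
      (restrictL2 ν σ f) := by
  refine Lp.ext ?_
  have h1 := ContinuousMap.coeFn_toLp (p := 2) (𝕜 := ℂ) haarK (restrictK ν σ (piInfK ν σ k f))
  have h2 := ContinuousMap.coeFn_toLp (p := 2) (𝕜 := ℂ) haarK (restrictK ν σ f)
  have h3 := Lp.coeFn_compMeasurePreserving (restrictL2 ν σ f) (measurePreserving_mul_right haarK k)
  have h4 := (measurePreserving_mul_right haarK k).quasiMeasurePreserving.ae_eq_comp h2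
  exact h1.trans (h3.trans h4).symm

theorem norm_piInfK (k : K) (f : HInf ν σ) : ‖piInfK ν σ k f‖ = ‖f‖ := by
  rw [HInf.norm_eq, HInf.norm_eq, restrictL2_piInfK]
  exact Lp.norm_compMeasurePreserving _ _

/-- Right translation by `k ∈ K`, as an isometry of `H^∞_{(ν,σ)}`. -/
noncomputable def piInfKIsom (k : K) : HInf ν σ →ₗᵢ[ℂ] HInf ν σ := ⟨piInfK ν σ k, norm_piInfK ν σ k⟩

end


section
variable (ν : LieA0 →ₗ[ℝ] ℂ) (σ : M0 →* ℂˣ)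

/-- The extension by continuity of a linear isometry from `H^∞_{(ν,σ)}` to a Hilbert space. -/
noncomputable def extendIsom {F : Type} [NormedAddCommGroup F] [InnerProductSpace ℂ F]
    [CompleteSpace F] (T : HInf ν σ →ₗᵢ[ℂ] F) : PS ν σ →ₗᵢ[ℂ] F where
  toLinearMap := (T.toContinuousLinearMap.extend
    (UniformSpace.Completion.toComplL : HInf ν σ →L[ℂ] PS ν σ)).toLinearMap
  norm_map' u := by
    refine UniformSpace.Completion.induction_on u ?_ fun f => ?_
    · exact isClosed_eq (ContinuousLinearMap.continuous _).norm continuous_norm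
    · rw [UniformSpace.Completion.norm_coe, ← T.norm_map f]
      exact congrArg norm (ContinuousLinearMap.extend_eq T.toContinuousLinearMap
        (e := (UniformSpace.Completion.toComplL : HInf ν σ →L[ℂ] PS ν σ))
        UniformSpace.Completion.denseRange_coe
        (UniformSpace.Completion.isUniformInducing_coe _) f)

theorem extendIsom_coe {F : Type} [NormedAddCommGroup F] [InnerProductSpace ℂ F]
    [CompleteSpace F] (T : HInf ν σ →ₗᵢ[ℂ] F) (f : HInf ν σ) :
    extendIsom ν σ T (f : PS ν σ) = T f :=
  ContinuousLinearMap.extend_eq T.toContinuousLinearMap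
    (e := (UniformSpace.Completion.toComplL : HInf ν σ →L[ℂ] PS ν σ))
    UniformSpace.Completion.denseRange_coe (UniformSpace.Completion.isUniformInducing_coe _) f

/-- The restriction map `r_K : H_{(ν,σ)} → L²(K)`, the continuous extension of `f ↦ f|_K`. -/
noncomputable def rK : PS ν σ →ₗᵢ[ℂ] L2K := extendIsom ν σ ⟨restrictL2 ν σ, fun _ => rfl⟩

/-- The action of `k ∈ K` on `H_{(ν,σ)}`, the continuous extension of right translation. -/
noncomputable def piKIsom (k : K) : PS ν σ →ₗᵢ[ℂ] PS ν σ :=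
  extendIsom ν σ (UniformSpace.Completion.toComplₗᵢ.comp (piInfKIsom ν σ k))

theorem piKIsom_coe (k : K) (f : HInf ν σ) :
    piKIsom ν σ k (f : PS ν σ) = (piInfK ν σ k f : HInf ν σ) :=
  extendIsom_coe ν σ _ f

/-- The restriction to `K` of the principal series representation `π_{(ν,σ)}`: right translation
on `H^∞_{(ν,σ)}`, extended by continuity to the completion `H_{(ν,σ)}`. -/
noncomputable def piK : Representation ℂ K (PS ν σ) where
  toFun k := (piKIsom ν σ k).toLinearMap
  map_one' := by
    refine LinearMap.ext fun u => ?_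
    refine UniformSpace.Completion.induction_on u
      (isClosed_eq (piKIsom ν σ 1).continuous continuous_id) fun f => ?_
    refine (piKIsom_coe ν σ 1 f).trans ?_
    exact congrArg _ (congrArg (fun T => T f) (map_one (piInf ν σ)))
  map_mul' a b := by
    refine LinearMap.ext fun u => ?_
    refine UniformSpace.Completion.induction_on u
      (isClosed_eq (piKIsom ν σ (a * b)).continuous
        ((piKIsom ν σ a).continuous.comp (piKIsom ν σ b).continuous)) fun f => ?_
    refine (piKIsom_coe ν σ (a * b) f).trans ?_
    refine Eq.trans ?_ (congrArg (piKIsom ν σ a) (piKIsom_coe ν σ b f)).symm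
    refine Eq.trans ?_ (piKIsom_coe ν σ a _).symm
    exact congrArg _ (congrArg (fun T => T f) (map_mul (piInf ν σ) (a : G) b))

theorem piK_coe (k : K) (f : HInf ν σ) :
    piK ν σ k (f : PS ν σ) = (piInfK ν σ k f : HInf ν σ) := piKIsom_coe ν σ k f

end

/-- The space `L²_{(M₀,σ)}(K)` of the `f ∈ L²(K)` with `f(m x) = σ(m) f(x)` for every `m ∈ M₀`
and almost every `x ∈ K`. -/
noncomputable def L2sigma (σ : M0 →* ℂˣ) : Submodule ℂ L2K where
  carrier := {f | ∀ m : M0, ∀ᵐ x ∂haarK, f (M0toK m * x) = σ m * f x}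
  zero_mem' m := by
    have h := Lp.coeFn_zero ℂ 2 haarK
    have h' := (measurePreserving_mul_left haarK (M0toK m)).quasiMeasurePreserving.ae_eq_comp h
    filter_upwards [h, h'] with x hx hx'
    simp only [Function.comp_apply] at hx'
    simp
  add_mem' {f g} hf hg m := by
    have h := Lp.coeFn_add f g
    have h' := (measurePreserving_mul_left haarK (M0toK m)).quasiMeasurePreserving.ae_eq_comp h
    filter_upwards [h, h', hf m, hg m] with x hx hx' h1 h2
    simp only [Function.comp_apply, Pi.add_apply] at hx hx'
    rw [hx, hx', h1, h2, mul_add]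
  smul_mem' c f hf m := by
    have h := Lp.coeFn_smul c f
    have h' := (measurePreserving_mul_left haarK (M0toK m)).quasiMeasurePreserving.ae_eq_comp h
    filter_upwards [h, h', hf m] with x hx hx' h1
    simp only [Function.comp_apply, Pi.smul_apply, smul_eq_mul] at hx hx'
    rw [hx, hx', h1, mul_left_comm]

/-! ### Matrix coefficients, elementary functions -/

/-- The matrix coefficient `x ↦ ⟨w, τ_{2l}(x) v⟩`. -/
noncomputable def matCoeff (l : ℕ) (w : Module.Dual ℂ (V (2 * l))) (v : V (2 * l)) : C(K, ℂ) :=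
  ⟨fun x => w (tau l x v), continuous_tau l w v⟩

/-- The map `Φ_l : V_{2l}^* ⊗ V_{2l} → L²(K)`, `w ⊗ v ↦ (x ↦ ⟨w, τ_{2l}(x) v⟩)`. -/
noncomputable def Phi (l : ℕ) : Module.Dual ℂ (V (2 * l)) ⊗[ℂ] V (2 * l) →ₗ[ℂ] L2K :=
  (ContinuousMap.toLp 2 haarK ℂ).toLinearMap ∘ₗ TensorProduct.lift
    (LinearMap.mk₂ ℂ (matCoeff l) (fun _ _ _ => rfl) (fun _ _ _ => rfl)
      (fun w v v' => by ext x; simp [matCoeff]) (fun c w v => by ext x; simp [matCoeff]))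

/-- The `σ`-isotypic component `V_{2l}^*[σ]` of the restriction to `M₀` of the dual
representation of `τ_{2l}`. -/
noncomputable def dualIso (σ : M0 →* ℂˣ) (l : ℕ) : Submodule ℂ (Module.Dual ℂ (V (2 * l))) where
  carrier := {w | ∀ m : M0, (tau l).dual (M0toK m) w = (σ m : ℂ) • w}
  zero_mem' m := by simp
  add_mem' {w w'} h h' m := by rw [map_add, h m, h' m, smul_add]
  smul_mem' c w h m := by rw [map_smul, h m, smul_comm]

section
variable (ν : LieA0 →ₗ[ℝ] ℂ) (σ : M0 →* ℂˣ)

/-- The inverse `r_K⁻¹`. As `r_K` is isometric, its adjoint is its inverse on the range of `r_K`. -/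
noncomputable def rKinv : L2K →L[ℂ] PS ν σ :=
  ContinuousLinearMap.adjoint (rK ν σ).toContinuousLinearMap

theorem rKinv_rK (u : PS ν σ) : rKinv ν σ (rK ν σ u) = u := by
  refine ext_inner_left ℂ fun v => ?_
  rw [rKinv, ContinuousLinearMap.adjoint_inner_right]
  exact (rK ν σ).inner_map_map v u

/-- The map `r_K⁻¹ ∘ Φ_l : V_{2l}^*[σ] ⊗ V_{2l} → H_{(ν,σ)}`. -/
noncomputable def Psi (l : ℕ) : dualIso σ l ⊗[ℂ] V (2 * l) →ₗ[ℂ] PS ν σ :=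
  (rKinv ν σ).toLinearMap ∘ₗ Phi l ∘ₗ TensorProduct.map (dualIso σ l).subtype LinearMap.id

/-- The number `ε(σ;l) ∈ {0,1}` with `ε(σ;l) ≡ l - σ₁ - σ₂ mod 2`. -/
noncomputable def eps (l : ℕ) : ℕ := (((l : ℤ) - sigma1 σ - sigma2 σ) % 2).toNat

/-- The set `Z(σ;l)` of the `k ≡ l - σ₂ mod 2` with `0 ≤ k ≤ l` if `ε(σ;l) = 0`, and with
`0 ≤ k ≤ l - 1` if `ε(σ;l) = 1`. -/
noncomputable def Z (l : ℕ) : Set ℕ :=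
  {k | (k : ℤ) ≡ (l : ℤ) - sigma2 σ [ZMOD 2] ∧
    if eps σ l = 0 then (k : ℤ) ≤ l else (k : ℤ) ≤ (l : ℤ) - 1}

/-- The functional `v_{2l-p}^* + (-1)^{ε(σ;l)} v_p^*`. -/
noncomputable def wVec (l p : ℕ) : Module.Dual ℂ (V (2 * l)) :=
  dualVec (2 * l) (2 * l - p) + (-1 : ℂ) ^ eps σ l • dualVec (2 * l) p

/-- The elementary function `s(l;p,q) ∈ H_{(ν,σ)}`, for `p ∈ Z(σ;l)` and `0 ≤ q ≤ 2l`. -/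
noncomputable def elemFun (l p : ℕ) (q : Fin (2 * l + 1)) : PS ν σ :=
  rKinv ν σ (Phi l (wVec σ l p ⊗ₜ stdVec (2 * l) q))

/-- The space `⟨S(l;p)⟩` spanned by the functions `s(l;p,q)`, `0 ≤ q ≤ 2l`. -/
noncomputable def spanS (l p : ℕ) : Submodule ℂ (PS ν σ) :=
  Submodule.span ℂ (Set.range (elemFun ν σ l p))

/-- The `τ_{2l}`-isotypic component of `H_{(ν,σ)}`: the sum of all the subrepresentations of `K`
that are isomorphic to `τ_{2l}`. -/
noncomputable def isotypic (l : ℕ) : Submodule ℂ (PS ν σ) :=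
  ⨆ W : {W : Subrepresentation (piK ν σ) //
    Nonempty ((tau l).Equiv W.toRepresentation)}, W.1.toSubmodule

/-- The `K`-finite part `H_{(ν,σ),K}`: the vectors whose `K`-orbit spans a finite-dimensional
space. -/
noncomputable def KFinite : Subrepresentation (piK ν σ) where
  toSubmodule :=
    { carrier := {u | FiniteDimensional ℂ
        (Submodule.span ℂ (Set.range fun k : K => piK ν σ k u))}
      zero_mem' := by
        have : Submodule.span ℂ (Set.range fun k : K => piK ν σ k 0) = ⊥ := by
          rw [Submodule.span_eq_bot]
          rintro _ ⟨k, rfl⟩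
          exact map_zero _
        change FiniteDimensional ℂ (Submodule.span ℂ _)
        rw [this]
        infer_instance
      add_mem' := by
        intro u v hu hv
        have hu' : FiniteDimensional ℂ (Submodule.span ℂ _) := hu
        have hv' : FiniteDimensional ℂ (Submodule.span ℂ _) := hv
        refine Submodule.finiteDimensional_of_le (Submodule.span_le.2 ?_ :
          _ ≤ Submodule.span ℂ (Set.range fun k : K => piK ν σ k u) ⊔
            Submodule.span ℂ (Set.range fun k : K => piK ν σ k v))
        rintro _ ⟨k, rfl⟩
        simp only [map_add]
        exact Submodule.add_mem_sup (Submodule.subset_span ⟨k, rfl⟩)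
          (Submodule.subset_span ⟨k, rfl⟩)
      smul_mem' := by
        intro c u hu
        have hu' : FiniteDimensional ℂ (Submodule.span ℂ _) := hu
        refine Submodule.finiteDimensional_of_le (Submodule.span_le.2 ?_ :
          _ ≤ Submodule.span ℂ (Set.range fun k : K => piK ν σ k u))
        rintro _ ⟨k, rfl⟩
        simp only [map_smul]
        exact Submodule.smul_mem _ _ (Submodule.subset_span ⟨k, rfl⟩) }
  apply_mem_toSubmodule := by
    intro g u hu
    have hu' : FiniteDimensional ℂ (Submodule.span ℂ _) := hu
    refine Submodule.finiteDimensional_of_le (Submodule.span_le.2 ?_ :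
      _ ≤ Submodule.span ℂ (Set.range fun k : K => piK ν σ k u))
    rintro _ ⟨k, rfl⟩
    refine Submodule.subset_span ⟨k * g, ?_⟩
    simp [map_mul]

/-- The space `Hom_K(V_{2l}, H_{(ν,σ),K})` of intertwining operators. -/
abbrev HomK (l : ℕ) : Type := (tau l).IntertwiningMap (KFinite ν σ).toRepresentation

end

/-! ### The invariant inner products -/

/-- The inner product `∑ i, a i * conj (c x i) * c y i` for linear coordinates `c` and positive
weights `a`. -/
@[reducible]
noncomputable def weightedCore {E : Type} [AddCommGroup E] [Module ℂ E] {n : ℕ}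
    (c : E →ₗ[ℂ] (Fin n → ℂ)) (hc : ∀ x, c x = 0 → x = 0) (a : Fin n → ℝ) (ha : ∀ i, 0 < a i) :
    InnerProductSpace.Core ℂ E where
  inner x y := ∑ i, (a i : ℂ) * (star (c x i) * c y i)
  conj_inner_symm x y := by
    simp only [map_sum, map_mul, Complex.conj_ofReal, Complex.star_def, Complex.conj_conj]
    exact Finset.sum_congr rfl fun i _ => by ring
  re_inner_nonneg x := by
    rw [map_sum]
    refine Finset.sum_nonneg fun i _ => ?_
    rw [Complex.star_def, mul_comm (starRingEnd ℂ _), Complex.mul_conj, ← Complex.ofReal_mul]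
    exact mul_nonneg (ha i).le (Complex.normSq_nonneg _)
  add_left x y z := by
    rw [← Finset.sum_add_distrib]
    exact Finset.sum_congr rfl fun i _ => by simp; ring
  smul_left x y r := by
    rw [Finset.mul_sum]
    exact Finset.sum_congr rfl fun i _ => by simp; ring
  definite x hx := by
    refine hc x (funext fun i => ?_)
    have h : ∑ i, a i * Complex.normSq (c x i) = 0 := by
      have h' : ((∑ i, a i * Complex.normSq (c x i) : ℝ) : ℂ) = 0 := by
        rw [← hx, Complex.ofReal_sum]
        refine Finset.sum_congr rfl fun i _ => ?_
        rw [Complex.star_def, mul_comm (starRingEnd ℂ _), Complex.mul_conj, ← Complex.ofReal_mul]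
      exact_mod_cast h'
    have h2 := (Finset.sum_eq_zero_iff_of_nonneg fun i _ =>
      mul_nonneg (ha i).le (Complex.normSq_nonneg _)).1 h i (Finset.mem_univ i)
    rcases mul_eq_zero.1 h2 with h3 | h3
    · exact absurd h3 (ha i).ne'
    · exact Complex.normSq_eq_zero.1 h3

/-- The `SU(2)`-invariant inner product on `V_n`: the vectors `v_k` are orthogonal, and
`‖v_k‖² = (n choose k)⁻¹`. -/
@[reducible]
noncomputable def coreV (n : ℕ) : InnerProductSpace.Core ℂ (V n) :=
  weightedCore (LinearMap.pi fun k : Fin (n + 1) => dualVec n k)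
    (fun _ h => V_ext fun k => congrFun h k) (fun k => ((n.choose k : ℝ))⁻¹)
    (fun k => inv_pos.2 (Nat.cast_pos.2 (Nat.choose_pos (Nat.lt_succ_iff.1 k.2))))

/-- The dual inner product on `V_n^*`: the vectors `v_k^*` are orthogonal, and
`‖v_k^*‖² = (n choose k)`. -/
@[reducible]
noncomputable def coreDual (n : ℕ) : InnerProductSpace.Core ℂ (Module.Dual ℂ (V n)) :=
  weightedCore (LinearMap.pi fun k : Fin (n + 1) => LinearMap.applyₗ (stdVec n k))
    (fun w h => LinearMap.ext fun v => by
      rw [V_sum v, map_sum, LinearMap.zero_apply]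
      refine Finset.sum_eq_zero fun k _ => ?_
      have hk : w (stdVec n k) = 0 := congrFun h k
      rw [map_smul, hk, smul_zero])
    (fun k => (n.choose k : ℝ))
    (fun k => Nat.cast_pos.2 (Nat.choose_pos (Nat.lt_succ_iff.1 k.2)))

noncomputable instance (n : ℕ) : NormedAddCommGroup (V n) := (coreV n).toNormedAddCommGroup
noncomputable instance (n : ℕ) : InnerProductSpace ℂ (V n) := .ofCore (coreV n).toCore

noncomputable instance (n : ℕ) : NormedAddCommGroup (Module.Dual ℂ (V n)) :=
  (coreDual n).toNormedAddCommGroup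
noncomputable instance (n : ℕ) : InnerProductSpace ℂ (Module.Dual ℂ (V n)) :=
  .ofCore (coreDual n).toCore

/-- The Hilbert space direct sum of the spaces `V_{2l}^*[σ] ⊗ V_{2l}`, `l ≥ 0`. -/
abbrev HilbertSum (σ : M0 →* ℂˣ) : Type :=
  lp (fun l : ℕ => dualIso σ l ⊗[ℂ] V (2 * l)) 2

end SL3PS

open SL3PS

namespace SL3PS

/-! ### Evaluation of homogeneous polynomials and power vectors -/

/-! Everything is reduced to `L²(K)`, where the statement becomes Peter-Weyl theory for `SO(3)`,
made explicit by polynomials.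

The powers `(a x + b y)^n` are reproducing kernels for the given inner product and are permuted by
`SU(2)`, so this inner product is invariant (`inner_tauSU`). Irreducibility follows from one torus
element with distinct eigenvalues and one rotation that mixes the weights. Schur's lemma then yields
the orthogonality relations (`inner_Phi_Phi`, `inner_Phi_Phi_of_ne`): the map `Φ_l` multiplies inner
products by `1/(2l+1)`, and the images for different `l` are orthogonal.

Completeness of the matrix coefficients is a dimension count (`mem_matSpan_of_pullSU`). The
polynomials of degree `2l` in the entries of `SU(2)` span at most `C(2l+3, 3) = ∑_{j ≤ l} (2j+1)²`
dimensions, and the matrix coefficients with `j ≤ l` are that many independent elements of this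
space. Hence every polynomial function on `SO(3)` is a combination of matrix coefficients, and
polynomial functions are dense by Stone-Weierstrass.

The range of `r_K` is closed because `r_K` is isometric. It contains the `M₀`-equivariant polynomial
functions, because the explicit Iwasawa decomposition `g = n a κ(g)` extends each of them smoothly
to `G` (`exists_restrictK_eq`). Averaging over `M₀` is the orthogonal projection to the equivariant
functions and preserves polynomiality, so the range is all of `L²_{(M₀,σ)}(K)` (`range_rK`). The
same averaging acts on matrix coefficients through the functional `w` alone, which gives the Hilbert
sum decomposition (`isHilbertSum_Psi`).

By Schur's lemma in each summand, every `K`-map from `V_{2l}` to `H_{(ν,σ)}` is `v ↦ r_K⁻¹ Φ_l(w ⊗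
v)` for some `w` in `V_{2l}^*[σ]` (`exists_Psi_eq`). Isotypic components and multiplicities are thus
read off from `V_{2l}^*[σ]`. Two generators of `M₀` act on the `v_k` by a sign and by the signed
reflection `k ↦ 2l - k`, so the functionals indexed by `Z(σ;l)` form a basis, and counting them
gives `d(σ;l)`. -/

theorem V_inner_def (n : ℕ) (f g : V n) : inner ℂ f g =
    ∑ k : Fin (n + 1), (((n.choose k : ℝ)⁻¹ : ℝ) : ℂ) * (star (dualVec n k f) * dualVec n k g) :=
  rfl

theorem dual_inner_def (n : ℕ) (w w' : Module.Dual ℂ (V n)) : inner ℂ w w' =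
    ∑ k : Fin (n + 1), ((n.choose k : ℝ) : ℂ) * (star (w (stdVec n k)) * w' (stdVec n k)) :=
  rfl

theorem stdVec_coe (n : ℕ) (k : Fin (n + 1)) : (stdVec n k : MvPolynomial (Fin 2) ℂ) =
    MvPolynomial.X 0 ^ (k : ℕ) * MvPolynomial.X 1 ^ (n - k : ℕ) := by
  simp only [stdVec, expo]
  rw [MvPolynomial.monomial_add_single, MvPolynomial.X_pow_eq_monomial,
    MvPolynomial.X_pow_eq_monomial]

theorem eval_eq_sum (n : ℕ) (f : V n) (u : Fin 2 → ℂ) : MvPolynomial.eval u f.1 =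
    ∑ k : Fin (n + 1), dualVec n k f * (u 0 ^ (k : ℕ) * u 1 ^ (n - k : ℕ)) := by
  conv_lhs => rw [V_sum f]
  simp [stdVec_coe]

theorem eval_subst (A : Matrix (Fin 2) (Fin 2) ℂ) (f : MvPolynomial (Fin 2) ℂ) (u : Fin 2 → ℂ) :
    MvPolynomial.eval u (subst A f) = MvPolynomial.eval (A.mulVec u) f := by
  induction f using MvPolynomial.induction_on with
  | C a => simp [subst]
  | add p q hp hq => simp [hp, hq]
  | mul_X p i hp =>
    rw [map_mul, map_mul, hp, map_mul]
    congr 1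
    simp only [subst, MvPolynomial.aeval_X, map_sum, map_mul, MvPolynomial.eval_C,
      MvPolynomial.eval_X]
    rfl

/-- The basis of the `v_k` of `V_n`. -/
noncomputable def stdBasis (n : ℕ) : Module.Basis (Fin (n + 1)) ℂ (V n) :=
  Module.Basis.ofEquivFun
    { toFun := fun f k => dualVec n k f
      invFun := fun c => ∑ k, c k • stdVec n k
      map_add' := fun f g => by ext; simp
      map_smul' := fun c f => by ext; simp
      left_inv := fun f => (V_sum f).symm
      right_inv := fun c => by ext; simp [map_sum, dualVec_stdVec] }

theorem stdBasis_apply (n : ℕ) (k : Fin (n + 1)) : stdBasis n k = stdVec n k := by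
  simp [stdBasis, Module.Basis.coe_ofEquivFun]

instance (n : ℕ) : FiniteDimensional ℂ (V n) := Module.Finite.of_basis (stdBasis n)

theorem finrank_V (n : ℕ) : Module.finrank ℂ (V n) = n + 1 := by
  simpa using Module.finrank_eq_card_basis (stdBasis n)

/-- The power `(a x + b y)^n` of a linear form. -/
noncomputable def powVec (n : ℕ) (u : Fin 2 → ℂ) : V n :=
  ∑ k : Fin (n + 1), ((n.choose k : ℂ) * (u 0 ^ (k : ℕ) * u 1 ^ (n - k : ℕ))) • stdVec n k

theorem dualVec_powVec (n : ℕ) (u : Fin 2 → ℂ) (k : Fin (n + 1)) :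
    dualVec n k (powVec n u) = (n.choose k : ℂ) * (u 0 ^ (k : ℕ) * u 1 ^ (n - k : ℕ)) := by
  simp [powVec, map_sum, dualVec_stdVec]

theorem powVec_coe (n : ℕ) (u : Fin 2 → ℂ) : (powVec n u : MvPolynomial (Fin 2) ℂ) =
    (MvPolynomial.C (u 0) * MvPolynomial.X 0 + MvPolynomial.C (u 1) * MvPolynomial.X 1) ^ n := by
  rw [add_pow, ← Fin.sum_univ_eq_sum_range (fun k => (MvPolynomial.C (u 0) * MvPolynomial.X 0) ^ k *
    (MvPolynomial.C (u 1) * MvPolynomial.X 1) ^ (n - k) *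
      ((n.choose k : ℕ) : MvPolynomial (Fin 2) ℂ)) (n + 1)]
  simp only [powVec, AddSubmonoidClass.coe_finsetSum, SetLike.val_smul, stdVec_coe,
    MvPolynomial.smul_eq_C_mul]
  refine Finset.sum_congr rfl fun k _ => ?_
  simp only [map_mul, map_pow, map_natCast, mul_pow]
  ring

/-- The weights `(n choose k)⁻¹` of the norm cancel the binomial coefficients of the power, so that
powers of linear forms are reproducing kernels. -/
theorem inner_powVec (n : ℕ) (u : Fin 2 → ℂ) (f : V n) :
    inner ℂ (powVec n u) f = MvPolynomial.eval (star u) f.1 := by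
  rw [V_inner_def, eval_eq_sum]
  refine Finset.sum_congr rfl fun k _ => ?_
  have : (n.choose k : ℂ) ≠ 0 :=
    Nat.cast_ne_zero.2 (Nat.choose_pos (Nat.lt_succ_iff.1 k.2)).ne'
  rw [dualVec_powVec]
  simp
  field_simp

/-- A polynomial orthogonal to all powers vanishes at every point of `ℂ²` by the reproducing
property, hence is zero. -/
theorem span_powVec (n : ℕ) : Submodule.span ℂ (Set.range (powVec n)) = ⊤ := by
  rw [← Submodule.orthogonal_eq_bot_iff, Submodule.eq_bot_iff]
  intro f hf
  have h : ∀ u, MvPolynomial.eval u f.1 = MvPolynomial.eval u 0 := fun u => by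
    have := (Submodule.mem_orthogonal _ _).1 hf _ (Submodule.subset_span ⟨star u, rfl⟩)
    rw [inner_powVec, star_star] at this
    rw [this, map_zero]
  exact Subtype.ext (MvPolynomial.funext h)

theorem tauSU_powVec (n : ℕ) (g : SU2) (u : Fin 2 → ℂ) :
    tauSU n g (powVec n u) = powVec n ((g⁻¹ : SU2).1.transpose.mulVec u) := by
  apply Subtype.ext
  rw [tauSU_apply, powVec_coe, powVec_coe]
  simp [subst, Matrix.mulVec, dotProduct, Fin.sum_univ_two]
  ring

/-- Since the powers of linear forms span and are permuted by the group, invariance need only be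
tested against a reproducing kernel in the first argument. -/
theorem inner_tauSU (n : ℕ) (g : SU2) (f h : V n) :
    inner ℂ (tauSU n g f) (tauSU n g h) = inner ℂ f h := by
  have hf : f ∈ Submodule.span ℂ (Set.range (powVec n)) := span_powVec n ▸ trivial
  induction hf using Submodule.span_induction with
  | zero => simp
  | add x y _ _ hx hy => simp only [map_add, inner_add_left, hx, hy]
  | smul c x _ hx => simp only [map_smul, inner_smul_left, hx]
  | mem x hx =>
    obtain ⟨u, rfl⟩ := hx
    rw [tauSU_powVec, inner_powVec, inner_powVec, tauSU_apply, eval_subst]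
    congr 2
    -- With `B = g⁻¹`, the conjugate of `Bᵀ u` is `B* ū`, so the point of evaluation is `B B* ū =
    -- ū`.
    have h1 : (g⁻¹ : SU2).1 * star (g⁻¹ : SU2).1 = 1 :=
      Matrix.mem_unitaryGroup_iff.1 (Matrix.mem_specialUnitaryGroup_iff.1 (g⁻¹).2).1
    rw [Matrix.star_mulVec, ← Matrix.mulVec_transpose]
    change (g⁻¹ : SU2).1.mulVec ((star (g⁻¹ : SU2).1).mulVec (star u)) = _
    rw [Matrix.mulVec_mulVec, h1, Matrix.one_mulVec]

/-! ### Irreducibility -/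
-- A stable subspace is stable under polynomials in `T`, and the Lagrange polynomial that is `1` at
-- `μ i` and `0` at the other eigenvalues isolates the `i`-th term of the sum.
theorem sum_smul_mem_of_eigen {E : Type*} [AddCommGroup E] [Module ℂ E] {ι : Type*} [Fintype ι]
    [DecidableEq ι] (T : E →ₗ[ℂ] E) (W : Submodule ℂ E) (hT : ∀ x ∈ W, T x ∈ W) (e : ι → E) (μ : ι → ℂ)
    (hμ : Function.Injective μ) (he : ∀ i, T (e i) = μ i • e i) (c : ι → ℂ)
    (hc : ∑ i, c i • e i ∈ W) (i : ι) (hi : c i ≠ 0) : e i ∈ W := by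
  have hp : ∀ (p : Polynomial ℂ) (x : E), x ∈ W → Polynomial.aeval T p x ∈ W := by
    intro p x hx
    induction p using Polynomial.induction_on' with
    | add p q hp hq => rw [map_add]; exact W.add_mem hp hq
    | monomial k a =>
      rw [Polynomial.aeval_monomial]
      refine W.smul_mem a ?_
      induction k with
      | zero => simpa using hx
      | succ k ih => rw [pow_succ']; exact hT _ ih
  have hep : ∀ (p : Polynomial ℂ) (j : ι), Polynomial.aeval T p (e j) = p.eval (μ j) • e j := by
    intro p j
    induction p using Polynomial.induction_on' with
    | add p q hp hq => simp [hp, hq, add_smul]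
    | monomial k a =>
      rw [Polynomial.aeval_monomial, Polynomial.eval_monomial, mul_smul]
      change a • (T ^ k) (e j) = _
      congr 1
      induction k with
      | zero => simp
      | succ k ih => rw [pow_succ', Module.End.mul_apply, ih, map_smul, he, smul_smul, pow_succ]
  have h := hp (Lagrange.basis Finset.univ μ i) _ hc
  rw [map_sum, Finset.sum_eq_single i] at h
  · rw [map_smul, hep, Lagrange.eval_basis_self hμ.injOn (Finset.mem_univ i), one_smul] at h
    exact (W.smul_mem_iff hi).1 h
  · intro j _ hj
    rw [map_smul, hep, Lagrange.eval_basis_of_ne hj.symm (Finset.mem_univ j), zero_smul, smul_zero]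
  · simp

/-- The element `diag(e^{iθ}, e^{-iθ})` of `SU(2)`. -/
noncomputable def torus (θ : ℝ) : SU2 :=
  SU2.mk (p := Real.cos θ) (q := Real.sin θ) (r := 0) (s := 0) (by simp)

theorem tauSU_torus (n : ℕ) (θ : ℝ) (k : Fin (n + 1)) :
    tauSU n (torus θ) (stdVec n k) =
      Complex.exp (((θ * (n - 2 * (k : ℕ)) : ℝ) : ℂ) * Complex.I) • stdVec n k := by
  have hinv : ((torus θ)⁻¹ : SU2).1 =
      !![Complex.exp (-(θ * Complex.I)), 0; 0, Complex.exp (θ * Complex.I)] := by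
    rw [← Matrix.star_eq_inv, Matrix.specialUnitaryGroup.coe_star, ← neg_mul,
      ← Complex.ofReal_neg, Complex.exp_mul_I, Complex.exp_mul_I]
    ext i j
    fin_cases i <;> fin_cases j <;> simp [torus, SU2.mk, Complex.ext_iff,
      ← Complex.ofReal_cos, ← Complex.ofReal_sin]
  have hk : (k : ℕ) ≤ n := Nat.lt_succ_iff.1 k.2
  apply Subtype.ext
  rw [tauSU_apply, SetLike.val_smul, stdVec_coe, hinv, MvPolynomial.smul_eq_C_mul]
  have he : Complex.exp (((θ * (n - 2 * (k : ℕ)) : ℝ) : ℂ) * Complex.I) =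
      Complex.exp (-(θ * Complex.I)) ^ (k : ℕ) * Complex.exp (θ * Complex.I) ^ (n - k : ℕ) := by
    rw [← Complex.exp_nat_mul, ← Complex.exp_nat_mul, ← Complex.exp_add]
    congr 1
    push_cast [Nat.cast_sub hk]
    ring
  rw [he]
  simp [subst]
  ring

/-- The `v_k` are eigenvectors of the torus for distinct weights, so an invariant subspace contains
each `v_k` that occurs in one of its elements. -/
theorem stdVec_mem_of_dualVec_ne_zero {n : ℕ} {W : Submodule ℂ (V n)}
    (hW : ∀ g : SU2, ∀ f ∈ W, tauSU n g f ∈ W) {f : V n} (hf : f ∈ W) {k : Fin (n + 1)}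
    (hk : dualVec n k f ≠ 0) : stdVec n k ∈ W := by
  -- For the angle `1/(n+1)` all exponents `θ(n - 2k)` lie in `(-1, 1)`, where `t ↦ e^{it}` is
  -- injective; a single torus element therefore separates all weights.
  refine sum_smul_mem_of_eigen (tauSU n (torus (1 / (n + 1)))) W (hW _) (stdVec n)
    (fun k => Complex.exp (((1 / (n + 1) * (n - 2 * (k : ℕ)) : ℝ) : ℂ) * Complex.I)) ?_
    (fun k => tauSU_torus n _ k) (fun k => dualVec n k f) (V_sum f ▸ hf) k hk
  intro i j hij
  have hb : ∀ k : Fin (n + 1), -Real.pi < 1 / ((n : ℝ) + 1) * (n - 2 * (k : ℕ)) ∧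
      1 / ((n : ℝ) + 1) * (n - 2 * (k : ℕ)) ≤ Real.pi := by
    intro k
    have hk : ((k : ℕ) : ℝ) ≤ n := by exact_mod_cast Nat.lt_succ_iff.1 k.2
    have hk0 : (0 : ℝ) ≤ (k : ℕ) := Nat.cast_nonneg _
    have hpi := Real.pi_gt_three
    have hn : (0 : ℝ) < n + 1 := by positivity
    rw [one_div_mul_eq_div, lt_div_iff₀ hn, div_le_iff₀ hn]
    constructor <;> nlinarith
  have him : ∀ t : ℝ, ((t : ℂ) * Complex.I).im = t := by simp
  have h := Complex.exp_inj_of_neg_pi_lt_of_le_pi (by rw [him]; exact (hb i).1)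
    (by rw [him]; exact (hb i).2) (by rw [him]; exact (hb j).1) (by rw [him]; exact (hb j).2) hij
  have h2 := mul_right_cancel₀ Complex.I_ne_zero h
  have hn : (1 / ((n : ℝ) + 1)) ≠ 0 := by positivity
  have h3 := mul_left_cancel₀ hn (Complex.ofReal_injective h2)
  have h4 : ((i : ℕ) : ℝ) = (j : ℕ) := by linarith
  exact Fin.ext (by exact_mod_cast h4)

/-- From one `v_k` a rotation produces a vector with a nonzero `x^n` coefficient, and from `x^n` it
produces a vector all of whose coefficients are nonzero. -/
theorem eq_top_of_tauSU_invariant {n : ℕ} {W : Submodule ℂ (V n)}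
    (hW : ∀ g : SU2, ∀ f ∈ W, tauSU n g f ∈ W) (hne : W ≠ ⊥) : W = ⊤ := by
  obtain ⟨f, hf, hf0⟩ := Submodule.exists_mem_ne_zero_of_ne_bot hne
  obtain ⟨k, hk⟩ : ∃ k : Fin (n + 1), dualVec n k f ≠ 0 := by
    by_contra! h
    exact hf0 (V_ext h)
  have hk' := stdVec_mem_of_dualVec_ne_zero hW hf hk
  -- Any real rotation with nonzero sine and cosine would do; the 3-4-5 triangle keeps the entries
  -- rational.
  let g : SU2 := SU2.mk (p := 3 / 5) (q := 0) (r := 4 / 5) (s := 0) (by norm_num)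
  have hg : (g⁻¹ : SU2).1 = !![3 / 5, -4 / 5; 4 / 5, 3 / 5] := by
    rw [← Matrix.star_eq_inv, Matrix.specialUnitaryGroup.coe_star]
    ext i j
    fin_cases i <;> fin_cases j <;> simp [g, SU2.mk, Complex.ext_iff, neg_div]
  have hlast : stdVec n (Fin.last n) ∈ W := by
    refine stdVec_mem_of_dualVec_ne_zero hW (hW g _ hk') ?_
    -- The coefficient of `x^n` is the value at `(1, 0)`, so here it is the value of `v_k` at `(3/5,
    -- 4/5)`, a product of nonzero numbers.
    have h1 : dualVec n (Fin.last n) (tauSU n g (stdVec n k)) =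
        MvPolynomial.eval ![1, 0] (tauSU n g (stdVec n k)).1 := by
      rw [eval_eq_sum, Finset.sum_eq_single (Fin.last n)]
      · simp
      · intro j _ hj
        have := Fin.val_lt_last hj
        have h0 : n - (j : ℕ) ≠ 0 := by omega
        simp [h0]
      · simp
    rw [h1, tauSU_apply, eval_subst, hg, stdVec_coe]
    simp
  have hpow : stdVec n (Fin.last n) = powVec n ![1, 0] := by
    apply Subtype.ext
    rw [stdVec_coe, powVec_coe]
    simp
  rw [eq_top_iff]
  intro v _
  rw [V_sum v]
  refine W.sum_mem fun j _ => W.smul_mem _ ?_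
  refine stdVec_mem_of_dualVec_ne_zero hW (hW g _ hlast) ?_
  rw [hpow, tauSU_powVec, dualVec_powVec, hg]
  have : (n.choose j : ℂ) ≠ 0 :=
    Nat.cast_ne_zero.2 (Nat.choose_pos (Nat.lt_succ_iff.1 j.2)).ne'
  simp [this]

theorem tau_isIrreducible (l : ℕ) : (tau l).IsIrreducible := by
  have h0 : stdVec (2 * l) 0 ≠ 0 := by
    rw [← stdBasis_apply]
    exact (stdBasis (2 * l)).ne_zero 0
  have hnt : Nontrivial (Subrepresentation (tau l)) := by
    refine ⟨⊥, ⊤, fun h => h0 ?_⟩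
    have : stdVec (2 * l) 0 ∈ (⊤ : Subrepresentation (tau l)) := trivial
    rw [← h] at this
    exact this
  refine { eq_bot_or_eq_top := fun W => ?_ }
  by_cases h : W.toSubmodule = ⊥
  · exact .inl (Subrepresentation.toSubmodule_injective h)
  · refine .inr (Subrepresentation.toSubmodule_injective (eq_top_of_tauSU_invariant ?_ h))
    intro g f hf
    rw [← tau_spinCover]
    exact W.apply_mem_toSubmodule _ hf

theorem inner_tau (l : ℕ) (k : K) (f h : V (2 * l)) :
    inner ℂ (tau l k f) (tau l k h) = inner ℂ f h := by
  obtain ⟨g, rfl⟩ := spinCover_surjective k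
  rw [tau_spinCover, inner_tauSU]

/-! ### Schur orthogonality -/

theorem inner_stdVec (n : ℕ) (k : Fin (n + 1)) (f : V n) :
    inner ℂ (stdVec n k) f = (n.choose k : ℂ)⁻¹ * dualVec n k f := by
  rw [V_inner_def, Finset.sum_eq_single k]
  · simp [dualVec_stdVec]
  · intro j _ hj
    simp [dualVec_stdVec, hj]
  · simp

theorem choose_ne_zero_fin (n : ℕ) (k : Fin (n + 1)) : (n.choose k : ℂ) ≠ 0 :=
  Nat.cast_ne_zero.2 (Nat.choose_pos (Nat.lt_succ_iff.1 k.2)).ne'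

/-- The Riesz representative of a functional on `V_n`. -/
noncomputable def riesz (n : ℕ) (w : Module.Dual ℂ (V n)) : V n :=
  ∑ k : Fin (n + 1), ((n.choose k : ℂ) * star (w (stdVec n k))) • stdVec n k

theorem inner_riesz (n : ℕ) (w : Module.Dual ℂ (V n)) (v : V n) : inner ℂ (riesz n w) v = w v := by
  rw [riesz, sum_inner]
  conv_rhs => rw [V_sum v, map_sum]
  refine Finset.sum_congr rfl fun k _ => ?_
  have := choose_ne_zero_fin n k
  rw [inner_smul_left, inner_stdVec, map_smul]
  simp
  field_simp

theorem inner_dual (n : ℕ) (w w' : Module.Dual ℂ (V n)) : inner ℂ w w' = w' (riesz n w) := by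
  rw [dual_inner_def, riesz, map_sum]
  refine Finset.sum_congr rfl fun k _ => ?_
  rw [map_smul, smul_eq_mul]
  simp [mul_assoc]

theorem inner_tau_left (l : ℕ) (k : K) (f h : V (2 * l)) :
    inner ℂ (tau l k f) h = inner ℂ f (tau l k⁻¹ h) := by
  rw [← inner_tau l k f, ← Module.End.mul_apply, ← map_mul, mul_inv_cancel, map_one,
    Module.End.one_apply]

/-- Composition with `τ(k)` moves the Riesz representative by the unitary operator `τ(k)⁻¹`. -/
theorem inner_comp_tau (l : ℕ) (k : K) (w w' : Module.Dual ℂ (V (2 * l))) :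
    inner ℂ (w ∘ₗ tau l k) (w' ∘ₗ tau l k) = inner ℂ w w' := by
  have h : riesz (2 * l) (w ∘ₗ tau l k) = tau l k⁻¹ (riesz (2 * l) w) := by
    refine ext_inner_right ℂ fun v => ?_
    rw [inner_riesz, inner_tau_left, inv_inv, inner_riesz]
    rfl
  rw [inner_dual, inner_dual, h, LinearMap.comp_apply, ← Module.End.mul_apply, ← map_mul,
    mul_inv_cancel, map_one, Module.End.one_apply]

theorem Phi_tmul (l : ℕ) (w : Module.Dual ℂ (V (2 * l))) (v : V (2 * l)) :
    Phi l (w ⊗ₜ v) = ContinuousMap.toLp 2 haarK ℂ (matCoeff l w v) := rfl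

theorem inner_Phi (l l' : ℕ) (w : Module.Dual ℂ (V (2 * l))) (v : V (2 * l))
    (w' : Module.Dual ℂ (V (2 * l'))) (v' : V (2 * l')) :
    inner ℂ (Phi l (w ⊗ₜ v)) (Phi l' (w' ⊗ₜ v')) =
      ∫ x : K, w' (tau l' x v') * star (w (tau l x v)) ∂haarK := by
  rw [Phi_tmul, Phi_tmul, ContinuousMap.inner_toLp]
  rfl

theorem inner_Phi_tau (l l' : ℕ) (k : K) (w : Module.Dual ℂ (V (2 * l))) (v : V (2 * l))
    (w' : Module.Dual ℂ (V (2 * l'))) (v' : V (2 * l')) :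
    inner ℂ (Phi l (w ⊗ₜ tau l k v)) (Phi l' (w' ⊗ₜ tau l' k v')) =
      inner ℂ (Phi l (w ⊗ₜ v)) (Phi l' (w' ⊗ₜ v')) := by
  rw [inner_Phi, inner_Phi,
    ← integral_mul_right_eq_self (fun x : K => w' (tau l' x v') * star (w (tau l x v))) k]
  simp only [map_mul, Module.End.mul_apply]

/-- The operator representing the form `⟨Φ_l(w ⊗ ·), Φ_{l'}(w' ⊗ ·)⟩`. -/
noncomputable def schurMap (l l' : ℕ) (w : Module.Dual ℂ (V (2 * l)))
    (w' : Module.Dual ℂ (V (2 * l'))) : V (2 * l') →ₗ[ℂ] V (2 * l) where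
  toFun v' := ∑ k : Fin (2 * l + 1), (((2 * l).choose k : ℂ) *
    inner ℂ (Phi l (w ⊗ₜ stdVec (2 * l) k)) (Phi l' (w' ⊗ₜ v'))) • stdVec (2 * l) k
  map_add' a b := by
    rw [← Finset.sum_add_distrib]
    refine Finset.sum_congr rfl fun k _ => ?_
    rw [TensorProduct.tmul_add, map_add, inner_add_right, mul_add, add_smul]
  map_smul' c a := by
    rw [RingHom.id_apply, Finset.smul_sum]
    refine Finset.sum_congr rfl fun k _ => ?_
    rw [TensorProduct.tmul_smul, map_smul, inner_smul_right, smul_smul, mul_left_comm]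

/-- The coefficients in `schurMap` are those of the expansion in the orthogonal basis `v_k`, the
binomials making up for `‖v_k‖² = (2l choose k)⁻¹`. -/
theorem inner_schurMap (l l' : ℕ) (w : Module.Dual ℂ (V (2 * l)))
    (w' : Module.Dual ℂ (V (2 * l'))) (v : V (2 * l)) (v' : V (2 * l')) :
    inner ℂ v (schurMap l l' w w' v') = inner ℂ (Phi l (w ⊗ₜ v)) (Phi l' (w' ⊗ₜ v')) := by
  conv_rhs => rw [V_sum v, TensorProduct.tmul_sum, map_sum, sum_inner]
  change inner ℂ v (∑ k : Fin (2 * l + 1), _) = _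
  rw [inner_sum]
  refine Finset.sum_congr rfl fun k _ => ?_
  have := choose_ne_zero_fin (2 * l) k
  rw [inner_smul_right, TensorProduct.tmul_smul, map_smul, inner_smul_left,
    ← inner_conj_symm v, inner_stdVec]
  simp
  field_simp

/-- `schurMap` as an intertwining operator. -/
noncomputable def schurInt (l l' : ℕ) (w : Module.Dual ℂ (V (2 * l)))
    (w' : Module.Dual ℂ (V (2 * l'))) : (tau l').IntertwiningMap (tau l) where
  toLinearMap := schurMap l l' w w'
  isIntertwining' k := by
    ext1 v'
    refine ext_inner_left ℂ fun v => ?_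
    rw [LinearMap.comp_apply, LinearMap.comp_apply, inner_schurMap]
    have h := inner_tau_left l k⁻¹ v (schurMap l l' w w' v')
    rw [inv_inv] at h
    have h2 := inner_Phi_tau l l' k w (tau l k⁻¹ v) w' v'
    rw [← Module.End.mul_apply (tau l k) (tau l k⁻¹), ← map_mul, mul_inv_cancel, map_one,
      Module.End.one_apply] at h2
    rw [← h, inner_schurMap, h2]

/-- By Schur's lemma a nonzero intertwining map would be bijective, but the dimensions `2l + 1` and
`2l' + 1` differ. -/
theorem intertwiningMap_eq_zero {l l' : ℕ} (h : l ≠ l') (T : (tau l').IntertwiningMap (tau l)) :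
    T = 0 := by
  have := tau_isIrreducible l
  have := tau_isIrreducible l'
  refine (Representation.IsIrreducible.bijective_or_eq_zero T).resolve_left fun hb => h ?_
  have := (LinearEquiv.ofBijective T.toLinearMap hb).finrank_eq
  rw [finrank_V, finrank_V] at this
  omega

theorem intertwiningMap_eq_smul (l : ℕ) (T : (tau l).IntertwiningMap (tau l)) :
    ∃ c : ℂ, ∀ v, T v = c • v := by
  have := tau_isIrreducible l
  obtain ⟨c, hc⟩ := (Representation.IsIrreducible.algebraMap_intertwiningMap_bijective_of_isAlgClosed
    (k := ℂ) (ρ := tau l)).2 T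
  refine ⟨c, fun v => ?_⟩
  rw [← hc]
  simp

theorem inner_Phi_of_ne {l l' : ℕ} (h : l ≠ l') (w : Module.Dual ℂ (V (2 * l))) (v : V (2 * l))
    (w' : Module.Dual ℂ (V (2 * l'))) (v' : V (2 * l')) :
    inner ℂ (Phi l (w ⊗ₜ v)) (Phi l' (w' ⊗ₜ v')) = 0 := by
  rw [← inner_schurMap]
  have := congrArg (fun T => T v') (intertwiningMap_eq_zero h (schurInt l l' w w'))
  have h2 : schurMap l l' w w' v' = 0 := this
  rw [h2, inner_zero_right]

theorem continuous_matCoeff_mul (l l' : ℕ) (w : Module.Dual ℂ (V (2 * l))) (v : V (2 * l))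
    (w' : Module.Dual ℂ (V (2 * l'))) (v' : V (2 * l')) :
    Continuous fun x : K => w' (tau l' x v') * star (w (tau l x v)) :=
  (continuous_tau l' w' v').mul (continuous_tau l w v).star

/-- By Schur's lemma the form in `(v, v')` is a multiple `c` of the inner product; taking its trace
over the weighted basis determines `c`. -/
theorem inner_Phi_self (l : ℕ) (w w' : Module.Dual ℂ (V (2 * l))) (v v' : V (2 * l)) :
    inner ℂ (Phi l (w ⊗ₜ v)) (Phi l (w' ⊗ₜ v')) =
      (2 * l + 1 : ℂ)⁻¹ * (inner ℂ w w' * inner ℂ v v') := by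
  obtain ⟨c, hc⟩ := intertwiningMap_eq_smul l (schurInt l l w w')
  have hB : ∀ v v' : V (2 * l), inner ℂ (Phi l (w ⊗ₜ v)) (Phi l (w' ⊗ₜ v')) = c * inner ℂ v v' := by
    intro v v'
    rw [← inner_schurMap, ← inner_smul_right, ← hc v']
    rfl
  -- Under the integral the trace becomes `⟨w ∘ τ(x), w' ∘ τ(x)⟩`, which does not depend on `x`
  -- because the dual inner product is invariant, and the measure has total mass one.
  have hsum : ∑ k : Fin (2 * l + 1), ((2 * l).choose k : ℂ) *
      inner ℂ (Phi l (w ⊗ₜ stdVec (2 * l) k)) (Phi l (w' ⊗ₜ stdVec (2 * l) k)) = inner ℂ w w' := by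
    simp only [inner_Phi, ← integral_const_mul]
    rw [← integral_finsetSum]
    · have : ∀ x : K, ∑ k : Fin (2 * l + 1), ((2 * l).choose k : ℂ) *
          (w' (tau l x (stdVec (2 * l) k)) * star (w (tau l x (stdVec (2 * l) k)))) =
          inner ℂ w w' := by
        intro x
        rw [← inner_comp_tau l x, dual_inner_def]
        refine Finset.sum_congr rfl fun k _ => ?_
        simp [mul_comm]
      simp only [this]
      simp
    · intro k _
      exact ((continuous_matCoeff_mul l l w _ w' _).const_mul _).integrable_of_hasCompactSupport
        (HasCompactSupport.of_compactSpace _)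
  have hc' : (2 * l + 1 : ℂ) * c = inner ℂ w w' := by
    rw [← hsum]
    have : ∀ k : Fin (2 * l + 1), ((2 * l).choose k : ℂ) *
        inner ℂ (Phi l (w ⊗ₜ stdVec (2 * l) k)) (Phi l (w' ⊗ₜ stdVec (2 * l) k)) = c := by
      intro k
      have := choose_ne_zero_fin (2 * l) k
      rw [hB, inner_stdVec, dualVec_stdVec]
      simp
      field_simp
    simp only [this]
    simp
  have hl : (2 * l + 1 : ℂ) ≠ 0 := by exact_mod_cast Nat.succ_ne_zero (2 * l)
  rw [hB, ← hc']
  field_simp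

theorem inner_Phi_Phi (l : ℕ) (s t : Module.Dual ℂ (V (2 * l)) ⊗[ℂ] V (2 * l)) :
    inner ℂ (Phi l s) (Phi l t) = (2 * l + 1 : ℂ)⁻¹ * inner ℂ s t := by
  induction s using TensorProduct.induction_on with
  | zero => simp
  | add a b ha hb => rw [map_add, inner_add_left, inner_add_left, ha, hb, mul_add]
  | tmul w v =>
    induction t using TensorProduct.induction_on with
    | zero => simp
    | add a b ha hb => rw [map_add, inner_add_right, inner_add_right, ha, hb, mul_add]
    | tmul w' v' => rw [inner_Phi_self, TensorProduct.inner_tmul]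

theorem inner_Phi_Phi_of_ne {l l' : ℕ} (h : l ≠ l')
    (s : Module.Dual ℂ (V (2 * l)) ⊗[ℂ] V (2 * l))
    (t : Module.Dual ℂ (V (2 * l')) ⊗[ℂ] V (2 * l')) :
    inner ℂ (Phi l s) (Phi l' t) = 0 := by
  induction s using TensorProduct.induction_on with
  | zero => simp
  | add a b ha hb => rw [map_add, inner_add_left, ha, hb, add_zero]
  | tmul w v =>
    induction t using TensorProduct.induction_on with
    | zero => simp
    | add a b ha hb => rw [map_add, inner_add_right, ha, hb, add_zero]
    | tmul w' v' => exact inner_Phi_of_ne h w v w' v'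

/-! ### Polynomial functions on `SU(2)` -/

/-- The matrix entries of an element of `SU(2)`. -/
def coordSU (i : Fin 4) (x : SU2) : ℂ := ![x.1 0 0, x.1 0 1, x.1 1 0, x.1 1 1] i

/-- The restrictions to `SU(2)` of the homogeneous polynomials of degree `n` in the matrix
entries. -/
noncomputable def polySU (n : ℕ) : Submodule ℂ (SU2 → ℂ) :=
  Submodule.span ℂ (Set.range fun (s : Sym (Fin 4) n) (x : SU2) =>
    (s.1.map fun i => coordSU i x).prod)

/-- Counting monomials in four variables gives only an upper bound, as the entries satisfy the
relation `det = 1`; the upper bound is what the dimension count needs. -/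
theorem finrank_polySU_le (n : ℕ) : Module.finrank ℂ (polySU n) ≤ Nat.multichoose 4 n := by
  refine (finrank_range_le_card _).trans ?_
  rw [Sym.card_sym_eq_multichoose, Fintype.card_fin]

instance (n : ℕ) : FiniteDimensional ℂ (polySU n) :=
  FiniteDimensional.span_of_finite ℂ (Set.finite_range _)

theorem coordSU_mem (i : Fin 4) : coordSU i ∈ polySU 1 := by
  refine Submodule.subset_span ⟨⟨{i}, by simp⟩, ?_⟩
  ext x
  simp

theorem mul_mem_polySU {m n : ℕ} {f g : SU2 → ℂ} (hf : f ∈ polySU m) (hg : g ∈ polySU n) :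
    f * g ∈ polySU (m + n) := by
  have h := Submodule.mul_mem_mul hf hg
  rw [polySU, polySU, Submodule.span_mul_span] at h
  refine Submodule.span_mono ?_ h
  rintro _ ⟨_, ⟨s, rfl⟩, _, ⟨t, rfl⟩, rfl⟩
  refine ⟨⟨s.1 + t.1, by simp⟩, ?_⟩
  ext x
  simp

theorem one_mem_polySU_zero : (1 : SU2 → ℂ) ∈ polySU 0 :=
  Submodule.subset_span ⟨⟨0, rfl⟩, by ext x; simp⟩

theorem pow_mem_polySU {f : SU2 → ℂ} (hf : f ∈ polySU 1) (n : ℕ) : f ^ n ∈ polySU n := by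
  induction n with
  | zero => simpa using one_mem_polySU_zero
  | succ n ih => rw [pow_succ]; exact mul_mem_polySU ih hf

/-- The constant `1` is the determinant, a quadratic form in the entries. Multiplying by it raises
the degree by two, so the even degrees form an increasing chain. -/
theorem one_mem_polySU_two : (1 : SU2 → ℂ) ∈ polySU 2 := by
  have h : (1 : SU2 → ℂ) = coordSU 0 * coordSU 3 - coordSU 1 * coordSU 2 := by
    ext x
    have := (Matrix.mem_specialUnitaryGroup_iff.1 x.2).2
    rw [Matrix.det_fin_two] at this
    simpa [coordSU] using this.symm
  rw [h]
  have hm : ∀ i j, coordSU i * coordSU j ∈ polySU 2 := fun i j =>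
    mul_mem_polySU (m := 1) (n := 1) (coordSU_mem i) (coordSU_mem j)
  exact (polySU 2).sub_mem (hm 0 3) (hm 1 2)

theorem polySU_mono {m n : ℕ} (h : m ≤ n) : polySU (2 * m) ≤ polySU (2 * n) := by
  induction n, h using Nat.le_induction with
  | base => exact le_rfl
  | succ n _ ih =>
    refine ih.trans fun f hf => ?_
    have h2 := mul_mem_polySU hf one_mem_polySU_two
    rwa [mul_one] at h2

theorem SU2.inv_entries (x : SU2) :
    (x⁻¹ : SU2).1 = !![coordSU 3 x, -coordSU 1 x; -coordSU 2 x, coordSU 0 x] := by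
  obtain ⟨h11, h10, -⟩ := SU2.entries x
  rw [← Matrix.star_eq_inv, Matrix.specialUnitaryGroup.coe_star]
  ext i j
  fin_cases i <;> fin_cases j <;> simp [coordSU, h11, h10]

/-- For a power of a linear form, `τ_n(x)` acts on the linear form, whose new coefficients are
linear in the entries of `x`; such powers span `V_n`. -/
theorem matCoeff_mem_polySU (n : ℕ) (w : Module.Dual ℂ (V n)) (v : V n) :
    (fun x : SU2 => w (tauSU n x v)) ∈ polySU n := by
  have hv : v ∈ Submodule.span ℂ (Set.range (powVec n)) := span_powVec n ▸ trivial
  induction hv using Submodule.span_induction with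
  | zero =>
    convert (polySU n).zero_mem using 2
    simp
  | add a b _ _ ha hb =>
    convert (polySU n).add_mem ha hb using 2
    simp
  | smul c a _ ha =>
    convert (polySU n).smul_mem c ha using 2
    simp
  | mem v hv =>
    obtain ⟨u, rfl⟩ := hv
    have h : (fun x : SU2 => w (tauSU n x (powVec n u))) = ∑ k : Fin (n + 1),
        ((n.choose k : ℂ) * w (stdVec n k)) •
          ((u 0 • coordSU 3 - u 1 • coordSU 2) ^ (k : ℕ) *
            (-u 0 • coordSU 1 + u 1 • coordSU 0) ^ (n - k : ℕ)) := by
      ext x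
      rw [tauSU_powVec, V_sum (powVec n _), map_sum, Finset.sum_apply]
      refine Finset.sum_congr rfl fun k _ => ?_
      rw [map_smul, dualVec_powVec, SU2.inv_entries]
      simp [Matrix.mulVec, dotProduct]
      ring
    rw [h]
    refine Submodule.sum_mem _ fun k _ => Submodule.smul_mem _ _ ?_
    have hk : (k : ℕ) + (n - k) = n := Nat.add_sub_of_le (Nat.lt_succ_iff.1 k.2)
    have hm := mul_mem_polySU
      (pow_mem_polySU (sub_mem ((polySU 1).smul_mem (u 0) (coordSU_mem 3))
        ((polySU 1).smul_mem (u 1) (coordSU_mem 2))) k)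
      (pow_mem_polySU (add_mem ((polySU 1).smul_mem (-u 0) (coordSU_mem 1))
        ((polySU 1).smul_mem (u 1) (coordSU_mem 0))) (n - k))
    rwa [hk] at hm

/-- Both sides equal `C(2l+3, 3)`. The left side counts the matrix coefficients of `τ_0, …, τ_{2l}`,
the right side the monomials of degree `2l` in four variables. -/
theorem sum_odd_sq (l : ℕ) :
    ∑ j ∈ Finset.range (l + 1), (2 * j + 1) * (2 * j + 1) = Nat.multichoose 4 (2 * l) := by
  have h : 6 * ∑ j ∈ Finset.range (l + 1), (2 * j + 1) * (2 * j + 1) =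
      (2 * l + 3) * (2 * l + 2) * (2 * l + 1) := by
    induction l with
    | zero => simp
    | succ l ih => rw [Finset.sum_range_succ, mul_add, ih]; ring
  have h2 : (2 * l + 3) * (2 * l + 2) * (2 * l + 1) = 6 * Nat.choose (2 * l + 3) 3 := by
    have := Nat.descFactorial_eq_factorial_mul_choose (2 * l + 3) 3
    simp [Nat.descFactorial, Nat.factorial] at this
    rw [← this]
    ring
  rw [Nat.multichoose_eq, show 4 + 2 * l - 1 = 2 * l + 3 by omega,
    ← Nat.choose_symm_add (a := 2 * l) (b := 3)] at *
  omega

/-! ### Matrix coefficients and the theorem of Peter and Weyl for `SO(3)` -/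

/-- The space of the matrix coefficients of the representations `τ_{2l}`. -/
noncomputable def matSpan : Submodule ℂ C(K, ℂ) :=
  Submodule.span ℂ {f | ∃ l w v, f = matCoeff l w v}

/-- The pullback of functions from `SO(3)` to `SU(2)`. -/
noncomputable def pullSU : C(K, ℂ) →ₗ[ℂ] (SU2 → ℂ) where
  toFun f x := f (spinCover x)
  map_add' _ _ := rfl
  map_smul' _ _ := rfl

theorem pullSU_injective : Function.Injective pullSU := by
  intro f g h
  ext k
  obtain ⟨x, rfl⟩ := spinCover_surjective k
  exact congrFun h x

theorem pullSU_matCoeff_mem (l : ℕ) (w : Module.Dual ℂ (V (2 * l))) (v : V (2 * l)) :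
    pullSU (matCoeff l w v) ∈ polySU (2 * l) := by
  convert matCoeff_mem_polySU (2 * l) w v using 2
  rename_i x
  change w (tau l (spinCover x) v) = _
  rw [tau_spinCover]

theorem inner_dualVec (n : ℕ) (j k : Fin (n + 1)) :
    inner ℂ (dualVec n j) (dualVec n k) = if j = k then (n.choose k : ℂ) else 0 := by
  rw [dual_inner_def, Finset.sum_eq_single k]
  · simp only [dualVec_stdVec]
    by_cases h : j = k <;> simp [h]
  · intro i _ hi
    simp [dualVec_stdVec, hi.symm]
  · simp

/-- By Schur orthogonality their classes in `L²(K)` are nonzero and pairwise orthogonal. -/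
theorem linearIndependent_matCoeff (l : ℕ) : LinearIndependent ℂ
    fun i : (j : Fin (l + 1)) × (Fin (2 * (j : ℕ) + 1) × Fin (2 * (j : ℕ) + 1)) =>
      matCoeff i.1 (dualVec (2 * i.1) i.2.1) (stdVec (2 * i.1) i.2.2) := by
  refine LinearIndependent.of_comp (ContinuousMap.toLp 2 haarK ℂ).toLinearMap ?_
  refine linearIndependent_of_ne_zero_of_inner_eq_zero ?_ ?_
  · rintro ⟨j, p, q⟩ h
    have h2 : Phi j (dualVec (2 * j) p ⊗ₜ stdVec (2 * j) q) = 0 := h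
    have h3 := inner_Phi_self j (dualVec (2 * j) p) (dualVec (2 * j) p) (stdVec (2 * j) q)
      (stdVec (2 * j) q)
    rw [h2, inner_zero_left, inner_dualVec, inner_stdVec, dualVec_stdVec] at h3
    have h4 : (2 * (j : ℕ) + 1 : ℂ) ≠ 0 := by exact_mod_cast Nat.succ_ne_zero (2 * (j : ℕ))
    simp only [if_true, mul_one] at h3
    exact mul_ne_zero (inv_ne_zero h4) (mul_ne_zero (choose_ne_zero_fin _ p)
      (inv_ne_zero (choose_ne_zero_fin _ q))) h3.symm
  · rintro ⟨j, p, q⟩ ⟨j', p', q'⟩ hne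
    change inner ℂ (Phi j (dualVec (2 * j) p ⊗ₜ stdVec (2 * j) q))
      (Phi j' (dualVec (2 * j') p' ⊗ₜ stdVec (2 * j') q')) = 0
    by_cases hj : j = j'
    · subst hj
      rw [inner_Phi_self, inner_dualVec, inner_stdVec, dualVec_stdVec]
      by_cases hp : p = p'
      · by_cases hq : q = q'
        · subst hp; subst hq; exact absurd rfl hne
        · simp [hq]
      · simp [hp]
    · exact inner_Phi_of_ne (fun h => hj (Fin.ext h)) _ _ _ _

/-- The pulled back matrix coefficients with `j ≤ l` are independent elements of `polySU (2 * l)`,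
and they are as many as its dimension can be, so they span it. Injectivity of the pullback then
brings the expansion of `f` down to `K`. -/
theorem mem_matSpan_of_pullSU {l : ℕ} {f : C(K, ℂ)} (hf : pullSU f ∈ polySU (2 * l)) :
    f ∈ matSpan := by
  set b := fun i : (j : Fin (l + 1)) × (Fin (2 * (j : ℕ) + 1) × Fin (2 * (j : ℕ) + 1)) =>
      matCoeff i.1 (dualVec (2 * i.1) i.2.1) (stdVec (2 * i.1) i.2.2) with hb
  have hli : LinearIndependent ℂ (pullSU ∘ b) :=
    (linearIndependent_matCoeff l).map' pullSU (LinearMap.ker_eq_bot.2 pullSU_injective)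
  have hle : Submodule.span ℂ (Set.range (pullSU ∘ b)) ≤ polySU (2 * l) := by
    rw [Submodule.span_le]
    rintro _ ⟨i, rfl⟩
    exact polySU_mono (Nat.lt_succ_iff.1 i.1.2) (pullSU_matCoeff_mem _ _ _)
  have heq := Submodule.eq_of_le_of_finrank_le hle (by
    rw [finrank_span_eq_card hli]
    refine (finrank_polySU_le _).trans (le_of_eq ?_)
    rw [← sum_odd_sq, Fintype.card_sigma]
    simp only [Fintype.card_prod, Fintype.card_fin]
    exact (Fin.sum_univ_eq_sum_range (fun j => (2 * j + 1) * (2 * j + 1)) (l + 1)).symm)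
  rw [← heq, Set.range_comp, ← Submodule.map_span] at hf
  obtain ⟨g, hg, hgf⟩ := hf
  rw [← pullSU_injective hgf]
  refine Submodule.span_mono ?_ hg
  rintro _ ⟨i, rfl⟩
  exact ⟨_, _, _, rfl⟩

/-- The matrix entries of an element of `SO(3)`. -/
noncomputable def entryK (i j : Fin 3) : C(K, ℂ) :=
  ⟨fun k : K => ((k.1.1 i j : ℝ) : ℂ), by
    have h : Continuous fun k : K => k.1.1 :=
      continuous_subtype_val.comp continuous_subtype_val
    exact Complex.continuous_ofReal.comp (h.matrix_elem i j)⟩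

theorem star_mem_adjoin_entryK {f : C(K, ℂ)} (hf : f ∈ Algebra.adjoin ℂ {f | ∃ i j, f = entryK i j}) :
    star f ∈ Algebra.adjoin ℂ {f | ∃ i j, f = entryK i j} := by
  induction hf using Algebra.adjoin_induction with
  | mem f hf =>
    obtain ⟨i, j, rfl⟩ := hf
    have : star (entryK i j) = entryK i j := by
      ext k
      exact Complex.conj_ofReal _
    rw [this]
    exact Algebra.subset_adjoin ⟨i, j, rfl⟩
  | algebraMap c =>
    rw [← algebraMap_star_comm]
    exact Subalgebra.algebraMap_mem _ _
  | add f g _ _ hf hg => rw [star_add]; exact add_mem hf hg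
  | mul f g _ _ hf hg => rw [star_mul]; exact mul_mem hg hf

/-- The algebra of the polynomial functions on `SO(3)`. -/
noncomputable def polyK : StarSubalgebra ℂ C(K, ℂ) where
  toSubalgebra := Algebra.adjoin ℂ {f | ∃ i j, f = entryK i j}
  star_mem' hf := star_mem_adjoin_entryK hf

theorem entryK_mem (i j : Fin 3) : entryK i j ∈ polyK := Algebra.subset_adjoin ⟨i, j, rfl⟩

/-- Stone-Weierstrass applies, because the matrix entries separate the points of `K`. -/
theorem polyK_topologicalClosure : polyK.topologicalClosure = ⊤ := by
  refine ContinuousMap.starSubalgebra_topologicalClosure_eq_top_of_separatesPoints _ ?_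
  intro x y hxy
  obtain ⟨i, j, hij⟩ : ∃ i j, x.1.1 i j ≠ y.1.1 i j := by
    by_contra! h
    exact hxy (Subtype.ext (Subtype.ext (Matrix.ext h)))
  exact ⟨entryK i j, ⟨entryK i j, entryK_mem i j, rfl⟩, fun h => hij (Complex.ofReal_injective h)⟩

/-- The entries of a rotation are quadratic forms in the quaternion coordinates, and these are
linear in the entries of the matrix in `SU(2)`. -/
theorem pullSU_entryK_mem (i j : Fin 3) : pullSU (entryK i j) ∈ polySU 2 := by
  let p : SU2 → ℂ := fun x => ((x.1 0 0).re : ℂ)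
  let q : SU2 → ℂ := fun x => ((x.1 0 0).im : ℂ)
  let r : SU2 → ℂ := fun x => ((x.1 0 1).re : ℂ)
  let s : SU2 → ℂ := fun x => ((x.1 0 1).im : ℂ)
  have hp : p ∈ polySU 1 := by
    have : p = (1 / 2 : ℂ) • (coordSU 0 + coordSU 3) := by
      ext x
      simp [p, coordSU, (SU2.entries x).1, Complex.add_conj]
    rw [this]
    exact Submodule.smul_mem _ _ (add_mem (coordSU_mem 0) (coordSU_mem 3))
  have hq : q ∈ polySU 1 := by
    have : q = (1 / (2 * Complex.I) : ℂ) • (coordSU 0 - coordSU 3) := by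
      ext x
      simp [q, coordSU, (SU2.entries x).1, Complex.sub_conj]
      field_simp
      simp
    rw [this]
    exact Submodule.smul_mem _ _ (sub_mem (coordSU_mem 0) (coordSU_mem 3))
  have hr : r ∈ polySU 1 := by
    have : r = (1 / 2 : ℂ) • (coordSU 1 - coordSU 2) := by
      ext x
      simp [r, coordSU, (SU2.entries x).2.1, Complex.add_conj]
    rw [this]
    exact Submodule.smul_mem _ _ (sub_mem (coordSU_mem 1) (coordSU_mem 2))
  have hs : s ∈ polySU 1 := by
    have : s = (1 / (2 * Complex.I) : ℂ) • (coordSU 1 + coordSU 2) := by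
      ext x
      simp [s, coordSU, (SU2.entries x).2.1, ← sub_eq_add_neg, Complex.sub_conj]
      field_simp
      simp
    rw [this]
    exact Submodule.smul_mem _ _ (add_mem (coordSU_mem 1) (coordSU_mem 2))
  have hm : ∀ {f g}, f ∈ polySU 1 → g ∈ polySU 1 → f * g ∈ polySU 2 := mul_mem_polySU
  have key : ∀ c : Fin 10 → ℂ, c 0 • (p * p) + c 1 • (q * q) + c 2 • (r * r) + c 3 • (s * s) +
      c 4 • (p * q) + c 5 • (p * r) + c 6 • (p * s) + c 7 • (q * r) + c 8 • (q * s) +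
      c 9 • (r * s) ∈ polySU 2 := by
    intro c
    refine add_mem (add_mem (add_mem (add_mem (add_mem (add_mem (add_mem (add_mem (add_mem
      ?_ ?_) ?_) ?_) ?_) ?_) ?_) ?_) ?_) ?_ <;> refine Submodule.smul_mem _ _ (hm ?_ ?_) <;>
      assumption
  have hc : ∃ c : Fin 10 → ℂ, pullSU (entryK i j) = c 0 • (p * p) + c 1 • (q * q) +
      c 2 • (r * r) + c 3 • (s * s) + c 4 • (p * q) + c 5 • (p * r) + c 6 • (p * s) +
      c 7 • (q * r) + c 8 • (q * s) + c 9 • (r * s) := by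
    -- The coefficients are read off from `rotMatrix`, in the order `p², q², r², s², pq, pr, ps, qr,
    -- qs, rs`.
    refine ⟨![![![1, 1, -1, -1, 0, 0, 0, 0, 0, 0], ![0, 0, 0, 0, 0, 0, -2, 2, 0, 0],
        ![0, 0, 0, 0, 0, 2, 0, 0, 2, 0]],
      ![![0, 0, 0, 0, 0, 0, 2, 2, 0, 0], ![1, -1, 1, -1, 0, 0, 0, 0, 0, 0],
        ![0, 0, 0, 0, -2, 0, 0, 0, 0, 2]],
      ![![0, 0, 0, 0, 0, -2, 0, 0, 2, 0], ![0, 0, 0, 0, 2, 0, 0, 0, 0, 2],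
        ![1, -1, -1, 1, 0, 0, 0, 0, 0, 0]]] i j, ?_⟩
    ext x
    change (((spinCover x).1.1 i j : ℝ) : ℂ) = _
    rw [spinCover_coe]
    fin_cases i <;> fin_cases j <;> simp [rotMatrix, p, q, r, s] <;> ring
  obtain ⟨c, hc⟩ := hc
  rw [hc]
  exact key c

/-- Every polynomial function on `K` pulls back to a single even degree: sums are lifted to the
larger of the two degrees, and in products the degrees add. -/
theorem polyK_le_matSpan {f : C(K, ℂ)} (hf : f ∈ polyK) : f ∈ matSpan := by
  suffices h : ∃ l, pullSU f ∈ polySU (2 * l) by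
    obtain ⟨l, hl⟩ := h
    exact mem_matSpan_of_pullSU hl
  change f ∈ Algebra.adjoin ℂ _ at hf
  induction hf using Algebra.adjoin_induction with
  | mem f hf =>
    obtain ⟨i, j, rfl⟩ := hf
    exact ⟨1, pullSU_entryK_mem i j⟩
  | algebraMap c =>
    refine ⟨0, ?_⟩
    have : pullSU (algebraMap ℂ C(K, ℂ) c) = c • 1 := by
      ext x
      simp [pullSU]
    rw [this]
    exact Submodule.smul_mem _ _ one_mem_polySU_zero
  | add f g _ _ hf hg =>
    obtain ⟨m, hm⟩ := hf
    obtain ⟨n, hn⟩ := hg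
    refine ⟨max m n, ?_⟩
    rw [map_add]
    exact add_mem (polySU_mono (le_max_left _ _) hm) (polySU_mono (le_max_right _ _) hn)
  | mul f g _ _ hf hg =>
    obtain ⟨m, hm⟩ := hf
    obtain ⟨n, hn⟩ := hg
    refine ⟨m + n, ?_⟩
    rw [mul_add]
    exact mul_mem_polySU hm hn

/-- Polynomial functions are uniformly dense in `C(K)`, and `C(K)` is dense in `L²(K)`. -/
theorem L2K_eq_zero_of_polyK {g : L2K}
    (h : ∀ f ∈ polyK, inner ℂ (ContinuousMap.toLp 2 haarK ℂ f) g = 0) : g = 0 := by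
  have h1 : ∀ f : C(K, ℂ), inner ℂ (ContinuousMap.toLp 2 haarK ℂ f) g = 0 := by
    intro f
    have hf : f ∈ closure (polyK : Set C(K, ℂ)) := by
      rw [← StarSubalgebra.topologicalClosure_coe, polyK_topologicalClosure]
      trivial
    have hcl : IsClosed {f : C(K, ℂ) | inner ℂ (ContinuousMap.toLp 2 haarK ℂ f) g = 0} :=
      isClosed_eq ((ContinuousMap.toLp 2 haarK ℂ).continuous.inner continuous_const)
        continuous_const
    exact closure_minimal h hcl hf
  have hd : DenseRange (ContinuousMap.toLp (E := ℂ) 2 haarK ℂ) :=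
    ContinuousMap.toLp_denseRange ℂ haarK ℂ (by simp)
  have h2 : ∀ f : L2K, inner ℂ f g = 0 := fun f =>
    hd.induction_on (p := fun f => inner ℂ f g = 0) f
      (isClosed_eq (continuous_id.inner continuous_const) continuous_const) h1
  exact inner_self_eq_zero.1 (h2 g)

/-! ### The Iwasawa decomposition and smooth extensions -/

/-- The cross product of the second and the third row of a matrix. -/
def crossRow (A : Fin 3 → Fin 3 → ℝ) : Fin 3 → ℝ :=
  ![A 1 1 * A 2 2 - A 1 2 * A 2 1, A 1 2 * A 2 0 - A 1 0 * A 2 2, A 1 0 * A 2 1 - A 1 1 * A 2 0]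

/-- The square of the norm of the third row of a matrix. -/
def rowSq (A : Fin 3 → Fin 3 → ℝ) : ℝ := A 2 0 ^ 2 + A 2 1 ^ 2 + A 2 2 ^ 2

/-- The square of the norm of `crossRow`. -/
def crossSq (A : Fin 3 → Fin 3 → ℝ) : ℝ := crossRow A 0 ^ 2 + crossRow A 1 ^ 2 + crossRow A 2 ^ 2

/-- The component in `SO(3)` of the Iwasawa decomposition. -/
noncomputable def iwasawaK (A : Fin 3 → Fin 3 → ℝ) : Fin 3 → Fin 3 → ℝ :=
  -- Left multiplication by `N₀` changes neither the third row nor the cross product of the second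
  -- and third rows, and `A₀` rescales both by positive factors. Normalized, they are the third and
  -- first rows of the orthogonal part, whose middle row is then their cross product.
  let u : Fin 3 → ℝ := fun j => A 2 j / √(rowSq A)
  let v : Fin 3 → ℝ := fun j => crossRow A j / √(crossSq A)
  ![v, ![u 1 * v 2 - u 2 * v 1, u 2 * v 0 - u 0 * v 2, u 0 * v 1 - u 1 * v 0], u]

/-- The character `e^μ` of the component in `A₀` of the Iwasawa decomposition. -/
noncomputable def iwasawaChar (μ : LieA0 →ₗ[ℝ] ℂ) (A : Fin 3 → Fin 3 → ℝ) : ℂ :=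
  -- For `g = n a k` one has `rowSq = a₃²` and `crossSq = (a₂ a₃)² = a₁⁻²`; solving for `log a₁` and
  -- `log a₂` gives the two exponents.
  Complex.exp (μ H1 * ((-(Real.log (crossSq A)) / 2 : ℝ) : ℂ) +
    μ H2 * (((Real.log (crossSq A) - Real.log (rowSq A)) / 2 : ℝ) : ℂ))

/-- This is the cofactor expansion along the first row; with determinant one, neither the cross
product nor the third row can vanish. -/
theorem det_eq_crossRow (A : Matrix (Fin 3) (Fin 3) ℝ) :
    A.det = A 0 0 * crossRow A 0 + A 0 1 * crossRow A 1 + A 0 2 * crossRow A 2 := by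
  rw [Matrix.det_fin_three]
  simp [crossRow]
  ring

theorem crossSq_pos (g : G) : 0 < crossSq g.1 := by
  have hd := g.2
  rw [det_eq_crossRow] at hd
  by_contra h
  have h0 := sq_nonneg (crossRow g.1 0)
  have h1 := sq_nonneg (crossRow g.1 1)
  have h2 := sq_nonneg (crossRow g.1 2)
  unfold crossSq at h
  have e0 : crossRow g.1 0 = 0 := pow_eq_zero_iff two_ne_zero |>.1 (by linarith)
  have e1 : crossRow g.1 1 = 0 := pow_eq_zero_iff two_ne_zero |>.1 (by linarith)
  have e2 : crossRow g.1 2 = 0 := pow_eq_zero_iff two_ne_zero |>.1 (by linarith)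
  simp [e0, e1, e2] at hd

theorem rowSq_pos (g : G) : 0 < rowSq g.1 := by
  have hd := g.2
  rw [det_eq_crossRow] at hd
  by_contra h
  have h0 := sq_nonneg (g.1 2 0)
  have h1 := sq_nonneg (g.1 2 1)
  have h2 := sq_nonneg (g.1 2 2)
  unfold rowSq at h
  have e0 : g.1 2 0 = 0 := pow_eq_zero_iff two_ne_zero |>.1 (by linarith)
  have e1 : g.1 2 1 = 0 := pow_eq_zero_iff two_ne_zero |>.1 (by linarith)
  have e2 : g.1 2 2 = 0 := pow_eq_zero_iff two_ne_zero |>.1 (by linarith)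
  simp [crossRow, e0, e1, e2] at hd

theorem frame_mem_K {u v : Fin 3 → ℝ} (hu : u 0 ^ 2 + u 1 ^ 2 + u 2 ^ 2 = 1)
    (hv : v 0 ^ 2 + v 1 ^ 2 + v 2 ^ 2 = 1) (huv : u 0 * v 0 + u 1 * v 1 + u 2 * v 2 = 0) :
    (Matrix.of ![v, ![u 1 * v 2 - u 2 * v 1, u 2 * v 0 - u 0 * v 2, u 0 * v 1 - u 1 * v 0],
      u]).det = 1 ∧
    Matrix.of ![v, ![u 1 * v 2 - u 2 * v 1, u 2 * v 0 - u 0 * v 2, u 0 * v 1 - u 1 * v 0], u] *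
      (Matrix.of ![v, ![u 1 * v 2 - u 2 * v 1, u 2 * v 0 - u 0 * v 2, u 0 * v 1 - u 1 * v 0],
        u]).transpose = 1 := by
  -- Lagrange's identity `|u × v|² = |u|² |v|² - (u · v)²`; the determinant of the frame is this
  -- same quantity.
  have hc : (u 1 * v 2 - u 2 * v 1) ^ 2 + (u 2 * v 0 - u 0 * v 2) ^ 2 +
      (u 0 * v 1 - u 1 * v 0) ^ 2 = 1 := by
    linear_combination (v 0 ^ 2 + v 1 ^ 2 + v 2 ^ 2) * hu + hv -
      (u 0 * v 0 + u 1 * v 1 + u 2 * v 2) * huv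
  constructor
  · rw [Matrix.det_fin_three]
    simp
    linear_combination hc
  · ext i j
    fin_cases i <;> fin_cases j <;> simp [Matrix.mul_apply, Fin.sum_univ_three] <;>
      first | ring1 | linear_combination hu | linear_combination hv | linear_combination hc |
        linear_combination huv

theorem iwasawaK_mem (g : G) : (Matrix.of (iwasawaK g.1)).det = 1 ∧
    Matrix.of (iwasawaK g.1) * (Matrix.of (iwasawaK g.1)).transpose = 1 := by
  have hr := Real.sq_sqrt (rowSq_pos g).le
  have hc := Real.sq_sqrt (crossSq_pos g).le
  refine frame_mem_K (u := fun j => g.1 2 j / √(rowSq g.1))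
    (v := fun j => crossRow g.1 j / √(crossSq g.1)) ?_ ?_ ?_
  · simp only [div_pow, hr, ← add_div]
    exact div_self (rowSq_pos g).ne'
  · simp only [div_pow, hc, ← add_div]
    exact div_self (crossSq_pos g).ne'
  · simp only [div_mul_div_comm, ← add_div]
    rw [div_eq_zero_iff]
    left
    simp [crossRow]
    ring

/-- The component in `SO(3)` of the Iwasawa decomposition of `g`. -/
noncomputable def kappa (g : G) : K :=
  ⟨⟨Matrix.of (iwasawaK g.1), (iwasawaK_mem g).1⟩, (iwasawaK_mem g).2⟩

/-- For a matrix in `SO(3)` the adjugate is the transpose, so each row is a cross product of the two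
others. Hence the Iwasawa decomposition of `k` is trivial: `κ(k) = k` and `a = 1`. -/
theorem K.rows (k : K) : (∀ j, crossRow k.1.1 j = k.1.1 0 j) ∧ rowSq k.1.1 = 1 ∧
    crossSq k.1.1 = 1 ∧ k.1.1 2 1 * k.1.1 0 2 - k.1.1 2 2 * k.1.1 0 1 = k.1.1 1 0 ∧
    k.1.1 2 2 * k.1.1 0 0 - k.1.1 2 0 * k.1.1 0 2 = k.1.1 1 1 ∧
    k.1.1 2 0 * k.1.1 0 1 - k.1.1 2 1 * k.1.1 0 0 = k.1.1 1 2 := by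
  have hk1 : k.1.1 * k.1.1.transpose = 1 := k.2
  have hadj : k.1.1.adjugate = k.1.1.transpose := by
    calc k.1.1.adjugate = k.1.1.adjugate * (k.1.1 * k.1.1.transpose) := by rw [hk1, Matrix.mul_one]
      _ = k.1.1.transpose := by rw [← Matrix.mul_assoc, Matrix.adjugate_mul, k.1.2]; simp
  have e1 := fun i j => congrFun (congrFun hk1 i) j
  have e3 := fun i j => congrFun (congrFun hadj i) j
  simp only [Matrix.mul_apply, Matrix.transpose_apply, Fin.sum_univ_three,
    Matrix.one_apply, Matrix.adjugate_fin_three] at e1 e3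
  have hx : ∀ j, crossRow k.1.1 j = k.1.1 0 j := by
    intro j
    have := e3 j 0
    fin_cases j <;> simp [crossRow] at this ⊢ <;> linarith
  refine ⟨hx, ?_, ?_, ?_, ?_, ?_⟩
  · have := e1 2 2
    simp at this
    unfold rowSq
    linarith
  · have := e1 0 0
    simp at this
    simp only [crossSq, hx]
    linarith
  · have := e3 0 1
    simp at this
    linarith
  · have := e3 1 1
    simp at this
    linarith
  · have := e3 2 1
    simp at this
    linarith

theorem kappa_coe (k : K) : kappa k = k := by
  obtain ⟨hx, hr, hc, h0, h1, h2⟩ := K.rows k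
  apply Subtype.ext
  apply Subtype.ext
  change Matrix.of (iwasawaK k.1.1) = k.1.1
  ext i j
  fin_cases i <;> fin_cases j <;> simp [iwasawaK, hx, hr, hc, h0, h1, h2]

theorem iwasawaChar_coe (μ : LieA0 →ₗ[ℝ] ℂ) (k : K) : iwasawaChar μ k.1.1 = 1 := by
  obtain ⟨hx, hr, hc, h0, h1, h2⟩ := K.rows k
  simp [iwasawaChar, hr, hc]

theorem expChar_eq (μ : LieA0 →ₗ[ℝ] ℂ) {a : G} (ha : a ∈ A0) : expChar μ a =
    Complex.exp (μ H1 * (Real.log (a.1 0 0) : ℝ) + μ H2 * (Real.log (a.1 1 1) : ℝ)) := by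
  have h0 := ha.2 0
  have h1 := ha.2 1
  rw [expChar, Complex.cpow_def_of_ne_zero (by exact_mod_cast h0.ne'),
    Complex.cpow_def_of_ne_zero (by exact_mod_cast h1.ne'), ← Complex.exp_add,
    Complex.ofReal_log h0.le, Complex.ofReal_log h1.le]
  congr 1
  ring

theorem M0.diag (m : M0) : ∃ e : ℤˣ × ℤˣ, m.1.1 =
    Matrix.diagonal ![((e.1 : ℤ) : ℝ), ((e.2 : ℤ) : ℝ), ((e.1 * e.2 : ℤ) : ℝ)] := by
  obtain ⟨_, e, rfl⟩ := m
  exact ⟨e, rfl⟩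

/-- The rows of `n a m x` that determine its Iwasawa decomposition. -/
theorem iwasawa_rows {n a : G} (hn : n ∈ N0) (ha : a ∈ A0) (m : M0) (x : G) :
    ∃ e₁ e₂ t : ℝ, e₁ ^ 2 = 1 ∧ e₂ ^ 2 = 1 ∧ m.1.1 = Matrix.diagonal ![e₁, e₂, e₁ * e₂] ∧
      (∀ j, (n * a * m * x).1 2 j = a.1 2 2 * (e₁ * e₂) * x.1 2 j) ∧
      (∀ j, (n * a * m * x).1 1 j = a.1 1 1 * e₂ * x.1 1 j + t * x.1 2 j) ∧
      a.1 0 0 * a.1 1 1 * a.1 2 2 = 1 := by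
  obtain ⟨e, he⟩ := M0.diag m
  have hsq : ∀ u : ℤˣ, ((u : ℤ) : ℝ) ^ 2 = 1 := by
    intro u
    rcases Int.units_eq_one_or u with h | h <;> simp [h]
  have hd : a.1 = Matrix.diagonal fun i => a.1 i i := by
    ext i j
    by_cases h : i = j
    · simp [h]
    · rw [Matrix.diagonal_apply_ne _ h, ha.1 h]
  have hdet : a.1 0 0 * a.1 1 1 * a.1 2 2 = 1 := by
    have := a.2
    rw [hd, Matrix.det_diagonal, Fin.prod_univ_three] at this
    exact this
  refine ⟨((e.1 : ℤ) : ℝ), ((e.2 : ℤ) : ℝ), n.1 1 2 * (a.1 2 2 * (e.1 * e.2 : ℤ)), hsq _, hsq _, ?_,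
    ?_, ?_, hdet⟩
  · rw [he]
    push_cast
    rfl
  all_goals
    intro j
    change (n.1 * a.1 * m.1.1 * x.1) _ j = _
    rw [he, hd]
    simp [Matrix.mul_apply, Fin.sum_univ_three, Matrix.diagonal_apply, hn.1 2 0 (by decide),
      hn.1 2 1 (by decide), hn.1 1 0 (by decide), hn.2]
    try first | ring1 | (left; ring1)

/-- The term with `t` adds a multiple of the third row to the second and drops out of the cross
product. -/
theorem crossRow_iwasawa {A B : Fin 3 → Fin 3 → ℝ} {c d t : ℝ} (h2 : ∀ j, A 2 j = c * B 2 j)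
    (h1 : ∀ j, A 1 j = d * B 1 j + t * B 2 j) (j : Fin 3) :
    crossRow A j = (c * d) * crossRow B j := by
  fin_cases j <;> simp [crossRow, h1, h2] <;> ring

/-- The signs from `M₀` disappear in the squares, while `rowSq` is scaled by `a₃²` and `crossSq` by
`(a₂ a₃)² = a₁⁻²`. -/
theorem iwasawaChar_mul (μ : LieA0 →ₗ[ℝ] ℂ) {n a : G} (hn : n ∈ N0) (ha : a ∈ A0) (m : M0)
    (x : G) : iwasawaChar μ (n * a * m * x).1 = expChar μ a * iwasawaChar μ x.1 := by
  obtain ⟨e₁, e₂, t, he₁, he₂, hm, h2, h1, hdet⟩ := iwasawa_rows hn ha m x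
  have hx := crossRow_iwasawa h2 h1
  have a0 := ha.2 0
  have a1 := ha.2 1
  have a2 := ha.2 2
  have hr : rowSq (n * a * m * x).1 = a.1 2 2 ^ 2 * rowSq x.1 := by
    simp only [rowSq, h2]
    linear_combination (a.1 2 2 ^ 2 * e₂ ^ 2 * (x.1 2 0 ^ 2 + x.1 2 1 ^ 2 + x.1 2 2 ^ 2)) * he₁ +
      (a.1 2 2 ^ 2 * (x.1 2 0 ^ 2 + x.1 2 1 ^ 2 + x.1 2 2 ^ 2)) * he₂
  have hc : crossSq (n * a * m * x).1 = (a.1 1 1 * a.1 2 2) ^ 2 * crossSq x.1 := by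
    simp only [crossSq, hx]
    linear_combination (e₂ ^ 4 * (a.1 1 1 * a.1 2 2) ^ 2 * (crossRow x.1 0 ^ 2 + crossRow x.1 1 ^ 2 +
      crossRow x.1 2 ^ 2)) * he₁ + ((e₂ ^ 2 + 1) * (a.1 1 1 * a.1 2 2) ^ 2 * (crossRow x.1 0 ^ 2 +
      crossRow x.1 1 ^ 2 + crossRow x.1 2 ^ 2)) * he₂
  have hlog : Real.log (a.1 0 0) + Real.log (a.1 1 1) + Real.log (a.1 2 2) = 0 := by
    rw [← Real.log_mul a0.ne' a1.ne', ← Real.log_mul (mul_pos a0 a1).ne' a2.ne', hdet, Real.log_one]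
  have hlr : Real.log (rowSq (n * a * m * x).1) =
      2 * Real.log (a.1 2 2) + Real.log (rowSq x.1) := by
    rw [hr, Real.log_mul (by positivity) (rowSq_pos x).ne', Real.log_pow]
    norm_num
  have hlc : Real.log (crossSq (n * a * m * x).1) =
      -2 * Real.log (a.1 0 0) + Real.log (crossSq x.1) := by
    rw [hc, Real.log_mul (by positivity) (crossSq_pos x).ne', Real.log_pow,
      Real.log_mul a1.ne' a2.ne']
    push_cast
    linear_combination 2 * hlog
  unfold iwasawaChar
  rw [expChar_eq μ ha, ← Complex.exp_add, hlr, hlc]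
  congr 1
  have h11 : Real.log (a.1 1 1) = -Real.log (a.1 0 0) - Real.log (a.1 2 2) := by linarith
  rw [h11]
  push_cast
  ring

/-- Normalization removes the positive factors from `A₀`, leaving the signs `e₁ e₂` on the third row
and `e₁` on the first; the middle row gets `e₁² e₂ = e₂`. -/
theorem kappa_mul {n a : G} (hn : n ∈ N0) (ha : a ∈ A0) (m : M0) (x : G) :
    kappa (n * a * m * x) = M0toK m * kappa x := by
  obtain ⟨e₁, e₂, t, he₁, he₂, hm, h2, h1, hdet⟩ := iwasawa_rows hn ha m x
  have hx := crossRow_iwasawa h2 h1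
  have a0 := ha.2 0
  have a1 := ha.2 1
  have a2 := ha.2 2
  have hr : √(rowSq (n * a * m * x).1) = a.1 2 2 * √(rowSq x.1) := by
    have : rowSq (n * a * m * x).1 = a.1 2 2 ^ 2 * rowSq x.1 := by
      simp only [rowSq, h2]
      linear_combination (a.1 2 2 ^ 2 * e₂ ^ 2 * (x.1 2 0 ^ 2 + x.1 2 1 ^ 2 + x.1 2 2 ^ 2)) * he₁ +
        (a.1 2 2 ^ 2 * (x.1 2 0 ^ 2 + x.1 2 1 ^ 2 + x.1 2 2 ^ 2)) * he₂
    rw [this, Real.sqrt_mul (by positivity), Real.sqrt_sq a2.le]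
  have hc : √(crossSq (n * a * m * x).1) = (a.1 1 1 * a.1 2 2) * √(crossSq x.1) := by
    have : crossSq (n * a * m * x).1 = (a.1 1 1 * a.1 2 2) ^ 2 * crossSq x.1 := by
      simp only [crossSq, hx]
      linear_combination (e₂ ^ 4 * (a.1 1 1 * a.1 2 2) ^ 2 * (crossRow x.1 0 ^ 2 +
        crossRow x.1 1 ^ 2 + crossRow x.1 2 ^ 2)) * he₁ + ((e₂ ^ 2 + 1) *
        (a.1 1 1 * a.1 2 2) ^ 2 * (crossRow x.1 0 ^ 2 + crossRow x.1 1 ^ 2 +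
        crossRow x.1 2 ^ 2)) * he₂
    rw [this, Real.sqrt_mul (by positivity), Real.sqrt_sq (mul_pos a1 a2).le]
  have hr0 := (Real.sqrt_pos.2 (rowSq_pos x)).ne'
  have hc0 := (Real.sqrt_pos.2 (crossSq_pos x)).ne'
  have hu : ∀ j, (n * a * m * x).1 2 j / √(rowSq (n * a * m * x).1) =
      (e₁ * e₂) * (x.1 2 j / √(rowSq x.1)) := by
    intro j
    rw [hr, h2]
    field_simp
  have hv : ∀ j, crossRow (n * a * m * x).1 j / √(crossSq (n * a * m * x).1) =
      e₁ * (crossRow x.1 j / √(crossSq x.1)) := by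
    intro j
    rw [hc, hx]
    field_simp
    linear_combination (e₁ * crossRow x.1 j) * he₂
  apply Subtype.ext
  apply Subtype.ext
  change Matrix.of (iwasawaK (n * a * m * x).1) = m.1.1 * Matrix.of (iwasawaK x.1)
  rw [hm]
  ext i j
  rw [Matrix.diagonal_mul]
  simp only [iwasawaK, hu, hv, Matrix.of_apply]
  fin_cases i <;> fin_cases j <;> simp
  · linear_combination (e₂ * (x.1 2 1 / √(rowSq x.1) * (crossRow x.1 2 / √(crossSq x.1)) -
      x.1 2 2 / √(rowSq x.1) * (crossRow x.1 1 / √(crossSq x.1)))) * he₁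
  · linear_combination (e₂ * (x.1 2 2 / √(rowSq x.1) * (crossRow x.1 0 / √(crossSq x.1)) -
      x.1 2 0 / √(rowSq x.1) * (crossRow x.1 2 / √(crossSq x.1)))) * he₁
  · linear_combination (e₂ * (x.1 2 0 / √(rowSq x.1) * (crossRow x.1 1 / √(crossSq x.1)) -
      x.1 2 1 / √(rowSq x.1) * (crossRow x.1 0 / √(crossSq x.1)))) * he₁

/-- The open set of matrices on which the Iwasawa decomposition is defined by `iwasawaK`. -/
def iwasawaSet : Set (Fin 3 → Fin 3 → ℝ) := {A | rowSq A ≠ 0 ∧ crossSq A ≠ 0}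

theorem contDiff_rowSq : ContDiff ℝ ∞ rowSq := by
  unfold rowSq
  fun_prop

theorem contDiff_crossRow (j : Fin 3) : ContDiff ℝ ∞ fun A => crossRow A j := by
  fin_cases j <;> simp [crossRow] <;> fun_prop

theorem contDiff_crossSq : ContDiff ℝ ∞ crossSq :=
  (((contDiff_crossRow 0).pow 2).add ((contDiff_crossRow 1).pow 2)).add
    ((contDiff_crossRow 2).pow 2)

theorem isOpen_iwasawaSet : IsOpen iwasawaSet :=
  (isOpen_ne.preimage contDiff_rowSq.continuous).inter
    (isOpen_ne.preimage contDiff_crossSq.continuous)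

theorem contDiffOn_iwasawaChar (μ : LieA0 →ₗ[ℝ] ℂ) :
    ContDiffOn ℝ ∞ (iwasawaChar μ) iwasawaSet := by
  have h1 : ContDiffOn ℝ ∞ (fun A => Real.log (rowSq A)) iwasawaSet :=
    contDiff_rowSq.contDiffOn.log fun A hA => hA.1
  have h2 : ContDiffOn ℝ ∞ (fun A => Real.log (crossSq A)) iwasawaSet :=
    contDiff_crossSq.contDiffOn.log fun A hA => hA.2
  have hof : ContDiff ℝ ∞ (fun t : ℝ => (t : ℂ)) := Complex.ofRealCLM.contDiff
  refine ContDiffOn.cexp ?_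
  refine (contDiffOn_const.mul (hof.comp_contDiffOn ?_)).add
    (contDiffOn_const.mul (hof.comp_contDiffOn ?_))
  · exact h2.neg.div_const 2
  · exact (h2.sub h1).div_const 2

theorem contDiffOn_iwasawaK : ContDiffOn ℝ ∞ iwasawaK iwasawaSet := by
  have hu : ∀ j, ContDiffOn ℝ ∞ (fun A : Fin 3 → Fin 3 → ℝ => A 2 j / √(rowSq A)) iwasawaSet := by
    intro j
    have h : ContDiff ℝ ∞ fun A : Fin 3 → Fin 3 → ℝ => A 2 j := by fun_prop
    refine h.contDiffOn.div (contDiff_rowSq.contDiffOn.sqrt fun A hA => hA.1) fun A hA => ?_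
    refine (Real.sqrt_pos.2 (lt_of_le_of_ne ?_ hA.1.symm)).ne'
    unfold rowSq
    positivity
  have hv : ∀ j, ContDiffOn ℝ ∞ (fun A : Fin 3 → Fin 3 → ℝ => crossRow A j / √(crossSq A))
      iwasawaSet := by
    intro j
    refine (contDiff_crossRow j).contDiffOn.div
      (contDiff_crossSq.contDiffOn.sqrt fun A hA => hA.2) fun A hA => ?_
    refine (Real.sqrt_pos.2 (lt_of_le_of_ne ?_ hA.2.symm)).ne'
    unfold crossSq
    positivity
  refine contDiffOn_pi.2 fun i => contDiffOn_pi.2 fun j => ?_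
  fin_cases i
  · exact hv j
  · fin_cases j
    · exact ((hu 1).mul (hv 2)).sub ((hu 2).mul (hv 1))
    · exact ((hu 2).mul (hv 0)).sub ((hu 0).mul (hv 2))
    · exact ((hu 0).mul (hv 1)).sub ((hu 1).mul (hv 0))
  · exact hu j

/-- The functions on `SO(3)` that are restrictions of smooth functions of matrices. -/
def IsSmoothK (p : K → ℂ) : Prop :=
  ∃ P : (Fin 3 → Fin 3 → ℝ) → ℂ, ContDiff ℝ ∞ P ∧ ∀ k : K, p k = P k.1.1

theorem isSmoothK_of_mem_polyK {p : C(K, ℂ)} (hp : p ∈ polyK) : IsSmoothK p := by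
  change p ∈ Algebra.adjoin ℂ _ at hp
  induction hp using Algebra.adjoin_induction with
  | mem f hf =>
    obtain ⟨i, j, rfl⟩ := hf
    refine ⟨fun A => ((A i j : ℝ) : ℂ), ?_, fun k => rfl⟩
    exact Complex.ofRealCLM.contDiff.comp (by fun_prop : ContDiff ℝ ∞ fun A : Fin 3 → Fin 3 → ℝ => A i j)
  | algebraMap c => exact ⟨fun _ => c, contDiff_const, fun k => rfl⟩
  | add f g _ _ hf hg =>
    obtain ⟨P, hP, h⟩ := hf
    obtain ⟨Q, hQ, h'⟩ := hg
    exact ⟨fun A => P A + Q A, hP.add hQ, fun k => by simp [h, h']⟩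
  | mul f g _ _ hf hg =>
    obtain ⟨P, hP, h⟩ := hf
    obtain ⟨Q, hQ, h'⟩ := hg
    exact ⟨fun A => P A * Q A, hP.mul hQ, fun k => by simp [h, h']⟩

/-- An `M₀`-equivariant smooth function on `K` is the restriction of an element of
`H^∞_{(ν,σ)}`. -/
theorem exists_restrictK_eq (ν : LieA0 →ₗ[ℝ] ℂ) (σ : M0 →* ℂˣ) {p : C(K, ℂ)} (hp : IsSmoothK p)
    (hσ : ∀ (m : M0) (k : K), p (M0toK m * k) = σ m * p k) :
    ∃ f : HInf ν σ, restrictK ν σ f = p := by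
  obtain ⟨P, hP, h⟩ := hp
  -- The equivariance under `N₀ A₀` forces this extension: `f(n a k) = e^{ν+ρ₀}(a) p(k)`.
  refine ⟨⟨fun g => iwasawaChar (ν + rho0) g.1 * p (kappa g), ?_, ?_⟩, ?_⟩
  · intro g
    refine ⟨iwasawaSet, fun A => iwasawaChar (ν + rho0) A * P (iwasawaK A), isOpen_iwasawaSet,
      ⟨(rowSq_pos g).ne', (crossSq_pos g).ne'⟩, ?_, ?_⟩
    · exact (contDiffOn_iwasawaChar _).mul (hP.comp_contDiffOn contDiffOn_iwasawaK)
    · intro x _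
      simp only [h]
      rfl
  · intro n hn a ha m x
    simp only [iwasawaChar_mul _ hn ha, kappa_mul hn ha, hσ]
    ring
  · ext k
    change iwasawaChar (ν + rho0) k.1.1 * p (kappa k) = p k
    rw [iwasawaChar_coe, kappa_coe, one_mul]

/-! ### Translations in `L²(K)` -/

/-- Right translation on `L²(K)`. -/
noncomputable def rTrans (k : K) : L2K →ₗᵢ[ℂ] L2K :=
  Lp.compMeasurePreservingₗᵢ ℂ (· * k) (measurePreserving_mul_right haarK k)

/-- Left translation on `L²(K)`. -/
noncomputable def lTrans (k : K) : L2K →ₗᵢ[ℂ] L2K :=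
  Lp.compMeasurePreservingₗᵢ ℂ (k * ·) (measurePreserving_mul_left haarK k)

theorem rTrans_ae (k : K) (f : L2K) : ∀ᵐ x ∂haarK, rTrans k f x = f (x * k) :=
  Lp.coeFn_compMeasurePreserving f (measurePreserving_mul_right haarK k)

theorem lTrans_ae (k : K) (f : L2K) : ∀ᵐ x ∂haarK, lTrans k f x = f (k * x) :=
  Lp.coeFn_compMeasurePreserving f (measurePreserving_mul_left haarK k)

theorem rTrans_toLp (k : K) (f : C(K, ℂ)) : rTrans k (ContinuousMap.toLp 2 haarK ℂ f) =
    ContinuousMap.toLp 2 haarK ℂ (f.comp ⟨(· * k), continuous_mul_const k⟩) := by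
  refine Lp.ext ?_
  have h1 := ContinuousMap.coeFn_toLp (p := 2) (𝕜 := ℂ) haarK f
  have h2 := (measurePreserving_mul_right haarK k).quasiMeasurePreserving.ae_eq_comp h1
  have h3 := ContinuousMap.coeFn_toLp (p := 2) (𝕜 := ℂ) haarK
    (f.comp ⟨(· * k), continuous_mul_const k⟩)
  filter_upwards [rTrans_ae k (ContinuousMap.toLp 2 haarK ℂ f), h2, h3] with x e1 e2 e3
  rw [e1, e3]
  exact e2

theorem lTrans_toLp (k : K) (f : C(K, ℂ)) : lTrans k (ContinuousMap.toLp 2 haarK ℂ f) =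
    ContinuousMap.toLp 2 haarK ℂ (f.comp ⟨(k * ·), continuous_const_mul k⟩) := by
  refine Lp.ext ?_
  have h1 := ContinuousMap.coeFn_toLp (p := 2) (𝕜 := ℂ) haarK f
  have h2 := (measurePreserving_mul_left haarK k).quasiMeasurePreserving.ae_eq_comp h1
  have h3 := ContinuousMap.coeFn_toLp (p := 2) (𝕜 := ℂ) haarK
    (f.comp ⟨(k * ·), continuous_const_mul k⟩)
  filter_upwards [lTrans_ae k (ContinuousMap.toLp 2 haarK ℂ f), h2, h3] with x e1 e2 e3
  rw [e1, e3]
  exact e2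

theorem continuous_rTrans (f : L2K) : Continuous fun k : K => rTrans k f := by
  let g : C(K, C(K, K)) := ContinuousMap.curry ⟨fun p : K × K => p.2 * p.1, by fun_prop⟩
  exact Continuous.compMeasurePreservingLp (f := fun _ : K => f) (g := g) continuous_const
    g.continuous (fun k => measurePreserving_mul_right haarK k) (by simp)

/-- The almost-everywhere condition becomes a family of equations between continuous operators,
which makes the space visibly closed. -/
theorem mem_L2sigma_iff (σ : M0 →* ℂˣ) (f : L2K) :
    f ∈ L2sigma σ ↔ ∀ m : M0, lTrans (M0toK m) f = (σ m : ℂ) • f := by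
  refine forall_congr' fun m => ?_
  constructor
  · intro h
    refine Lp.ext ?_
    filter_upwards [h, lTrans_ae (M0toK m) f, Lp.coeFn_smul (σ m : ℂ) f] with x h1 h2 h3
    rw [h2, h3, h1]
    rfl
  · intro h
    filter_upwards [lTrans_ae (M0toK m) f, Lp.coeFn_smul (σ m : ℂ) f] with x h2 h3
    rw [← h2, h, h3]
    rfl

theorem isClosed_L2sigma (σ : M0 →* ℂˣ) : IsClosed (L2sigma σ : Set L2K) := by
  have : (L2sigma σ : Set L2K) = ⋂ m : M0, {f | lTrans (M0toK m) f = (σ m : ℂ) • f} := by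
    ext f
    simp [mem_L2sigma_iff]
  rw [this]
  exact isClosed_iInter fun m => isClosed_eq (lTrans _).continuous (continuous_const_smul _)

theorem toLp_mem_L2sigma {σ : M0 →* ℂˣ} {p : C(K, ℂ)}
    (h : ∀ (m : M0) (k : K), p (M0toK m * k) = σ m * p k) :
    ContinuousMap.toLp 2 haarK ℂ p ∈ L2sigma σ := by
  rw [mem_L2sigma_iff]
  intro m
  rw [lTrans_toLp, ← map_smul]
  congr 1
  ext k
  exact h m k

/-! ### Averaging over `M₀` -/

instance : Finite M0 := inferInstanceAs (Finite diagSign.range)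

noncomputable instance : Fintype M0 := Fintype.ofFinite M0

theorem M0.inv_eq (m : M0) : m⁻¹ = m := by
  obtain ⟨_, e, rfl⟩ := m
  refine Subtype.ext ?_
  change (diagSign e)⁻¹ = diagSign e
  rw [← map_inv]
  congr 1
  exact Prod.ext (Int.units_inv_eq_self _) (Int.units_inv_eq_self _)

theorem norm_sigma (σ : M0 →* ℂˣ) (m : M0) : ‖(σ m : ℂ)‖ = 1 := by
  refine Complex.norm_eq_one_of_pow_eq_one (n := Fintype.card M0) ?_ Fintype.card_ne_zero
  rw [← Units.val_pow_eq_pow_val, ← map_pow, pow_card_eq_one, map_one, Units.val_one]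

/-- The projection of a function to the `σ`-equivariant functions. -/
noncomputable def avg (σ : M0 →* ℂˣ) (p : C(K, ℂ)) : C(K, ℂ) :=
  (Fintype.card M0 : ℂ)⁻¹ • ∑ m : M0, (σ m⁻¹ : ℂ) •
    p.comp ⟨(M0toK m * ·), continuous_const_mul (M0toK m)⟩

theorem avg_apply (σ : M0 →* ℂˣ) (p : C(K, ℂ)) (k : K) : avg σ p k =
    (Fintype.card M0 : ℂ)⁻¹ * ∑ m : M0, (σ m⁻¹ : ℂ) * p (M0toK m * k) := by
  simp [avg]

/-- The sum over `M₀` is reindexed by `m' ↦ m' m`. -/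
theorem avg_equivariant (σ : M0 →* ℂˣ) (p : C(K, ℂ)) (m : M0) (k : K) :
    avg σ p (M0toK m * k) = σ m * avg σ p k := by
  rw [avg_apply, avg_apply, mul_left_comm, Finset.mul_sum (a := (σ m : ℂ)),
    ← Equiv.sum_comp (Equiv.mulRight m) fun m' => (σ m : ℂ) * ((σ m'⁻¹ : ℂ) * p (M0toK m' * k))]
  congr 1
  refine Finset.sum_congr rfl fun m' _ => ?_
  simp only [Equiv.coe_mulRight, map_mul, mul_inv_rev, mul_assoc, map_inv, Units.val_mul]
  rw [← mul_assoc (σ m : ℂ), Units.mul_inv, one_mul]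

theorem isSmoothK_avg (σ : M0 →* ℂˣ) {p : C(K, ℂ)} (hp : IsSmoothK p) : IsSmoothK (avg σ p) := by
  obtain ⟨P, hP, h⟩ := hp
  refine ⟨fun A => (Fintype.card M0 : ℂ)⁻¹ * ∑ m : M0, (σ m⁻¹ : ℂ) *
    P fun i j => ∑ l, m.1.1 i l * A l j, ?_, fun k => ?_⟩
  · refine contDiff_const.mul (ContDiff.sum fun m _ => contDiff_const.mul (hP.comp ?_))
    fun_prop
  · rw [avg_apply]
    simp only [h]
    rfl

/-- Averaging is the orthogonal projection to the equivariant functions. Since `σ` is unitary, every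
term of the average has the same inner product with an equivariant `f`. -/
theorem inner_toLp_avg (σ : M0 →* ℂˣ) (p : C(K, ℂ)) {f : L2K} (hf : f ∈ L2sigma σ) :
    inner ℂ (ContinuousMap.toLp 2 haarK ℂ (avg σ p)) f =
      inner ℂ (ContinuousMap.toLp 2 haarK ℂ p) f := by
  rw [mem_L2sigma_iff] at hf
  have h : ∀ m : M0, inner ℂ ((σ m⁻¹ : ℂ) • ContinuousMap.toLp 2 haarK ℂ
      (p.comp ⟨(M0toK m * ·), continuous_const_mul (M0toK m)⟩)) f =
      inner ℂ (ContinuousMap.toLp 2 haarK ℂ p) f := by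
    intro m
    have h1 : f = (σ m⁻¹ : ℂ) • lTrans (M0toK m) f := by
      rw [hf, smul_smul, ← Units.val_mul, ← map_mul, inv_mul_cancel, map_one, Units.val_one,
        one_smul]
    conv_lhs => rw [h1]
    rw [← lTrans_toLp, inner_smul_left, inner_smul_right, LinearIsometry.inner_map_map, ← mul_assoc,
      ← Complex.normSq_eq_conj_mul_self, Complex.normSq_eq_norm_sq, norm_sigma]
    simp
  have hc : (Fintype.card M0 : ℂ) ≠ 0 := Nat.cast_ne_zero.2 Fintype.card_ne_zero
  rw [avg, map_smul, map_sum, inner_smul_left, sum_inner]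
  simp only [map_smul, h]
  simp [hc]

theorem eq_zero_of_inner_avg {σ : M0 →* ℂˣ} {f : L2K} (hf : f ∈ L2sigma σ)
    (h : ∀ p ∈ polyK, inner ℂ (ContinuousMap.toLp 2 haarK ℂ (avg σ p)) f = 0) : f = 0 :=
  L2K_eq_zero_of_polyK fun p hp => by rw [← inner_toLp_avg σ p hf, h p hp]

/-! ### The restriction map -/

section
variable (ν : LieA0 →ₗ[ℝ] ℂ) (σ : M0 →* ℂˣ)

theorem rK_coe (f : HInf ν σ) : rK ν σ (f : PS ν σ) = restrictL2 ν σ f := extendIsom_coe ν σ _ f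

theorem rK_piK (k : K) (u : PS ν σ) : rK ν σ (piK ν σ k u) = rTrans k (rK ν σ u) := by
  refine UniformSpace.Completion.induction_on u ?_ fun f => ?_
  · exact isClosed_eq ((rK ν σ).continuous.comp (piKIsom ν σ k).continuous)
      ((rTrans k).continuous.comp (rK ν σ).continuous)
  · rw [piK_coe, rK_coe, rK_coe, restrictL2_piInfK]
    rfl

theorem inner_piK (k : K) (u v : PS ν σ) :
    inner ℂ (piK ν σ k u) (piK ν σ k v) = inner ℂ u v := (piKIsom ν σ k).inner_map_map u v

/-- The isometry `r_K` is an embedding that turns the action into right translation, which is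
strongly continuous on `L²(K)`. -/
theorem continuous_piK (u : PS ν σ) : Continuous fun k : K => piK ν σ k u := by
  rw [(rK ν σ).isometry.isEmbedding.continuous_iff]
  simp only [Function.comp_def, rK_piK]
  exact continuous_rTrans _

theorem rK_mem (u : PS ν σ) : rK ν σ u ∈ L2sigma σ := by
  refine UniformSpace.Completion.induction_on u ?_ fun f => ?_
  · exact (isClosed_L2sigma σ).preimage (rK ν σ).continuous
  · rw [rK_coe]
    refine toLp_mem_L2sigma fun m k => ?_
    have h1 : (1 : G) ∈ N0 := ⟨fun i j h => Matrix.one_apply_ne h.ne', fun i => Matrix.one_apply_eq i⟩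
    have h2 : (1 : G) ∈ A0 := ⟨Matrix.isDiag_one, fun i => by simp⟩
    have h3 : expChar (ν + rho0) 1 = 1 := by simp [expChar]
    have h := f.2.2 1 h1 1 h2 m k
    rw [h3, one_mul, one_mul, one_mul] at h
    exact h

/-- The range is complete, so an equivariant `f` splits into a part in the range and an equivariant
part `t` orthogonal to it. Averages of polynomial functions lie in the range, so `t` is orthogonal
to them, and therefore to all polynomial functions. -/
theorem range_rK : LinearMap.range (rK ν σ).toLinearMap = L2sigma σ := by
  refine le_antisymm ?_ fun f hf => ?_
  · rintro _ ⟨u, rfl⟩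
    exact rK_mem ν σ u
  · have hcl : IsComplete (LinearMap.range (rK ν σ).toLinearMap : Set L2K) := by
      have := (rK ν σ).isometry.isUniformInducing.isComplete_range
      exact this
    have : CompleteSpace (LinearMap.range (rK ν σ).toLinearMap) := hcl.completeSpace_coe
    obtain ⟨y, ⟨u, rfl⟩, t, ht, rfl⟩ :=
      (LinearMap.range (rK ν σ).toLinearMap).exists_add_mem_mem_orthogonal f
    have hu : (rK ν σ).toLinearMap u ∈ L2sigma σ := rK_mem ν σ u
    have ht' : t ∈ L2sigma σ := by
      have := (L2sigma σ).sub_mem hf hu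
      rwa [add_sub_cancel_left] at this
    have h0 : t = 0 := by
      refine eq_zero_of_inner_avg ht' fun p hp => ?_
      obtain ⟨f, hf⟩ := exists_restrictK_eq ν σ (isSmoothK_avg σ (isSmoothK_of_mem_polyK hp))
        (avg_equivariant σ p)
      refine ht _ ⟨(f : PS ν σ), ?_⟩
      change rK ν σ f = _
      rw [rK_coe, ← hf]
      rfl
    rw [h0, add_zero]
    exact ⟨u, rfl⟩

theorem rK_rKinv {f : L2K} (hf : f ∈ L2sigma σ) : rK ν σ (rKinv ν σ f) = f := by
  rw [← range_rK ν σ] at hf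
  obtain ⟨u, rfl⟩ := hf
  exact congrArg (rK ν σ) (rKinv_rK ν σ u)

theorem Phi_mem {l : ℕ} {w : Module.Dual ℂ (V (2 * l))} (hw : w ∈ dualIso σ l) (v : V (2 * l)) :
    Phi l (w ⊗ₜ v) ∈ L2sigma σ := by
  refine toLp_mem_L2sigma fun m k => ?_
  -- The dual representation at `m⁻¹` is composition with `τ(m)`; the resulting `σ(m⁻¹)` equals
  -- `σ(m)` since every element of `M₀` is its own inverse.
  have h := hw m⁻¹
  have hm : ((σ m⁻¹ : ℂˣ) : ℂ) = σ m := by rw [M0.inv_eq]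
  change w (tau l (M0toK m * k) v) = σ m * w (tau l k v)
  rw [map_mul, Module.End.mul_apply, ← hm]
  have h2 := LinearMap.congr_fun h (tau l k v)
  rw [LinearMap.smul_apply, smul_eq_mul] at h2
  rw [← h2, Representation.dual_apply, ← map_inv, inv_inv]
  rfl

theorem Phi_map_mem (l : ℕ) (t : dualIso σ l ⊗[ℂ] V (2 * l)) :
    Phi l (TensorProduct.map (dualIso σ l).subtype LinearMap.id t) ∈ L2sigma σ := by
  induction t using TensorProduct.induction_on with
  | zero => simp
  | add a b ha hb => rw [map_add, map_add]; exact add_mem ha hb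
  | tmul w v => exact Phi_mem σ w.2 v

theorem rK_Psi (l : ℕ) (t : dualIso σ l ⊗[ℂ] V (2 * l)) : rK ν σ (Psi ν σ l t) =
    Phi l (TensorProduct.map (dualIso σ l).subtype LinearMap.id t) :=
  rK_rKinv ν σ (Phi_map_mem σ l t)

end

/-! ### The Hilbert sum decomposition -/

theorem mem_dualIso_iff (σ : M0 →* ℂˣ) (l : ℕ) (w : Module.Dual ℂ (V (2 * l))) :
    w ∈ dualIso σ l ↔ ∀ (m : M0) (v : V (2 * l)), w (tau l (M0toK m) v) = σ m * w v := by
  refine forall_congr' fun m => ?_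
  rw [LinearMap.ext_iff]
  refine forall_congr' fun v => ?_
  rw [Representation.dual_apply, ← map_inv, M0.inv_eq]
  rfl

/-- The projection of a functional to the `σ`-isotypic component. -/
noncomputable def projDual (σ : M0 →* ℂˣ) (l : ℕ) (w : Module.Dual ℂ (V (2 * l))) :
    Module.Dual ℂ (V (2 * l)) :=
  (Fintype.card M0 : ℂ)⁻¹ • ∑ m : M0, (σ m⁻¹ : ℂ) • w ∘ₗ tau l (M0toK m)

theorem avg_matCoeff (σ : M0 →* ℂˣ) (l : ℕ) (w : Module.Dual ℂ (V (2 * l))) (v : V (2 * l)) :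
    avg σ (matCoeff l w v) = matCoeff l (projDual σ l w) v := by
  ext k
  rw [avg_apply]
  change _ = projDual σ l w (tau l k v)
  simp only [projDual, LinearMap.smul_apply, LinearMap.sum_apply, smul_eq_mul,
    LinearMap.comp_apply, ← Module.End.mul_apply, ← map_mul]
  rfl

/-- The equivariance of the averaged matrix coefficient, evaluated at `k = 1`, is the required
property of its functional. -/
theorem projDual_mem (σ : M0 →* ℂˣ) (l : ℕ) (w : Module.Dual ℂ (V (2 * l))) :
    projDual σ l w ∈ dualIso σ l := by
  rw [mem_dualIso_iff]
  intro m v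
  have h := avg_equivariant σ (matCoeff l w v) m 1
  rw [avg_matCoeff, mul_one] at h
  refine h.trans ?_
  change _ * projDual σ l w (tau l 1 v) = _
  rw [map_one, Module.End.one_apply]

local instance (σ : M0 →* ℂˣ) (l : ℕ) : IsBoundedSMul ℂ (dualIso σ l ⊗[ℂ] V (2 * l)) :=
  @NormedSpace.toIsBoundedSMul ℂ (dualIso σ l ⊗[ℂ] V (2 * l)) _ _
    InnerProductSpace.toNormedSpace

section
variable (ν : LieA0 →ₗ[ℝ] ℂ) (σ : M0 →* ℂˣ)

theorem inner_map_dualIso (l : ℕ) (s t : dualIso σ l ⊗[ℂ] V (2 * l)) :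
    inner ℂ (TensorProduct.map (dualIso σ l).subtype LinearMap.id s)
      (TensorProduct.map (dualIso σ l).subtype LinearMap.id t) = inner ℂ s t :=
  TensorProduct.inner_map_map (dualIso σ l).subtypeₗᵢ LinearIsometry.id s t

theorem inner_Psi (l : ℕ) (s t : dualIso σ l ⊗[ℂ] V (2 * l)) :
    inner ℂ (Psi ν σ l s) (Psi ν σ l t) = (2 * l + 1 : ℂ)⁻¹ * inner ℂ s t := by
  rw [← (rK ν σ).inner_map_map, rK_Psi, rK_Psi, inner_Phi_Phi, inner_map_dualIso]

theorem inner_Psi_of_ne {l l' : ℕ} (h : l ≠ l') (s : dualIso σ l ⊗[ℂ] V (2 * l))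
    (t : dualIso σ l' ⊗[ℂ] V (2 * l')) : inner ℂ (Psi ν σ l s) (Psi ν σ l' t) = 0 := by
  rw [← (rK ν σ).inner_map_map, rK_Psi, rK_Psi, inner_Phi_Phi_of_ne h]

theorem rTrans_Phi (l : ℕ) (k : K) (w : Module.Dual ℂ (V (2 * l))) (v : V (2 * l)) :
    rTrans k (Phi l (w ⊗ₜ v)) = Phi l (w ⊗ₜ tau l k v) := by
  rw [Phi_tmul, Phi_tmul, rTrans_toLp]
  have h : (matCoeff l w v).comp ⟨(· * k), continuous_mul_const k⟩ =
      matCoeff l w (tau l k v) := by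
    ext x
    change w (tau l (x * k) v) = w (tau l x (tau l k v))
    rw [map_mul, Module.End.mul_apply]
  rw [h]

theorem piK_Psi (l : ℕ) (k : K) (t : dualIso σ l ⊗[ℂ] V (2 * l)) :
    piK ν σ k (Psi ν σ l t) = Psi ν σ l (TensorProduct.map LinearMap.id (tau l k) t) := by
  apply (rK ν σ).injective
  rw [rK_piK, rK_Psi, rK_Psi]
  induction t using TensorProduct.induction_on with
  | zero => simp
  | add a b ha hb => simp only [map_add, ha, hb]
  | tmul w v =>
    rw [TensorProduct.map_tmul, TensorProduct.map_tmul, TensorProduct.map_tmul]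
    exact rTrans_Phi l k w.1 v

/-- The multiple of `r_K⁻¹ ∘ Φ_l` that is an isometry. -/
noncomputable def PsiIsom (l : ℕ) : dualIso σ l ⊗[ℂ] V (2 * l) →ₗᵢ[ℂ] PS ν σ where
  -- The factor compensates for the constant `1/(2l+1)` of Schur orthogonality.
  toLinearMap := ((√(2 * l + 1) : ℝ) : ℂ) • Psi ν σ l
  norm_map' t := by
    have hl : (0 : ℝ) ≤ 2 * l + 1 := by positivity
    have hl' : (2 * l + 1 : ℂ) ≠ 0 := by exact_mod_cast Nat.succ_ne_zero (2 * l)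
    have h : inner ℂ (((√(2 * l + 1) : ℝ) : ℂ) • Psi ν σ l t)
        (((√(2 * l + 1) : ℝ) : ℂ) • Psi ν σ l t) = inner ℂ t t := by
      rw [inner_smul_left, inner_smul_right, inner_Psi, Complex.conj_ofReal, ← mul_assoc,
        ← mul_assoc, ← Complex.ofReal_mul, Real.mul_self_sqrt hl]
      push_cast
      rw [mul_inv_cancel₀ hl', one_mul]
    rw [LinearMap.smul_apply, norm_eq_sqrt_re_inner (𝕜 := ℂ), h]
    exact (norm_eq_sqrt_re_inner (𝕜 := ℂ) t).symm

theorem PsiIsom_apply (l : ℕ) (t : dualIso σ l ⊗[ℂ] V (2 * l)) :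
    PsiIsom ν σ l t = ((√(2 * l + 1) : ℝ) : ℂ) • Psi ν σ l t := rfl

/-- Since `r_K u` is equivariant, its inner product with a matrix coefficient is unchanged when the
functional `w` is projected to `V_{2l}^*[σ]`. Thus `r_K u` is orthogonal to all matrix coefficients,
hence to all polynomial functions. -/
theorem eq_zero_of_inner_Psi {u : PS ν σ}
    (h : ∀ l (t : dualIso σ l ⊗[ℂ] V (2 * l)), inner ℂ (Psi ν σ l t) u = 0) : u = 0 := by
  apply (rK ν σ).injective
  rw [map_zero]
  refine L2K_eq_zero_of_polyK fun p hp => ?_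
  have hp' := polyK_le_matSpan hp
  clear hp
  induction hp' using Submodule.span_induction with
  | zero => simp
  | add x y _ _ hx hy => rw [map_add, inner_add_left, hx, hy, add_zero]
  | smul c x _ hx => rw [map_smul, inner_smul_left, hx, mul_zero]
  | mem x hx =>
    obtain ⟨l, w, v, rfl⟩ := hx
    rw [← inner_toLp_avg σ _ (rK_mem ν σ u), avg_matCoeff]
    have h2 := h l ((⟨projDual σ l w, projDual_mem σ l w⟩ : dualIso σ l) ⊗ₜ v)
    rw [← (rK ν σ).inner_map_map, rK_Psi] at h2
    exact h2

theorem isHilbertSum_Psi :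
    IsHilbertSum ℂ (fun l : ℕ => dualIso σ l ⊗[ℂ] V (2 * l)) (PsiIsom ν σ) := by
  have : ∀ l : ℕ, CompleteSpace (dualIso σ l ⊗[ℂ] V (2 * l)) := fun l =>
    FiniteDimensional.complete ℂ _
  refine IsHilbertSum.mk ?_ ?_
  · intro l l' h s t
    rw [PsiIsom_apply, PsiIsom_apply, inner_smul_left, inner_smul_right, inner_Psi_of_ne ν σ h,
      mul_zero, mul_zero]
  · rw [top_le_iff, Submodule.topologicalClosure_eq_top_iff, Submodule.eq_bot_iff]
    intro u hu
    refine eq_zero_of_inner_Psi ν σ fun l t => ?_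
    have h := hu _ (Submodule.mem_iSup_of_mem l ⟨t, rfl⟩)
    have h2 : inner ℂ (((√(2 * l + 1) : ℝ) : ℂ) • Psi ν σ l t) u = 0 := h
    rw [inner_smul_left, Complex.conj_ofReal] at h2
    refine (mul_eq_zero.1 h2).resolve_left ?_
    have : (0 : ℝ) < √(2 * l + 1) := Real.sqrt_pos.2 (by positivity)
    exact_mod_cast this.ne'

/-- The unitary isomorphism of the Hilbert sum of the `V_{2l}^*[σ] ⊗ V_{2l}` with `H_{(ν,σ)}`. -/
noncomputable def sumEquiv : HilbertSum σ ≃ₗᵢ[ℂ] PS ν σ :=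
  (isHilbertSum_Psi ν σ).linearIsometryEquiv.symm

theorem sumEquiv_single (l : ℕ) (t : dualIso σ l ⊗[ℂ] V (2 * l)) :
    sumEquiv ν σ (lp.single 2 l t) = ((√(2 * l + 1) : ℝ) : ℂ) • Psi ν σ l t :=
  (isHilbertSum_Psi ν σ).linearIsometryEquiv_symm_apply_single t

/-- Both sides are continuous and linear in `x`, so it is enough to take `x` supported in one
summand, where `piK_Psi` applies. -/
theorem sumEquiv_equivariant (k : K) (x : HilbertSum σ) (l : ℕ) :
    ((sumEquiv ν σ).symm (piK ν σ k (sumEquiv ν σ x))) l =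
      TensorProduct.map LinearMap.id (tau l k) (x l) := by
  let E : HilbertSum σ →L[ℂ] dualIso σ l ⊗[ℂ] V (2 * l) :=
    lp.evalCLM ℂ (fun l : ℕ => dualIso σ l ⊗[ℂ] V (2 * l)) 2 l
  let f : HilbertSum σ →L[ℂ] dualIso σ l ⊗[ℂ] V (2 * l) :=
    E ∘L (sumEquiv ν σ).symm.toContinuousLinearEquiv.toContinuousLinearMap ∘L
      (piKIsom ν σ k).toContinuousLinearMap ∘L
        (sumEquiv ν σ).toContinuousLinearEquiv.toContinuousLinearMap
  let g : HilbertSum σ →L[ℂ] dualIso σ l ⊗[ℂ] V (2 * l) :=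
    (TensorProduct.mapIsometry LinearIsometry.id
      ((tau l k).isometryOfInner (inner_tau l k))).toContinuousLinearMap ∘L E
  have hfg : f = g := by
    refine lp.ext_continuousLinearMap (by simp) fun j => ?_
    ext1 t
    change ((sumEquiv ν σ).symm (piK ν σ k (sumEquiv ν σ (lp.single 2 j t)))) l =
      TensorProduct.map LinearMap.id (tau l k) ((lp.single 2 j t : HilbertSum σ) l)
    have h : piK ν σ k (sumEquiv ν σ (lp.single 2 j t)) =
        sumEquiv ν σ (lp.single 2 j (TensorProduct.map LinearMap.id (tau j k) t)) := by
      rw [sumEquiv_single, sumEquiv_single, map_smul, piK_Psi]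
    rw [h, LinearIsometryEquiv.symm_apply_apply]
    by_cases hj : j = l
    · subst hj
      rw [lp.single_apply_self, lp.single_apply_self]
    · rw [lp.single_apply_ne _ _ _ (Ne.symm hj), lp.single_apply_ne _ _ _ (Ne.symm hj), map_zero]
  exact congrArg (fun T : HilbertSum σ →L[ℂ] dualIso σ l ⊗[ℂ] V (2 * l) => T x) hfg

end

/-! ### Intertwining operators -/

section
variable {D : Type*} [AddCommGroup D] [Module ℂ D] {ι : Type*} [Fintype ι]

/-- The contraction of `D ⊗ V` with a functional on `D`. -/
noncomputable def contract (n : ℕ) (φ : Module.Dual ℂ D) : D ⊗[ℂ] V n →ₗ[ℂ] V n :=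
  (TensorProduct.lid ℂ (V n)).toLinearMap ∘ₗ TensorProduct.map φ LinearMap.id

theorem contract_tmul (n : ℕ) (φ : Module.Dual ℂ D) (d : D) (v : V n) :
    contract n φ (d ⊗ₜ v) = φ d • v := by
  simp [contract]

theorem sum_contract (n : ℕ) (b : Module.Basis ι ℂ D) (x : D ⊗[ℂ] V n) :
    x = ∑ i, b i ⊗ₜ contract n (b.coord i) x := by
  induction x using TensorProduct.induction_on with
  | zero => simp
  | add x y hx hy =>
    conv_lhs => rw [hx, hy, ← Finset.sum_add_distrib]
    simp only [map_add, TensorProduct.tmul_add]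
  | tmul d v =>
    conv_lhs => rw [← b.sum_repr d, TensorProduct.sum_tmul]
    refine Finset.sum_congr rfl fun i _ => ?_
    rw [contract_tmul, TensorProduct.tmul_smul, TensorProduct.smul_tmul']
    rfl

/-- A contracted intertwining operator. -/
noncomputable def contractInt {l j : ℕ} (C : V (2 * l) →ₗ[ℂ] D ⊗[ℂ] V (2 * j))
    (hC : ∀ (k : K) v, C (tau l k v) = TensorProduct.map LinearMap.id (tau j k) (C v))
    (φ : Module.Dual ℂ D) : (tau l).IntertwiningMap (tau j) where
  toLinearMap := contract (2 * j) φ ∘ₗ C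
  isIntertwining' k := by
    ext1 v
    have h : ∀ x : D ⊗[ℂ] V (2 * j), contract (2 * j) φ (TensorProduct.map LinearMap.id (tau j k) x)
        = tau j k (contract (2 * j) φ x) := by
      intro x
      induction x using TensorProduct.induction_on with
      | zero => simp
      | add x y hx hy => simp only [map_add, hx, hy]
      | tmul d v => rw [TensorProduct.map_tmul, contract_tmul, contract_tmul, map_smul]; rfl
    simp only [LinearMap.comp_apply, hC, h]

/-- Contraction with the coordinates of a basis of `D` turns `C` into intertwining operators between
inequivalent irreducible representations, which vanish. -/
theorem tensor_intertwining_of_ne [FiniteDimensional ℂ D] {l j : ℕ} (hlj : l ≠ j)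
    (C : V (2 * l) →ₗ[ℂ] D ⊗[ℂ] V (2 * j))
    (hC : ∀ (k : K) v, C (tau l k v) = TensorProduct.map LinearMap.id (tau j k) (C v))
    (v : V (2 * l)) : C v = 0 := by
  rw [sum_contract (2 * j) (Module.finBasis ℂ D) (C v)]
  refine Finset.sum_eq_zero fun i _ => ?_
  have h : contract (2 * j) ((Module.finBasis ℂ D).coord i) (C v) = 0 :=
    congrArg (fun T => T v) (intertwiningMap_eq_zero hlj.symm (contractInt C hC _))
  rw [h, TensorProduct.tmul_zero]

/-- Here the contractions are scalars by Schur's lemma, and these scalars are the coordinates of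
`d`. -/
theorem tensor_intertwining_self [FiniteDimensional ℂ D] {l : ℕ}
    (C : V (2 * l) →ₗ[ℂ] D ⊗[ℂ] V (2 * l))
    (hC : ∀ (k : K) v, C (tau l k v) = TensorProduct.map LinearMap.id (tau l k) (C v)) :
    ∃ d : D, ∀ v, C v = d ⊗ₜ v := by
  choose c hc using fun i => intertwiningMap_eq_smul l
    (contractInt C hC ((Module.finBasis ℂ D).coord i))
  refine ⟨∑ i, c i • Module.finBasis ℂ D i, fun v => ?_⟩
  rw [sum_contract (2 * l) (Module.finBasis ℂ D) (C v), TensorProduct.sum_tmul]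
  refine Finset.sum_congr rfl fun i _ => ?_
  have h : contract (2 * l) ((Module.finBasis ℂ D).coord i) (C v) = c i • v := hc i v
  rw [h, TensorProduct.tmul_smul, TensorProduct.smul_tmul']

end

/-- Each component of `T` in the Hilbert sum is an intertwining operator into a finite multiple of
`V_{2j}`, so only `j = l` contributes, in the form `v ↦ d ⊗ v`. -/
theorem exists_Psi_eq (ν : LieA0 →ₗ[ℝ] ℂ) (σ : M0 →* ℂˣ) (l : ℕ) (T : V (2 * l) →ₗ[ℂ] PS ν σ)
    (hT : ∀ (k : K) v, T (tau l k v) = piK ν σ k (T v)) :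
    ∃ w : dualIso σ l, ∀ v, T v = Psi ν σ l (w ⊗ₜ v) := by
  let C : ∀ j : ℕ, V (2 * l) →ₗ[ℂ] dualIso σ j ⊗[ℂ] V (2 * j) := fun j =>
    (lp.evalCLM ℂ (fun l : ℕ => dualIso σ l ⊗[ℂ] V (2 * l)) 2 j).toLinearMap ∘ₗ
      (sumEquiv ν σ).symm.toLinearEquiv.toLinearMap ∘ₗ T
  have hCa : ∀ j v, C j v = ((sumEquiv ν σ).symm (T v)) j := fun j v => rfl
  have hC : ∀ j (k : K) v, C j (tau l k v) = TensorProduct.map LinearMap.id (tau j k) (C j v) := by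
    intro j k v
    rw [hCa, hCa, hT, ← sumEquiv_equivariant, LinearIsometryEquiv.apply_symm_apply]
  obtain ⟨d, hd⟩ := tensor_intertwining_self (C l) (hC l)
  -- The unitary isomorphism is `√(2l+1)` times `r_K⁻¹ ∘ Φ_l` on this summand, and the factor is
  -- absorbed in `w`.
  refine ⟨((√(2 * l + 1) : ℝ) : ℂ) • d, fun v => ?_⟩
  have h : (sumEquiv ν σ).symm (T v) = lp.single 2 l (d ⊗ₜ v) := by
    refine lp.ext (funext fun j => ?_)
    by_cases hj : j = l
    · subst hj
      rw [lp.single_apply_self, ← hCa, hd]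
    · rw [lp.single_apply_ne _ _ _ hj, ← hCa]
      exact tensor_intertwining_of_ne (Ne.symm hj) (C j) (hC j) v
  rw [← TensorProduct.smul_tmul', map_smul, ← sumEquiv_single, ← h,
    LinearIsometryEquiv.apply_symm_apply]

/-! ### The action of `M₀` on the standard basis -/

/-- The preimage of `diag(1, -1, -1)` in `SU(2)`. -/
noncomputable def quatI : SU2 := SU2.mk (p := 0) (q := 1) (r := 0) (s := 0) (by norm_num)

/-- The preimage of `diag(-1, 1, -1)` in `SU(2)`. -/
noncomputable def quatJ : SU2 := SU2.mk (p := 0) (q := 0) (r := 1) (s := 0) (by norm_num)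

theorem spinCover_quatI : spinCover quatI = M0toK (M0.mk 1 (-1)) := by
  apply Subtype.ext
  apply Subtype.ext
  change rotMatrix 0 1 0 0 = Matrix.diagonal _
  ext i j
  fin_cases i <;> fin_cases j <;> simp [rotMatrix]

theorem spinCover_quatJ : spinCover quatJ = M0toK (M0.mk (-1) 1) := by
  apply Subtype.ext
  apply Subtype.ext
  change rotMatrix 0 0 1 0 = Matrix.diagonal _
  ext i j
  fin_cases i <;> fin_cases j <;> simp [rotMatrix]

theorem tau_quatI (l : ℕ) (k : Fin (2 * l + 1)) :
    tau l (M0toK (M0.mk 1 (-1))) (stdVec (2 * l) k) =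
      (-1 : ℂ) ^ (l + k : ℕ) • stdVec (2 * l) k := by
  have hinv : (quatI⁻¹ : SU2).1 = !![-Complex.I, 0; 0, Complex.I] := by
    rw [SU2.inv_entries]
    ext i j
    fin_cases i <;> fin_cases j <;> simp [quatI, SU2.mk, coordSU, Complex.ext_iff]
  have hk : (k : ℕ) ≤ 2 * l := Nat.lt_succ_iff.1 k.2
  rw [← spinCover_quatI, tau_spinCover]
  apply Subtype.ext
  rw [tauSU_apply, SetLike.val_smul, stdVec_coe, hinv, MvPolynomial.smul_eq_C_mul]
  -- The substitution is `x ↦ -i x`, `y ↦ i y`, and `(-i)^k i^(2l-k) = (-1)^k i^(2l) = (-1)^(l+k)`.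
  have he : (-1 : ℂ) ^ (l + k : ℕ) = (-Complex.I) ^ (k : ℕ) * Complex.I ^ (2 * l - k : ℕ) := by
    rw [neg_pow Complex.I (k : ℕ), mul_assoc, ← pow_add, Nat.add_sub_of_le hk, pow_mul,
      Complex.I_sq, ← pow_add, add_comm]
  rw [he]
  simp [subst, mul_pow]
  ring

theorem tau_quatJ (l : ℕ) (k : Fin (2 * l + 1)) :
    tau l (M0toK (M0.mk (-1) 1)) (stdVec (2 * l) k) =
      (-1 : ℂ) ^ (k : ℕ) • stdVec (2 * l) k.rev := by
  have hinv : (quatJ⁻¹ : SU2).1 = !![0, -1; 1, 0] := by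
    rw [SU2.inv_entries]
    ext i j
    fin_cases i <;> fin_cases j <;> simp [quatJ, SU2.mk, coordSU, Complex.ext_iff]
  have hk : (k : ℕ) ≤ 2 * l := Nat.lt_succ_iff.1 k.2
  rw [← spinCover_quatJ, tau_spinCover]
  apply Subtype.ext
  rw [tauSU_apply, SetLike.val_smul, stdVec_coe, hinv, MvPolynomial.smul_eq_C_mul, stdVec_coe]
  have h1 : (k.rev : ℕ) = 2 * l - k := by rw [Fin.val_rev]; omega
  have h2 : 2 * l - (k.rev : ℕ) = k := by omega
  rw [h2, h1]
  simp [subst]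
  rw [neg_pow]
  ring

/-- The two elements `diag(1, -1, -1)` and `diag(-1, 1, -1)` generate `M₀`, so it suffices to impose
equivariance under them on basis vectors: the first fixes the parity of `k`, the second relates `k`
to `2l - k`. -/
theorem mem_dualIso_iff_stdVec (σ : M0 →* ℂˣ) (l : ℕ) (w : Module.Dual ℂ (V (2 * l))) :
    w ∈ dualIso σ l ↔ ∀ k : Fin (2 * l + 1),
      (-1 : ℂ) ^ (l + k : ℕ) * w (stdVec (2 * l) k) = (-1) ^ sigma2 σ * w (stdVec (2 * l) k) ∧
      (-1 : ℂ) ^ (k : ℕ) * w (stdVec (2 * l) k.rev) = (-1) ^ sigma1 σ * w (stdVec (2 * l) k) := by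
  have h1 : (σ (M0.mk 1 (-1)) : ℂ) = (-1) ^ sigma2 σ := by rw [sigma_eq]; simp
  have h2 : (σ (M0.mk (-1) 1) : ℂ) = (-1) ^ sigma1 σ := by rw [sigma_eq]; simp
  rw [mem_dualIso_iff]
  constructor
  · intro h k
    have e1 := h (M0.mk 1 (-1)) (stdVec (2 * l) k)
    have e2 := h (M0.mk (-1) 1) (stdVec (2 * l) k)
    rw [tau_quatI, map_smul, smul_eq_mul, h1] at e1
    rw [tau_quatJ, map_smul, smul_eq_mul, h2] at e2
    exact ⟨e1, e2⟩
  · intro h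
    have ext' : ∀ m : M0, (∀ k, w (tau l (M0toK m) (stdVec (2 * l) k)) =
        σ m * w (stdVec (2 * l) k)) → ∀ v, w (tau l (M0toK m) v) = σ m * w v := by
      intro m hm v
      have : w ∘ₗ tau l (M0toK m) = (σ m : ℂ) • w :=
        (stdBasis (2 * l)).ext fun k => by rw [stdBasis_apply]; exact hm k
      exact LinearMap.congr_fun this v
    have e1 := ext' (M0.mk 1 (-1)) fun k => by
      rw [tau_quatI, map_smul, smul_eq_mul, h1]; exact (h k).1
    have e2 := ext' (M0.mk (-1) 1) fun k => by
      rw [tau_quatJ, map_smul, smul_eq_mul, h2]; exact (h k).2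
    have e0 : ∀ v, w (tau l (M0toK (M0.mk 1 1)) v) = σ (M0.mk 1 1) * w v := by
      have : M0.mk 1 1 = 1 := Subtype.ext (map_one diagSign)
      intro v
      rw [this, map_one, map_one, map_one, Module.End.one_apply, Units.val_one, one_mul]
    have e3 : ∀ v, w (tau l (M0toK (M0.mk (-1) (-1))) v) = σ (M0.mk (-1) (-1)) * w v := by
      intro v
      have : M0.mk (-1) (-1) = M0.mk (-1) 1 * M0.mk 1 (-1) := by rw [M0.mk_mul]; simp
      rw [this, map_mul, map_mul, map_mul, Module.End.mul_apply, e2, e1, Units.val_mul, mul_assoc]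
    rintro ⟨_, ⟨a, b⟩, rfl⟩
    change ∀ v, w (tau l (M0toK (M0.mk a b)) v) = σ (M0.mk a b) * w v
    rcases Int.units_eq_one_or a with rfl | rfl <;> rcases Int.units_eq_one_or b with rfl | rfl
    exacts [e0, e1, e2, e3]

/-! ### The functionals `v_{2l-p}^* + (-1)^ε v_p^*` -/

section
variable (σ : M0 →* ℂˣ)

theorem sigma1_lt : sigma1 σ < 2 := by unfold sigma1; split_ifs <;> norm_num

theorem sigma2_lt : sigma2 σ < 2 := by unfold sigma2; split_ifs <;> norm_num

theorem eps_eq (l : ℕ) : eps σ l = (l + sigma1 σ + sigma2 σ) % 2 := by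
  unfold eps
  omega

theorem mem_Z_iff (l p : ℕ) : p ∈ Z σ l ↔ p % 2 = (l + sigma2 σ) % 2 ∧ p + eps σ l ≤ l := by
  have h := eps_eq σ l
  have h1 : eps σ l = 0 ∨ eps σ l = 1 := by omega
  unfold Z
  simp only [Set.mem_ofPred_eq, Int.ModEq]
  rcases h1 with h1 | h1
  · simp only [h1, if_true]
    omega
  · simp only [h1, one_ne_zero, if_false]
    omega

theorem dualVec_stdVec_nat {n j : ℕ} (hj : j ≤ n) (k : Fin (n + 1)) :
    dualVec n j (stdVec n k) = if j = (k : ℕ) then 1 else 0 := by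
  have := dualVec_stdVec n ⟨j, Nat.lt_succ_iff.2 hj⟩ k
  simpa [Fin.ext_iff] using this

theorem wVec_stdVec {l p : ℕ} (hp : p ≤ l) (k : Fin (2 * l + 1)) :
    wVec σ l p (stdVec (2 * l) k) = (if 2 * l - p = (k : ℕ) then 1 else 0) +
      (-1) ^ eps σ l * (if p = (k : ℕ) then 1 else 0) := by
  rw [wVec, LinearMap.add_apply, LinearMap.smul_apply, dualVec_stdVec_nat (by omega),
    dualVec_stdVec_nat (by omega), smul_eq_mul]

theorem neg_one_pow_eq {a b : ℕ} (h : a % 2 = b % 2) : (-1 : ℂ) ^ a = (-1) ^ b :=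
  neg_one_pow_congr (by rw [Nat.even_iff, Nat.even_iff, h])

theorem wVec_mem {l p : ℕ} (hp : p ∈ Z σ l) : wVec σ l p ∈ dualIso σ l := by
  rw [mem_Z_iff] at hp
  have he := eps_eq σ l
  rw [mem_dualIso_iff_stdVec]
  intro k
  have hk : (k : ℕ) ≤ 2 * l := Nat.lt_succ_iff.1 k.2
  have hr : (k.rev : ℕ) = 2 * l - k := by rw [Fin.val_rev]; omega
  have hE : (-1 : ℂ) ^ eps σ l * (-1) ^ eps σ l = 1 := by
    rw [← pow_add, neg_one_pow_eq (b := 0) (by omega), pow_zero]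
  rw [wVec_stdVec σ (by omega), wVec_stdVec σ (by omega), hr]
  have c1 : (2 * l - p = 2 * l - (k : ℕ)) ↔ p = k := by omega
  have c2 : (p = 2 * l - (k : ℕ)) ↔ 2 * l - p = k := by omega
  simp only [c1, c2]
  by_cases hpar : (k : ℕ) % 2 = p % 2
  · have h1 : (-1 : ℂ) ^ (l + k : ℕ) = (-1) ^ sigma2 σ := neg_one_pow_eq (by omega)
    -- Here `k ≡ l + σ₂` and `ε ≡ l + σ₁ + σ₂`, hence `k ≡ σ₁ + ε` modulo 2.
    have h2 : (-1 : ℂ) ^ (k : ℕ) = (-1) ^ sigma1 σ * (-1) ^ eps σ l := by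
      rw [← pow_add]
      exact neg_one_pow_eq (by omega)
    rw [h1, h2]
    refine ⟨rfl, ?_⟩
    linear_combination ((-1) ^ sigma1 σ * (if 2 * l - p = (k : ℕ) then 1 else 0)) * hE
  · have d1 : ¬ (p = (k : ℕ)) := by omega
    have d2 : ¬ (2 * l - p = (k : ℕ)) := by omega
    simp [d1, d2]

theorem inner_dualVec_left {n j : ℕ} (hj : j ≤ n) (w : Module.Dual ℂ (V n)) :
    inner ℂ (dualVec n j) w = (n.choose j : ℂ) * w (stdVec n ⟨j, Nat.lt_succ_iff.2 hj⟩) := by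
  rw [dual_inner_def, Finset.sum_eq_single ⟨j, Nat.lt_succ_iff.2 hj⟩]
  · simp [dualVec_stdVec_nat hj]
  · intro i _ hi
    have : ¬ (j = (i : ℕ)) := fun h => hi (Fin.ext h.symm)
    simp [dualVec_stdVec_nat hj, this]
  · simp

theorem inner_wVec {l p : ℕ} (hp : p ≤ l) (w : Module.Dual ℂ (V (2 * l))) :
    inner ℂ (wVec σ l p) w = ((2 * l).choose p : ℂ) *
      (w (stdVec (2 * l) ⟨2 * l - p, by omega⟩) +
        (-1) ^ eps σ l * w (stdVec (2 * l) ⟨p, by omega⟩)) := by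
  rw [wVec, inner_add_left, inner_smul_left, inner_dualVec_left (by omega),
    inner_dualVec_left (by omega), Nat.choose_symm (by omega)]
  simp
  ring

/-- For distinct `p, q ≤ l` the supports `{p, 2l - p}` and `{q, 2l - q}` are disjoint. -/
theorem inner_wVec_of_ne {l p q : ℕ} (hp : p ∈ Z σ l) (hq : q ∈ Z σ l) (h : p ≠ q) :
    inner ℂ (wVec σ l p) (wVec σ l q) = 0 := by
  rw [mem_Z_iff] at hp hq
  rw [inner_wVec σ (by omega), wVec_stdVec σ (by omega), wVec_stdVec σ (by omega)]
  have d1 : ¬ (2 * l - q = 2 * l - p) := by omega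
  have d2 : ¬ (q = 2 * l - p) := by omega
  have d3 : ¬ (2 * l - q = p) := by omega
  simp [d1, d2, d3, h.symm]

theorem wVec_ne_zero {l p : ℕ} (hp : p ∈ Z σ l) : wVec σ l p ≠ 0 := by
  rw [mem_Z_iff] at hp
  have he := eps_eq σ l
  intro h
  have h2 : wVec σ l p (stdVec (2 * l) ⟨2 * l - p, by omega⟩) = 0 := by
    rw [h, LinearMap.zero_apply]
  rw [wVec_stdVec σ (by omega)] at h2
  -- For `p = l` the two terms coincide; this index belongs to `Z(σ;l)` only if `ε = 0`, where they
  -- add up instead of cancelling.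
  by_cases hpl : p = l
  · have : eps σ l = 0 := by omega
    have d : p = 2 * l - p := by omega
    simp [this, ← d] at h2
  · have d : ¬ (p = 2 * l - p) := by omega
    simp [d] at h2

/-- The functionals `v_{2l-p}^* + (-1)^ε v_p^*` as elements of `V_{2l}^*[σ]`. -/
noncomputable def wIso (l : ℕ) (p : Z σ l) : dualIso σ l := ⟨wVec σ l p, wVec_mem σ p.2⟩

theorem linearIndependent_wIso (l : ℕ) : LinearIndependent ℂ (wIso σ l) := by
  refine linearIndependent_of_ne_zero_of_inner_eq_zero (fun p h => ?_) fun p q h => ?_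
  · exact wVec_ne_zero σ p.2 (congrArg Subtype.val h)
  · exact inner_wVec_of_ne σ p.2 q.2 fun h' => h (Subtype.ext h')

/-- Equivariance makes `w` vanish on the `v_k` of the wrong parity and symmetric up to the sign
`(-1)^ε` under `k ↦ 2l - k`. So `w` is determined by its values for `k ≤ l`, which are, up to
nonzero factors, its inner products with the given functionals. -/
theorem eq_zero_of_inner_wVec {l : ℕ} {w : Module.Dual ℂ (V (2 * l))} (hw : w ∈ dualIso σ l)
    (h : ∀ p ∈ Z σ l, inner ℂ (wVec σ l p) w = 0) : w = 0 := by
  rw [mem_dualIso_iff_stdVec] at hw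
  have he := eps_eq σ l
  have s1 := sigma1_lt σ
  have s2 := sigma2_lt σ
  have hrev : ∀ k : Fin (2 * l + 1), w (stdVec (2 * l) k) ≠ 0 →
      (k : ℕ) % 2 = (l + sigma2 σ) % 2 ∧
      w (stdVec (2 * l) k.rev) = (-1) ^ eps σ l * w (stdVec (2 * l) k) := by
    intro k hk
    have h1 := mul_right_cancel₀ hk (hw k).1
    have hpar : (k : ℕ) % 2 = (l + sigma2 σ) % 2 := by
      by_contra hne
      have : (-1 : ℂ) ^ (l + k : ℕ) = (-1) ^ (sigma2 σ + 1) := neg_one_pow_eq (by omega)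
      rw [this, pow_succ] at h1
      have hs : (-1 : ℂ) ^ sigma2 σ ≠ 0 := pow_ne_zero _ (by norm_num)
      have h3 := mul_left_cancel₀ hs (h1.trans (mul_one _).symm)
      norm_num at h3
    refine ⟨hpar, ?_⟩
    have h2 := (hw k).2
    have h3 : (-1 : ℂ) ^ (k : ℕ) * (-1) ^ (k : ℕ) = 1 := by
      rw [← pow_add, neg_one_pow_eq (b := 0) (by omega), pow_zero]
    have h4 : (-1 : ℂ) ^ eps σ l = (-1) ^ (k : ℕ) * (-1) ^ sigma1 σ := by
      rw [← pow_add]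
      exact neg_one_pow_eq (by omega)
    rw [h4]
    linear_combination (-1 : ℂ) ^ (k : ℕ) * h2 - w (stdVec (2 * l) k.rev) * h3
  have hE : (-1 : ℂ) ^ eps σ l * (-1) ^ eps σ l = 1 := by
    rw [← pow_add, neg_one_pow_eq (b := 0) (by omega), pow_zero]
  have hsmall : ∀ k : Fin (2 * l + 1), (k : ℕ) ≤ l → w (stdVec (2 * l) k) = 0 := by
    intro k hkl
    by_contra hne
    obtain ⟨hpar, hr⟩ := hrev k hne
    by_cases hkZ : (k : ℕ) ∈ Z σ l
    · have h1 := h k hkZ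
      rw [inner_wVec σ hkl] at h1
      have e1 : (⟨2 * l - k, by omega⟩ : Fin (2 * l + 1)) = k.rev :=
        Fin.ext (by rw [Fin.val_rev]; change 2 * l - (k : ℕ) = _; omega)
      have e2 : (⟨(k : ℕ), by omega⟩ : Fin (2 * l + 1)) = k := rfl
      rw [e1, e2, hr, ← two_mul] at h1
      have hs : (-1 : ℂ) ^ eps σ l ≠ 0 := pow_ne_zero _ (by norm_num)
      exact mul_ne_zero (choose_ne_zero_fin _ k) (mul_ne_zero two_ne_zero (mul_ne_zero hs hne)) h1
    -- The only index `k ≤ l` of the right parity outside `Z(σ;l)` is `k = l` with `ε = 1`, where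
    -- the antisymmetry forces the value to be its own negative.
    · rw [mem_Z_iff] at hkZ
      have e1 : k.rev = k := Fin.ext (by rw [Fin.val_rev]; omega)
      have e2 : eps σ l = 1 := by omega
      rw [e1, e2, pow_one, neg_one_mul] at hr
      exact hne (self_eq_neg.1 hr)
  refine (stdBasis (2 * l)).ext fun k => ?_
  rw [stdBasis_apply, LinearMap.zero_apply]
  by_cases hkl : (k : ℕ) ≤ l
  · exact hsmall k hkl
  · by_contra hne
    have h1 := (hrev k hne).2
    rw [hsmall k.rev (by rw [Fin.val_rev]; omega)] at h1
    have hs : (-1 : ℂ) ^ eps σ l ≠ 0 := pow_ne_zero _ (by norm_num)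
    exact mul_ne_zero hs hne h1.symm

theorem span_wIso (l : ℕ) : Submodule.span ℂ (Set.range (wIso σ l)) = ⊤ := by
  have : FiniteDimensional ℂ (Submodule.span ℂ (Set.range (wIso σ l))) :=
    FiniteDimensional.finiteDimensional_submodule _
  refine (Submodule.orthogonal_eq_bot_iff).1 ((Submodule.eq_bot_iff _).2 fun w hw => ?_)
  have h0 := (Submodule.mem_orthogonal _ _).1 hw
  refine Subtype.ext (eq_zero_of_inner_wVec σ w.2 fun p hp => ?_)
  have h1 := h0 (wIso σ l ⟨p, hp⟩) (Submodule.subset_span ⟨⟨p, hp⟩, rfl⟩)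
  rw [Submodule.coe_inner] at h1
  exact h1

/-- The basis of `V_{2l}^*[σ]` that is indexed by `Z(σ;l)`. -/
noncomputable def wBasis (l : ℕ) : Module.Basis (Z σ l) ℂ (dualIso σ l) :=
  Module.Basis.mk (linearIndependent_wIso σ l) (span_wIso σ l).ge

/-- With `r = (l + σ₂) % 2`, the indices are `2i + r ≤ l - ε`. Adding 2 before dividing keeps the
count `(l + 2 - ε - r) / 2` correct in natural numbers even when the set is empty. -/
theorem Z_eq_image (l : ℕ) : Z σ l =
    ((Finset.range ((l + 2 - eps σ l - (l + sigma2 σ) % 2) / 2)).image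
      fun i => 2 * i + (l + sigma2 σ) % 2 : Finset ℕ) := by
  have he := eps_eq σ l
  ext p
  rw [mem_Z_iff]
  simp only [Finset.coe_image, Finset.coe_range, Set.mem_image, Set.mem_Iio]
  constructor
  · rintro ⟨h1, h2⟩
    exact ⟨p / 2, by omega, by omega⟩
  · rintro ⟨i, hi, rfl⟩
    omega

theorem finrank_dualIso (l : ℕ) : Module.finrank ℂ (dualIso σ l) =
    (l + 2 - eps σ l - (l + sigma2 σ) % 2) / 2 := by
  rw [Module.finrank_eq_nat_card_basis (wBasis σ l), Nat.card_coe_set_eq, Z_eq_image,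
    Set.ncard_coe_finset, Finset.card_image_of_injective _ (fun a b h => by simpa using h),
    Finset.card_range]

theorem finrank_dualIso_eq (l : ℕ) : (Module.finrank ℂ (dualIso σ l) : ℚ) =
    if sigma1 σ = 0 ∧ sigma2 σ = 0 then
      (if Even l then ((l : ℚ) + 2) / 2 else ((l : ℚ) - 1) / 2)
    else
      (if Even l then (l : ℚ) / 2 else ((l : ℚ) + 1) / 2) := by
  have h1 := sigma1_lt σ
  have h2 := sigma2_lt σ
  have he := eps_eq σ l
  rw [finrank_dualIso]
  rcases Nat.even_or_odd' l with ⟨m, rfl | rfl⟩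
  · have hl : Even (2 * m) := even_two_mul m
    by_cases hs : sigma1 σ = 0 ∧ sigma2 σ = 0
    · rw [if_pos hs, if_pos hl,
        show (2 * m + 2 - eps σ (2 * m) - (2 * m + sigma2 σ) % 2) / 2 = m + 1 by omega]
      push_cast
      ring
    · rw [if_neg hs, if_pos hl,
        show (2 * m + 2 - eps σ (2 * m) - (2 * m + sigma2 σ) % 2) / 2 = m by omega]
      push_cast
      ring
  · have hl : ¬ Even (2 * m + 1) := by simp
    by_cases hs : sigma1 σ = 0 ∧ sigma2 σ = 0
    · rw [if_pos hs, if_neg hl,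
        show (2 * m + 1 + 2 - eps σ (2 * m + 1) - (2 * m + 1 + sigma2 σ) % 2) / 2 = m by omega]
      push_cast
      ring
    · rw [if_neg hs, if_neg hl,
        show (2 * m + 1 + 2 - eps σ (2 * m + 1) - (2 * m + 1 + sigma2 σ) % 2) / 2 = m + 1 by omega]
      push_cast
      ring

end

/-! ### The elementary functions and the isotypic components -/

section
variable (ν : LieA0 →ₗ[ℝ] ℂ) (σ : M0 →* ℂˣ)

/-- The intertwining operator `v ↦ r_K⁻¹ Φ_l(w ⊗ v)`. -/
noncomputable def psiInt (l : ℕ) (w : dualIso σ l) : (tau l).IntertwiningMap (piK ν σ) where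
  toLinearMap := Psi ν σ l ∘ₗ TensorProduct.mk ℂ (dualIso σ l) (V (2 * l)) w
  isIntertwining' k := by
    ext1 v
    exact (piK_Psi ν σ l k (w ⊗ₜ v)).symm

/-- The squared norm of the image is `‖w‖² ‖v‖² / (2l+1)`. -/
theorem Psi_tmul_eq_zero {l : ℕ} {w : dualIso σ l} {v : V (2 * l)}
    (h : Psi ν σ l (w ⊗ₜ v) = 0) : w = 0 ∨ v = 0 := by
  have h1 := inner_Psi ν σ l (w ⊗ₜ v) (w ⊗ₜ v)
  have hl : (2 * l + 1 : ℂ) ≠ 0 := by exact_mod_cast Nat.succ_ne_zero (2 * l)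
  rw [h, inner_zero_left, TensorProduct.inner_tmul] at h1
  rcases mul_eq_zero.1 ((mul_eq_zero.1 h1.symm).resolve_left (inv_ne_zero hl)) with h2 | h2
  · exact .inl (inner_self_eq_zero.1 h2)
  · exact .inr (inner_self_eq_zero.1 h2)

theorem psiInt_injective {l : ℕ} {w : dualIso σ l} (hw : w ≠ 0) :
    Function.Injective (psiInt ν σ l w) := by
  rw [injective_iff_map_eq_zero]
  intro v hv
  exact (Psi_tmul_eq_zero ν σ hv).resolve_left hw

theorem wIso_ne_zero {l : ℕ} (p : Z σ l) : wIso σ l p ≠ 0 := (linearIndependent_wIso σ l).ne_zero p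

theorem spanS_eq {l : ℕ} (p : Z σ l) :
    spanS ν σ l p = (psiInt ν σ l (wIso σ l p)).range.toSubmodule := by
  have h : elemFun ν σ l p = (psiInt ν σ l (wIso σ l p)).toLinearMap ∘ stdBasis (2 * l) := by
    ext1 q
    rw [Function.comp_apply, stdBasis_apply]
    rfl
  change _ = LinearMap.range (psiInt ν σ l (wIso σ l p)).toLinearMap
  rw [spanS, h, Set.range_comp, ← Submodule.map_span, Module.Basis.span_eq, LinearMap.range_eq_map]

/-- The spaces are pairwise orthogonal because the functionals `v_{2l-p}^* + (-1)^ε v_p^*` are. -/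
theorem iSupIndep_spanS (l : ℕ) : iSupIndep fun p : Z σ l => spanS ν σ l p := by
  refine OrthogonalFamily.independent (𝕜 := ℂ) ?_
  rintro p q hpq ⟨x, hx⟩ ⟨y, hy⟩
  change inner ℂ x y = 0
  rw [spanS_eq] at hx hy
  obtain ⟨v, rfl⟩ := hx
  obtain ⟨v', rfl⟩ := hy
  change inner ℂ (Psi ν σ l (wIso σ l p ⊗ₜ v)) (Psi ν σ l (wIso σ l q ⊗ₜ v')) = 0
  rw [inner_Psi, TensorProduct.inner_tmul]
  have : inner ℂ (wIso σ l p) (wIso σ l q) = 0 :=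
    inner_wVec_of_ne σ p.2 q.2 fun h => hpq (Subtype.ext h)
  rw [this, zero_mul, mul_zero]

theorem Psi_mem_iSup_spanS (l : ℕ) (w : dualIso σ l) (v : V (2 * l)) :
    Psi ν σ l (w ⊗ₜ v) ∈ ⨆ p : Z σ l, spanS ν σ l p := by
  have hw : w ∈ Submodule.span ℂ (Set.range (wIso σ l)) := span_wIso σ l ▸ trivial
  induction hw using Submodule.span_induction with
  | zero => rw [TensorProduct.zero_tmul, map_zero]; exact zero_mem _
  | add a b _ _ ha hb => rw [TensorProduct.add_tmul, map_add]; exact add_mem ha hb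
  | smul c a _ ha =>
    rw [← TensorProduct.smul_tmul', map_smul]
    exact Submodule.smul_mem _ _ ha
  | mem w hw =>
    obtain ⟨p, rfl⟩ := hw
    refine Submodule.mem_iSup_of_mem p ?_
    rw [spanS_eq]
    exact ⟨v, rfl⟩

/-- A subrepresentation isomorphic to `τ_{2l}` is the image of some `v ↦ r_K⁻¹ Φ_l(w ⊗ v)`, and `w`
expands in the functionals indexed by `Z(σ;l)`. Conversely, each `⟨S(l;p)⟩` is the range of an
injective intertwining operator. -/
theorem isotypic_eq (l : ℕ) : isotypic ν σ l = ⨆ p : Z σ l, spanS ν σ l p := by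
  refine le_antisymm (iSup_le ?_) (iSup_le fun p => ?_)
  · rintro ⟨W, ⟨e⟩⟩ u hu
    let T : V (2 * l) →ₗ[ℂ] PS ν σ := W.toSubmodule.subtype ∘ₗ e.toIntertwiningMap.toLinearMap
    obtain ⟨w, hw⟩ := exists_Psi_eq ν σ l T fun k v =>
      congrArg Subtype.val (Representation.IntertwiningMap.isIntertwining _ _ e.toIntertwiningMap k v)
    have hu' : u = T (e.symm ⟨u, hu⟩) :=
      (congrArg Subtype.val (e.apply_symm_apply ⟨u, hu⟩)).symm
    rw [hu', hw]
    exact Psi_mem_iSup_spanS ν σ l w _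
  · let f := psiInt ν σ l (wIso σ l p)
    have hf : Function.Injective f.toLinearMap := psiInt_injective ν σ (wIso_ne_zero σ p)
    let e : (tau l).Equiv f.range.toRepresentation :=
      Representation.Equiv.mk (LinearEquiv.ofInjective f.toLinearMap hf) fun k => by
        ext1 v
        exact Subtype.ext (Representation.IntertwiningMap.isIntertwining _ _ f k v)
    rw [spanS_eq]
    exact le_iSup (fun W : {W : Subrepresentation (piK ν σ) //
      Nonempty ((tau l).Equiv W.toRepresentation)} => W.1.toSubmodule) ⟨f.range, ⟨e⟩⟩

/-! ### Multiplicities -/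

/-- The orbit stays in the range of `Psi`, which is finite-dimensional and stable under `K`. -/
theorem Psi_mem_KFinite (l : ℕ) (t : dualIso σ l ⊗[ℂ] V (2 * l)) :
    Psi ν σ l t ∈ (KFinite ν σ).toSubmodule := by
  change FiniteDimensional ℂ (Submodule.span ℂ (Set.range fun k : K => piK ν σ k (Psi ν σ l t)))
  refine Submodule.finiteDimensional_of_le (Submodule.span_le.2 ?_ :
    _ ≤ LinearMap.range (Psi ν σ l))
  rintro _ ⟨k, rfl⟩
  exact ⟨_, (piK_Psi ν σ l k t).symm⟩

/-- The isomorphism of `V_{2l}^*[σ]` with the space of intertwining operators from `V_{2l}` to the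
`K`-finite part of `H_{(ν,σ)}`. -/
noncomputable def homKMap (l : ℕ) : dualIso σ l →ₗ[ℂ] HomK ν σ l where
  toFun w :=
    { toLinearMap := (psiInt ν σ l w).toLinearMap.codRestrict (KFinite ν σ).toSubmodule
        fun v => Psi_mem_KFinite ν σ l (w ⊗ₜ v)
      isIntertwining' := fun k => by
        ext1 v
        exact Subtype.ext (Representation.IntertwiningMap.isIntertwining _ _ (psiInt ν σ l w) k v) }
  map_add' a b := by
    apply Representation.IntertwiningMap.ext
    ext1 v
    refine Subtype.ext ?_
    change Psi ν σ l ((a + b) ⊗ₜ v) = Psi ν σ l (a ⊗ₜ v) + Psi ν σ l (b ⊗ₜ v)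
    rw [TensorProduct.add_tmul, map_add]
  map_smul' c a := by
    apply Representation.IntertwiningMap.ext
    ext1 v
    refine Subtype.ext ?_
    change Psi ν σ l ((c • a) ⊗ₜ v) = c • Psi ν σ l (a ⊗ₜ v)
    rw [← TensorProduct.smul_tmul', map_smul]

theorem homKMap_apply (l : ℕ) (w : dualIso σ l) (v : V (2 * l)) :
    (homKMap ν σ l w v : PS ν σ) = Psi ν σ l (w ⊗ₜ v) := rfl

/-- Surjectivity is the classification `exists_Psi_eq`, applied after forgetting `K`-finiteness; for
injectivity it suffices to evaluate at one nonzero vector. -/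
theorem homKMap_bijective (l : ℕ) : Function.Bijective (homKMap ν σ l) := by
  constructor
  · rw [injective_iff_map_eq_zero]
    intro w hw
    have h : Psi ν σ l (w ⊗ₜ stdVec (2 * l) 0) = 0 := by
      rw [← homKMap_apply, hw]
      rfl
    refine (Psi_tmul_eq_zero ν σ h).resolve_right ?_
    rw [← stdBasis_apply]
    exact (stdBasis (2 * l)).ne_zero 0
  · intro T
    obtain ⟨w, hw⟩ := exists_Psi_eq ν σ l ((KFinite ν σ).toSubmodule.subtype ∘ₗ T.toLinearMap)
      fun k v => congrArg Subtype.val (Representation.IntertwiningMap.isIntertwining _ _ T k v)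
    refine ⟨w, Representation.IntertwiningMap.ext ?_⟩
    ext1 v
    exact Subtype.ext (hw v).symm

/-- `homKMap` as a linear isomorphism. -/
noncomputable def homKEquiv (l : ℕ) : dualIso σ l ≃ₗ[ℂ] HomK ν σ l :=
  LinearEquiv.ofBijective (homKMap ν σ l) (homKMap_bijective ν σ l)

end

end SL3PS

theorem mainTheorem6 (ν : LieA0 →ₗ[ℝ] ℂ) (σ : M0 →* ℂˣ) :
    -- `K` acts on the Hilbert space `H_{(ν,σ)}` by a (strongly continuous) unitary representation
    (∀ (k : K) (u v : PS ν σ), inner ℂ (piK ν σ k u) (piK ν σ k v) = inner ℂ u v) ∧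
    (∀ u : PS ν σ, Continuous fun k : K => piK ν σ k u) ∧
    -- the isometry `r_K` is an isomorphism of `K`-modules from `H_{(ν,σ)}` onto `L²_{(M₀,σ)}(K)`
    LinearMap.range (rK ν σ).toLinearMap = L2sigma σ ∧
    (∀ (k : K) (u : PS ν σ),
      ∀ᵐ x ∂haarK, rK ν σ (piK ν σ k u) x = rK ν σ u (x * k)) ∧
    -- the map `r_K⁻¹ ∘ Φ_l` is well defined on `V_{2l}^*[σ] ⊗ V_{2l}`
    (∀ (l : ℕ) (t : dualIso σ l ⊗[ℂ] V (2 * l)),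
      rK ν σ (Psi ν σ l t) = Phi l (TensorProduct.map (dualIso σ l).subtype LinearMap.id t)) ∧
    -- the unitary representation of `K` on `H_{(ν,σ)}` is the Hilbert space direct sum of the
    -- `V_{2l}^*[σ] ⊗ V_{2l}`, by means of positive multiples of the maps `r_K⁻¹ ∘ Φ_l`,
    -- and the `τ_{2l}` are irreducible
    (∃ U : HilbertSum σ ≃ₗᵢ[ℂ] PS ν σ,
      (∀ (k : K) (x : HilbertSum σ) (l : ℕ),
        (U.symm (piK ν σ k (U x))) l = TensorProduct.map LinearMap.id (tau l k) (x l)) ∧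
      ∃ c : ℕ → ℝ, ∀ l : ℕ, 0 < c l ∧
        ∀ t : dualIso σ l ⊗[ℂ] V (2 * l), U (lp.single 2 l t) = (c l : ℂ) • Psi ν σ l t) ∧
    (∀ l : ℕ, (tau l).IsIrreducible) ∧
    -- for `p ∈ Z(σ;l)` the `s(l;p,q)` are the images of the standard basis under an injective
    -- `K`-homomorphism from `V_{2l}`, so that `⟨S(l;p)⟩` is isomorphic to `V_{2l}`
    (∀ l : ℕ, ∀ p ∈ Z σ l,
      ∃ η : (tau l).IntertwiningMap (piK ν σ), Function.Injective η ∧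
        ∀ q, η (stdVec (2 * l) q) = elemFun ν σ l p q) ∧
    -- the `τ_{2l}`-isotypic component is the direct sum of the `⟨S(l;p)⟩`, `p ∈ Z(σ;l)`
    (∀ l : ℕ, iSupIndep (fun p : Z σ l => spanS ν σ l p) ∧
      isotypic ν σ l = ⨆ p : Z σ l, spanS ν σ l p) ∧
    -- the multiplicity `d(σ;l) = dim Hom_K(V_{2l}, H_{(ν,σ),K})`
    (∀ l : ℕ, FiniteDimensional ℂ (HomK ν σ l) ∧
      (Module.finrank ℂ (HomK ν σ l) : ℚ) =
        if sigma1 σ = 0 ∧ sigma2 σ = 0 then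
          (if Even l then ((l : ℚ) + 2) / 2 else ((l : ℚ) - 1) / 2)
        else
          (if Even l then (l : ℚ) / 2 else ((l : ℚ) + 1) / 2)) := by
  refine ⟨inner_piK ν σ, continuous_piK ν σ, range_rK ν σ, ?_, rK_Psi ν σ,
    ⟨sumEquiv ν σ, sumEquiv_equivariant ν σ, fun l => √(2 * l + 1), fun l =>
      ⟨Real.sqrt_pos.2 (by positivity), sumEquiv_single ν σ l⟩⟩, tau_isIrreducible, ?_,
    fun l => ⟨iSupIndep_spanS ν σ l, isotypic_eq ν σ l⟩, fun l => ⟨?_, ?_⟩⟩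
  · intro k u
    rw [rK_piK]
    exact rTrans_ae k _
  · intro l p hp
    exact ⟨psiInt ν σ l (wIso σ l ⟨p, hp⟩), psiInt_injective ν σ (wIso_ne_zero σ _), fun q => rfl⟩
  · exact Module.Finite.equiv (homKEquiv ν σ l)
  · rw [← (homKEquiv ν σ l).finrank_eq]
    exact finrank_dualIso_eq σ l
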